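/- **Model.** An instance consists of $n\ge 2$ creators, reals $\mu>0$, $\alpha>0$, $\gamma\in[0,1]$, and cost functions $c_1,\dots,c_n:[0,\infty)\to\mathbb R$ that are non-decreasing, strictly convex, twice differentiable on $(0,\infty)$, with $c_i(0)=0$, $\lim_{x\to0^+}c_i'(x)=0$ and $\lim_{x\to\infty}c_i'(x)=\infty$. Creator $i$ chooses a quality $x_i\ge0$ and a sharing level $s_i\in[0,1]$. Put $X=\sum_j x_j$, $S=\sum_j x_js_j$, $T=\mu X^\gamma$. For $\rho\in[0,1]$ let $f_{i,\rho}=\rho\,x_is_i/S$ if $S>0$ and $f_{i,\rho}=0$ if $S=0$, and $f_{P,\rho}=1-\sum_i f_{i,\rho}$. Creator $i$'s utility and the platform's revenue are $$U_i(\mathbf x,\mathbf s;\rho)=T\frac{x_i}{X+\alpha S}+T\frac{\alpha S}{X+\alpha S}f_{i,\rho}-c_i(x_i),\qquad U_P(\mathbf x,\mathbf s;\rho)=T\frac{\alpha S}{X+\alpha S}f_{P,\rho}$$ (the attention shares are $0$ at $\mathbf x=\mathbf 0$). Let $\mathbf 1$ denote full sharing. The profile $(\mathbf x,\mathbf 1)$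 is an *$\varepsilon$-FSE* for $\rho$ if no creator gains more than $\varepsilon$ by a unilateral deviation $(x_i',s_i')\in[0,\infty)\times[0,1]$, and an *FSE* if this holds with $\varepsilon=0$. The profile $\mathbf x$ is an *ESE* for $\rho$ if at $(\mathbf x,\mathbf 1)$ no creator gains by changing the quality $x_i$ alone. Let $\mathrm{OPT}$ be the supremum of $U_P(\mathbf x,\mathbf 1;\rho)$ over all $\rho\in[0,1]$ and ESEs $\mathbf x$ for $\rho$ such that $(\mathbf x,\mathbf 1)$ is an FSE for $\rho$. **Algorithm 1** (instance, $\delta>0$, $\eta>0$). Start with $\hat\rho=0$, $\hat U=0$. For $t=1,\dots,\lceil1/\delta\rceil$: let $\rho=\min\{t/\lceil1/\delta\rceil,1\}$; find some $\mathbf x\ge\mathbf 0$ at Euclidean distance at most $\delta$ from the ESE for $\rho$; if $(\mathbf x,\mathbf 1)$ is an $\eta$-FSE for $\rho$ and $U_P(\mathbf x,\mathbf 1;\rho)>\hat U$, set $\hat U=U_P(\mathbf x,\mathbf 1;\rho)$ and $\hat\rho=\rho$. Return $\hat\rho$. (The choice of $\mathbf x$ is free, so the algorithm has several possible executions and outputs.)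 **Machine model.** A real RAM with real registers, real arrays and natural-number index registers. Each of the following takes one step: an arithmetic operation on reals, loading a rational constant, a comparison, copying, an increment or decrement of an index register, and the evaluation, at a computed argument $v \ge 0$, of $\mu v^\gamma$, of $c_i(v)$ or of $c_i'(v)$ (with $c_i'(0)=0$). **Theorem.** There is one program, the same for all instances, with the following property. Fix any instance with strongly convex costs; it is enough that for some $\beta>0$ every $c_i$ is $\beta$-strongly convex on $[0,x_i^{\max}]$, where $x_i^{\max}>0$ is the unique positive solution of $c_i(z)=\mu z^\gamma$. Then every $\rho\in[0,1]$ has a unique ESE $\mathcal X(\rho)$, $\mathrm{OPT}$ is the least upper bound of a nonempty bounded set, and there are constants $A,B>0$, depending only on the instance, such that for every $\varepsilon>0$, with $\delta=\varepsilon/A$ and $\eta=\varepsilon/4$: 1. the program, given $n,\mu,\alpha,\gamma,\delta,\eta$ and unit-cost access to the $c_i$ and $c_i'$, halts after at most $B\cdot\max\{1,A^2/\varepsilon^2\}$ steps (that is, $A^2B/\varepsilon^2$ for $\varepsilon\le A$), and what it returns is the output of an execution of Algorithm 1 with parameters $\delta,\eta$; 2. every possible output $\hat\rho$ of Algorithm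 1 with parameters $\delta,\eta$ lies in $[0,1]$, the profile $(\mathcal X(\hat\rho),\mathbf 1)$ is an $\varepsilon$-FSE for $\hat\rho$, and $U_P(\mathcal X(\hat\rho),\mathbf 1;\hat\rho)\ge\mathrm{OPT}-\varepsilon$. -/

import Mathlib

open Set Filter Topology

noncomputable section

namespace ContentGame

/-! ### The game -/

/-- An instance: `n ≥ 2` creators, traffic parameters `μ > 0` and `γ ∈ [0,1]`, data efficiency `α > 0`,
and one cost function on `[0,∞)` per creator (its values at negative arguments are never used). -/
structure Game where
  n : ℕ
  two_le_n : 2 ≤ n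
  μ : ℝ
  μ_pos : 0 < μ
  α : ℝ
  α_pos : 0 < α
  γ : ℝ
  γ_mem : γ ∈ Icc (0 : ℝ) 1
  cost : Fin n → ℝ → ℝ
  cost_mono : ∀ i, MonotoneOn (cost i) (Ici 0)
  cost_strictConvex : ∀ i, StrictConvexOn ℝ (Ici 0) (cost i)
  cost_diff : ∀ i, DifferentiableOn ℝ (cost i) (Ioi 0)
  cost_diff_two : ∀ i, DifferentiableOn ℝ (deriv (cost i)) (Ioi 0)
  cost_zero : ∀ i, cost i 0 = 0
  cost_deriv_zero : ∀ i, Tendsto (deriv (cost i)) (𝓝[>] 0) (𝓝 0)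
  cost_deriv_top : ∀ i, Tendsto (deriv (cost i)) atTop atTop

namespace Game

variable (G : Game)

/-- Strong convexity of the costs with a common modulus `β`. It is only required on `[0, z]`, where `z > 0`
is the (unique) quality with `c_i(z) = μ z ^ γ`, beyond which a creator's utility is negative. This is implied
by strong convexity on `[0,∞)`, and it also covers `c_i(x) = a x ^ θ` with `1 < θ ≤ 2`. -/
def StronglyConvexCosts : Prop :=
  ∃ β : ℝ, 0 < β ∧ ∀ i, ∀ z : ℝ, 0 < z → G.cost i z = G.μ * z ^ G.γ →
    StrongConvexOn (Icc 0 z) β (G.cost i)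

/-- Total content quality. On nonnegative profiles it is the `ℓ¹` norm. -/
def total (x : Fin G.n → ℝ) : ℝ := ∑ j, x j

/-- Total shared content. -/
def shared (x s : Fin G.n → ℝ) : ℝ := ∑ j, x j * s j

/-- Quality of the GenAI system. -/
def qAI (x s : Fin G.n → ℝ) : ℝ := G.α * G.shared x s

/-- User traffic. -/
def traffic (x : Fin G.n → ℝ) : ℝ := G.μ * G.total x ^ G.γ

open Classical in
/-- The fraction of the GenAI revenue that the proportional rule with parameter `ρ` gives to creator `i`. -/
def alloc (ρ : ℝ) (x s : Fin G.n → ℝ) (i : Fin G.n) : ℝ :=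
  if 0 < G.shared x s then ρ * (x i * s i / G.shared x s) else 0

/-- The fraction retained by the platform. -/
def allocPlatform (ρ : ℝ) (x s : Fin G.n → ℝ) : ℝ := 1 - ∑ i, G.alloc ρ x s i

/-- Utility of creator `i`. At the zero quality profile the attention shares `0 / 0` are `0`. -/
def utility (ρ : ℝ) (x s : Fin G.n → ℝ) (i : Fin G.n) : ℝ :=
  G.traffic x * (x i / (G.total x + G.qAI x s))
    + G.traffic x * (G.qAI x s / (G.total x + G.qAI x s)) * G.alloc ρ x s i
    - G.cost i (x i)

/-- Revenue of the platform. -/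
def revenue (ρ : ℝ) (x s : Fin G.n → ℝ) : ℝ :=
  G.traffic x * (G.qAI x s / (G.total x + G.qAI x s)) * G.allocPlatform ρ x s

/-- The full sharing profile. -/
def full : Fin G.n → ℝ := fun _ => 1

/-- `(x, 1)` is an `ε`-FSE in the subgame with parameter `ρ`: no unilateral deviation in quality and sharing
level gains more than `ε`. -/
def IsApproxFSE (ε ρ : ℝ) (x : Fin G.n → ℝ) : Prop :=
  (∀ i, 0 ≤ x i) ∧ ∀ i, ∀ x' : ℝ, 0 ≤ x' → ∀ s' ∈ Icc (0 : ℝ) 1,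
    G.utility ρ (Function.update x i x') (Function.update G.full i s') i ≤ G.utility ρ x G.full i + ε

/-- `(x, 1)` is a full sharing equilibrium. -/
def IsFSE (ρ : ℝ) (x : Fin G.n → ℝ) : Prop :=
  (∀ i, 0 ≤ x i) ∧ ∀ i, ∀ x' : ℝ, 0 ≤ x' → ∀ s' ∈ Icc (0 : ℝ) 1,
    G.utility ρ (Function.update x i x') (Function.update G.full i s') i ≤ G.utility ρ x G.full i

/-- `x` is an enforced sharing equilibrium: no deviation in quality alone is profitable when everybody
shares fully. -/
def IsESE (ρ : ℝ) (x : Fin G.n → ℝ) : Prop :=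
  (∀ i, 0 ≤ x i) ∧ ∀ i, ∀ x' : ℝ, 0 ≤ x' →
    G.utility ρ (Function.update x i x') G.full i ≤ G.utility ρ x G.full i

/-- The platform revenues attained by the parameters `ρ ∈ [0,1]` whose ESE is an FSE. -/
def feasibleRevenues : Set ℝ :=
  {u | ∃ ρ ∈ Icc (0 : ℝ) 1, ∃ x, G.IsESE ρ x ∧ G.IsFSE ρ x ∧ u = G.revenue ρ x G.full}

/-- The optimal value of the platform's problem. -/
def opt : ℝ := sSup G.feasibleRevenues

/-! ### The algorithm -/

/-- The `t`-th allocation parameter that is examined. -/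
def gridPoint (δ : ℝ) (t : ℕ) : ℝ := min ((t : ℝ) / (⌈1 / δ⌉₊ : ℝ)) 1

/-- `x` is a quality profile at Euclidean distance at most `δ` from the ESE for `ρ`. -/
def NearESE (δ ρ : ℝ) (x : Fin G.n → ℝ) : Prop :=
  (∀ i, 0 ≤ x i) ∧ ∃ z, G.IsESE ρ z ∧ dist (WithLp.toLp 2 x) (WithLp.toLp 2 z) ≤ δ

/-- `G.AlgState δ η t ρ' u` says that after `t` iterations the variables that hold the current best parameter
and the current best revenue can have the values `ρ'` and `u`. The profile `x` found in an iteration is an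
arbitrary one at distance at most `δ` from the ESE. -/
inductive AlgState (δ η : ℝ) : ℕ → ℝ → ℝ → Prop
  | start : AlgState δ η 0 0 0
  | update {t : ℕ} {ρ' u : ℝ} (x : Fin G.n → ℝ) :
      AlgState δ η t ρ' u →
      G.NearESE δ (gridPoint δ (t + 1)) x →
      (G.IsApproxFSE η (gridPoint δ (t + 1)) x ∧ u < G.revenue (gridPoint δ (t + 1)) x G.full) →
      AlgState δ η (t + 1) (gridPoint δ (t + 1)) (G.revenue (gridPoint δ (t + 1)) x G.full)
  | keep {t : ℕ} {ρ' u : ℝ} (x : Fin G.n → ℝ) :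
      AlgState δ η t ρ' u →
      G.NearESE δ (gridPoint δ (t + 1)) x →
      ¬ (G.IsApproxFSE η (gridPoint δ (t + 1)) x ∧ u < G.revenue (gridPoint δ (t + 1)) x G.full) →
      AlgState δ η (t + 1) ρ' u

/-- `ρ'` is returned by some execution of the algorithm with parameters `δ` and `η`. -/
def IsOutput (δ η ρ' : ℝ) : Prop := ∃ u, G.AlgState δ η ⌈1 / δ⌉₊ ρ' u

end Game

/-! ### The machine model: a real RAM with unit cost -/

/-- Memory: real registers, arrays of reals, and natural-number index registers. -/
structure Store where
  reg : ℕ → ℝ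
  arr : ℕ → ℕ → ℝ
  idx : ℕ → ℕ

/-- The places where a real number is kept: register `k`, or the cell of array `a` whose position is the
content of index register `j`. -/
inductive Loc
  | reg (k : ℕ)
  | cell (a j : ℕ)

namespace Store

def get (s : Store) : Loc → ℝ
  | .reg k => s.reg k
  | .cell a j => s.arr a (s.idx j)

def set (s : Store) : Loc → ℝ → Store
  | .reg k, v => { s with reg := Function.update s.reg k v }
  | .cell a j, v => { s with arr := Function.update s.arr a (Function.update (s.arr a) (s.idx j) v) }

def setIdx (s : Store) (j k : ℕ) : Store := { s with idx := Function.update s.idx j k }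

end Store

/-- The instructions, each of which takes one step: arithmetic on reals, evaluation of `v ↦ μ v ^ γ`, of the
cost function and of the marginal cost of the creator whose number is in index register `j`, and counting. -/
inductive Instr
  | const (d : Loc) (q : ℚ)
  | move (d a : Loc)
  | add (d a b : Loc)
  | sub (d a b : Loc)
  | mul (d a b : Loc)
  | div (d a b : Loc)
  | traffic (d a : Loc)
  | cost (d : Loc) (j : ℕ) (a : Loc)
  | marginal (d : Loc) (j : ℕ) (a : Loc)
  | idxConst (j k : ℕ)
  | idxMove (j i : ℕ)
  | idxSucc (j : ℕ)
  | idxPred (j : ℕ)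

/-- Cost of quality `v ≥ 0` for creator number `i` (counted from `0`). -/
def Game.costAt (G : Game) (i : ℕ) (v : ℝ) : ℝ :=
  if h : i < G.n then G.cost ⟨i, h⟩ (max v 0) else 0

open Classical in
/-- Marginal cost at `v ≥ 0` for creator number `i`. It is `0` at `v = 0`. -/
def Game.marginalAt (G : Game) (i : ℕ) (v : ℝ) : ℝ :=
  if h : i < G.n then (if 0 < v then deriv (G.cost ⟨i, h⟩) v else 0) else 0

/-- Effect of an instruction. -/
def Instr.exec (G : Game) (s : Store) : Instr → Store
  | .const d q => s.set d (q : ℝ)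
  | .move d a => s.set d (s.get a)
  | .add d a b => s.set d (s.get a + s.get b)
  | .sub d a b => s.set d (s.get a - s.get b)
  | .mul d a b => s.set d (s.get a * s.get b)
  | .div d a b => s.set d (s.get a / s.get b)
  | .traffic d a => s.set d (G.μ * (max (s.get a) 0) ^ G.γ)
  | .cost d j a => s.set d (G.costAt (s.idx j) (s.get a))
  | .marginal d j a => s.set d (G.marginalAt (s.idx j) (s.get a))
  | .idxConst j k => s.setIdx j k
  | .idxMove j i => s.setIdx j (s.idx i)
  | .idxSucc j => s.setIdx j (s.idx j + 1)
  | .idxPred j => s.setIdx j (s.idx j - 1)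

/-- Tests: comparison of two reals or of two index registers. -/
inductive Test
  | lt (a b : Loc)
  | idxLt (i j : ℕ)

def Test.Holds (s : Store) : Test → Prop
  | .lt a b => s.get a < s.get b
  | .idxLt i j => s.idx i < s.idx j

/-- Programs. -/
inductive Prog
  | skip
  | instr (c : Instr)
  | seq (p q : Prog)
  | ite (b : Test) (p q : Prog)
  | loop (b : Test) (p : Prog)

/-- `Runs G p s k s'`: started in `s` on the instance `G`, the program `p` halts in `s'` after `k` steps.
Every instruction and every evaluation of a test counts as one step. -/
inductive Runs (G : Game) : Prog → Store → ℕ → Store → Prop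
  | skip (s : Store) : Runs G .skip s 0 s
  | instr (c : Instr) (s : Store) : Runs G (.instr c) s 1 (c.exec G s)
  | seq {p q : Prog} {s s' s'' : Store} {k l : ℕ} :
      Runs G p s k s' → Runs G q s' l s'' → Runs G (.seq p q) s (k + l) s''
  | ite_true {b : Test} {p q : Prog} {s s' : Store} {k : ℕ} :
      b.Holds s → Runs G p s k s' → Runs G (.ite b p q) s (k + 1) s'
  | ite_false {b : Test} {p q : Prog} {s s' : Store} {k : ℕ} :
      ¬ b.Holds s → Runs G q s k s' → Runs G (.ite b p q) s (k + 1) s'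
  | loop_done {b : Test} {p : Prog} {s : Store} :
      ¬ b.Holds s → Runs G (.loop b p) s 1 s
  | loop_step {b : Test} {p : Prog} {s s' s'' : Store} {k l : ℕ} :
      b.Holds s → Runs G p s k s' → Runs G (.loop b p) s' l s'' → Runs G (.loop b p) s (k + l + 1) s''

/-- Programs are deterministic, so the final memory and the number of steps are functions of the input. -/
theorem Runs.deterministic {G : Game} {p : Prog} {s s₁ s₂ : Store} {k₁ k₂ : ℕ}
    (h₁ : Runs G p s k₁ s₁) (h₂ : Runs G p s k₂ s₂) : k₁ = k₂ ∧ s₁ = s₂ := by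
  induction h₁ generalizing k₂ s₂ with
  | skip s => cases h₂; exact ⟨rfl, rfl⟩
  | instr c s => cases h₂; exact ⟨rfl, rfl⟩
  | seq _ _ ih1 ih2 =>
    cases h₂ with
    | seq a b =>
      obtain ⟨rfl, rfl⟩ := ih1 a
      obtain ⟨rfl, rfl⟩ := ih2 b
      exact ⟨rfl, rfl⟩
  | ite_true hb _ ih =>
    cases h₂ with
    | ite_true _ a => obtain ⟨rfl, rfl⟩ := ih a; exact ⟨rfl, rfl⟩
    | ite_false hb' _ => exact absurd hb hb'
  | ite_false hb _ ih =>
    cases h₂ with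
    | ite_true hb' _ => exact absurd hb' hb
    | ite_false _ a => obtain ⟨rfl, rfl⟩ := ih a; exact ⟨rfl, rfl⟩
  | loop_done hb =>
    cases h₂ with
    | loop_done _ => exact ⟨rfl, rfl⟩
    | loop_step hb' _ _ => exact absurd hb' hb
  | loop_step hb _ _ ih1 ih2 =>
    cases h₂ with
    | loop_done hb' => exact absurd hb hb'
    | loop_step _ a b =>
      obtain ⟨rfl, rfl⟩ := ih1 a
      obtain ⟨rfl, rfl⟩ := ih2 b
      exact ⟨rfl, rfl⟩

/-- The memory at the start: registers `0` to `4` hold `δ`, `η`, `μ`, `α`, `γ`, index register `0` holds `n`,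
and everything else is `0`. -/
def Game.input (G : Game) (δ η : ℝ) : Store where
  reg := fun k => match k with
    | 0 => δ
    | 1 => η
    | 2 => G.μ
    | 3 => G.α
    | 4 => G.γ
    | _ => 0
  arr := fun _ _ => 0
  idx := fun j => if j = 0 then G.n else 0

end ContentGame

end

/-! Equilibria. Under full sharing a creator with quality x in a total X earns κ x X^(γ-1), where κ
= μ(1+αρ)/(1+α). This is concave in the own quality, so an ESE is the same thing as a positive
solution of the first-order conditions c_i'(z_i) = κ Φ(X, z_i). For a prescribed total X each
condition has one root, continuous in X, and an intermediate value argument for the sum of the roots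
gives existence. The share of a root in the total falls as the total grows; strong convexity makes
this quantitative (`FOC.rate`). Shares of a profile sum to 1, so adding these bounds over the
creators gives uniqueness, Lipschitz dependence on ρ (`exists_lipschitz_ESE`) and control of inexact
bisection (`exists_total_le_of_bracket`).

Guarantees. Revenue and gains from deviations are Lipschitz on the compact range that contains all
equilibria, and qualities beyond a fixed M cost more than they can earn. Hence a grid point near any
feasible ρ passes the test and loses O(δ) of revenue, while an accepted profile is within δ of an
equilibrium that inherits its properties. Some ρ < 1 is feasible with positive revenue
(`exists_isFSE`), so for small δ the initial value 0 is overwritten; for large ε the claims are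
trivial.

Program. The acceptance test is an exact inequality, but the profile may be chosen freely within δ
of the ESE. The program computes a profile l much closer than r, with r of order δ, and tests it
with a safety margin of order r². If all creators pass, l is an η-FSE. If creator i fails, her
quality is lowered by r: the payoffs of her deviations depend only on the others and stay the same,
whereas by strong convexity her own utility falls by almost β r²/8, more than margin and errors
(`utility_drop`). The lowered profile then certainly is not an η-FSE, and the algorithm may use it
(`exists_decidesApproxFSE`).

Running time. Errors of order r² must cost only O(1/r) steps. In the sharing level only s = 0 and s
= 1 matter; s = 1 is controlled by the closeness to the ESE. For s = 0 a grid is scanned: the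
derivative vanishes at the maximiser, so spacing h costs O(h²) plus a term from the variation of the
marginal cost. The steps shrink where the marginal cost rises, and their number telescopes
(`scan_spec`). The two nested bisections take O(1/r) steps as well, and O(1/δ) iterations give the
bound. The constants of the instance are unknown to the program; it only reads off A = 4η/δ, and the
analysis holds for every sufficiently large A. -/

noncomputable section

namespace ContentGame

/-! ### Cost functions and marginal costs -/

namespace Game

/-- Marginal cost, extended by `0` to nonpositive arguments. -/
def mc (G : Game) (i : Fin G.n) (x : ℝ) : ℝ := if 0 < x then deriv (G.cost i) x else 0

variable (G : Game) (i : Fin G.n)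

lemma mc_of_pos {x : ℝ} (hx : 0 < x) : G.mc i x = deriv (G.cost i) x := if_pos hx

@[simp] lemma mc_zero : G.mc i 0 = 0 := if_neg (lt_irrefl 0)

lemma hasDerivAt_cost {x : ℝ} (hx : 0 < x) : HasDerivAt (G.cost i) (G.mc i x) x := by
  rw [mc_of_pos G i hx]
  exact ((G.cost_diff i).differentiableAt (Ioi_mem_nhds hx)).hasDerivAt

lemma cost_nonneg {x : ℝ} (hx : 0 ≤ x) : 0 ≤ G.cost i x := by
  have := G.cost_mono i (mem_Ici.2 le_rfl) (mem_Ici.2 hx) hx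
  rwa [G.cost_zero i] at this

lemma cost_ge_tangent_of_pos {x y : ℝ} (hx : 0 < x) (hy : 0 ≤ y) :
    G.cost i x + G.mc i x * (y - x) ≤ G.cost i y := by
  have hc := (G.cost_strictConvex i).convexOn
  rcases lt_trichotomy x y with h | rfl | h
  · have := hc.le_slope_of_hasDerivAt (mem_Ici.2 hx.le) (mem_Ici.2 hy) h (G.hasDerivAt_cost i hx)
    rw [slope_def_field, le_div_iff₀ (by linarith)] at this
    linarith
  · simp
  · have := hc.slope_le_of_hasDerivAt (mem_Ici.2 hy) (mem_Ici.2 hx.le) h (G.hasDerivAt_cost i hx)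
    rw [slope_def_field, div_le_iff₀ (by linarith)] at this
    linarith

lemma cost_ge_tangent {x y : ℝ} (hx : 0 ≤ x) (hy : 0 ≤ y) :
    G.cost i x + G.mc i x * (y - x) ≤ G.cost i y := by
  rcases hx.eq_or_lt with rfl | hx
  · simpa [G.cost_zero i] using G.cost_nonneg i hy
  · exact G.cost_ge_tangent_of_pos i hx hy

/-- The tangent bound at the midpoint of x and y, combined with strict convexity there, excludes
equality. -/
lemma cost_gt_tangent {x y : ℝ} (hx : 0 < x) (hy : 0 ≤ y) (h : y ≠ x) :
    G.cost i x + G.mc i x * (y - x) < G.cost i y := by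
  have h1 := G.cost_ge_tangent_of_pos i hx (y := (x + y) / 2) (by linarith)
  have h2 := (G.cost_strictConvex i).2 (mem_Ici.2 hx.le) (mem_Ici.2 hy) h.symm
    (show (0 : ℝ) < 1 / 2 by norm_num) (show (0 : ℝ) < 1 / 2 by norm_num) (by norm_num)
  simp only [smul_eq_mul] at h2
  rw [show 1 / 2 * x + 1 / 2 * y = (x + y) / 2 by ring] at h2
  nlinarith

lemma mc_strictMonoOn : StrictMonoOn (G.mc i) (Ici 0) := by
  intro x hx y hy hxy
  have hx : 0 ≤ x := hx
  have h1 := G.cost_gt_tangent i (hx.trans_lt hxy) hx hxy.ne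
  have h2 := G.cost_ge_tangent i hx (hx.trans hxy.le)
  by_contra hcon
  push Not at hcon
  nlinarith

lemma mc_mono : Monotone (G.mc i) := by
  intro x y hxy
  rcases le_or_gt x 0 with hx | hx
  · have h0 : G.mc i x = 0 := if_neg (not_lt.2 hx)
    rw [h0]
    rcases le_or_gt y 0 with hy | hy
    · exact (if_neg (not_lt.2 hy)).ge
    · simpa using ((G.mc_strictMonoOn i) (mem_Ici.2 le_rfl) (mem_Ici.2 hy.le) hy).le
  · exact (G.mc_strictMonoOn i).monotoneOn (mem_Ici.2 hx.le) (mem_Ici.2 (hx.le.trans hxy)) hxy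

lemma mc_nonneg (x : ℝ) : 0 ≤ G.mc i x := by
  rcases le_or_gt x 0 with hx | hx
  · exact (if_neg (not_lt.2 hx)).ge
  · simpa using G.mc_mono i hx.le

lemma continuous_mc : Continuous (G.mc i) := by
  rw [continuous_iff_continuousAt]
  intro x
  rcases lt_trichotomy x 0 with hx | rfl | hx
  · have : G.mc i =ᶠ[𝓝 x] fun _ => 0 := by
      filter_upwards [Iio_mem_nhds hx] with y hy
      exact if_neg (not_lt.2 (le_of_lt hy))
    exact this.continuousAt
  · rw [continuousAt_iff_continuous_left_right]
    constructor
    · have : ContinuousWithinAt (fun _ : ℝ => (0 : ℝ)) (Iic 0) 0 := continuousWithinAt_const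
      exact this.congr (fun y hy => if_neg (not_lt.2 hy)) (mc_zero G i)
    · rw [← continuousWithinAt_Ioi_iff_Ici, ContinuousWithinAt, mc_zero]
      refine (G.cost_deriv_zero i).congr' ?_
      filter_upwards [self_mem_nhdsWithin] with y hy
      exact (mc_of_pos G i hy).symm
  · have h := ((G.cost_diff_two i).differentiableAt (Ioi_mem_nhds hx)).continuousAt
    refine h.congr ?_
    filter_upwards [Ioi_mem_nhds hx] with y hy
    exact (mc_of_pos G i hy).symm

lemma tendsto_mc_atTop : Tendsto (G.mc i) atTop atTop := by
  refine (G.cost_deriv_top i).congr' ?_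
  filter_upwards [eventually_gt_atTop 0] with y hy
  exact (mc_of_pos G i hy).symm

lemma cost_le_mul_mc {x : ℝ} (hx : 0 ≤ x) : G.cost i x ≤ x * G.mc i x := by
  have := G.cost_ge_tangent i hx le_rfl
  rw [G.cost_zero i] at this
  linarith

lemma cost_lt_mul_mc {x : ℝ} (hx : 0 < x) : G.cost i x < x * G.mc i x := by
  have := G.cost_gt_tangent i hx le_rfl hx.ne
  rw [G.cost_zero i] at this
  linarith

lemma continuousOn_cost : ContinuousOn (G.cost i) (Ici 0) := by
  intro x hx
  rcases (mem_Ici.1 hx).eq_or_lt with rfl | hx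
  · rw [ContinuousWithinAt, G.cost_zero i]
    have h : Tendsto (fun y => y * G.mc i y) (𝓝[Ici 0] 0) (𝓝 0) := by
      have : Continuous fun y => y * G.mc i y := continuous_id.mul (G.continuous_mc i)
      simpa using (this.tendsto 0).mono_left nhdsWithin_le_nhds
    refine tendsto_of_tendsto_of_tendsto_of_le_of_le' tendsto_const_nhds h ?_ ?_
    · filter_upwards [self_mem_nhdsWithin] with y hy using G.cost_nonneg i hy
    · filter_upwards [self_mem_nhdsWithin] with y hy using G.cost_le_mul_mc i hy
  · exact (G.hasDerivAt_cost i hx).continuousAt.continuousWithinAt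

lemma abs_cost_sub_le {M x y : ℝ} (hx : 0 ≤ x) (hy : 0 ≤ y) (hxM : x ≤ M) (hyM : y ≤ M) :
    |G.cost i x - G.cost i y| ≤ G.mc i M * |x - y| := by
  wlog h : y ≤ x generalizing x y
  · rw [abs_sub_comm, abs_sub_comm x]
    exact this hy hx hyM hxM (le_of_not_ge h)
  rw [abs_of_nonneg (sub_nonneg.2 (G.cost_mono i hy hx h)), abs_of_nonneg (sub_nonneg.2 h)]
  have h1 := G.cost_ge_tangent i hx hy
  have h2 := G.mc_mono i hxM
  nlinarith

/-- Beyond some quality, the cost of every creator exceeds the largest conceivable traffic. -/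
lemma exists_cost_ge_traffic :
    ∃ M : ℝ, 1 ≤ M ∧ ∀ i, ∀ x, M ≤ x → G.μ * x ^ G.γ ≤ G.cost i x := by
  have h : ∀ᶠ x in atTop, ∀ i, 2 * G.μ ≤ G.mc i x :=
    eventually_all.2 fun i => (G.tendsto_mc_atTop i).eventually_ge_atTop _
  obtain ⟨M, hM⟩ := (h.and (eventually_ge_atTop 1)).exists_forall_of_atTop
  have hM1 : 1 ≤ M := (hM M le_rfl).2
  -- From M on the slope is at least 2μ, so for x ≥ 2M the cost is at least 2μ(x - M) ≥ μ x ≥ μ x^γ.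
  refine ⟨2 * M, by linarith, fun i x hx => ?_⟩
  have h1 := G.cost_ge_tangent i (x := M) (y := x) (by linarith) (by linarith)
  have h2 := (hM M le_rfl).1 i
  have h3 := G.cost_nonneg i (x := M) (by linarith)
  have h4 : x ^ G.γ ≤ x := by
    simpa using Real.rpow_le_rpow_of_exponent_le (x := x) (by linarith) G.γ_mem.2
  have h5 := G.μ_pos
  have h6 : G.μ * x ^ G.γ ≤ G.μ * x := by gcongr
  nlinarith [mul_le_mul_of_nonneg_right h2 (show 0 ≤ x - M by linarith)]

/-- Strong convexity is available below every quality whose cost is less than the largest traffic that the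
creator could generate alone. -/
lemma exists_strong_tangent (hG : G.StronglyConvexCosts) :
    ∃ β : ℝ, 0 < β ∧ ∀ i, ∀ v : ℝ, 0 < v → G.cost i v < G.μ * v ^ G.γ →
      ∀ x, 0 < x → x ≤ v → ∀ y, 0 ≤ y → y ≤ v →
        G.cost i x + G.mc i x * (y - x) + β / 2 * (y - x) ^ 2 ≤ G.cost i y := by
  obtain ⟨β, hβ, H⟩ := hG
  refine ⟨β, hβ, fun i v hv hcv x hx hxv y hy hyv => ?_⟩
  obtain ⟨M, hM1, hM⟩ := G.exists_cost_ge_traffic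
  have hvM : v ≤ M := by
    by_contra! hcon
    exact absurd (hM i v hcon.le) (not_le.2 hcv)
  -- Strong convexity is given only on [0, z] for a z where cost equals traffic. Cost is below
  -- traffic at v and not below it at M, so such a z exists between them.
  have hcont : ContinuousOn (fun z => G.cost i z - G.μ * z ^ G.γ) (Icc v M) := by
    refine ((G.continuousOn_cost i).mono fun z hz => hv.le.trans hz.1).sub ?_
    exact continuousOn_const.mul (continuousOn_id.rpow_const fun z hz => Or.inl (hv.trans_le hz.1).ne')
  obtain ⟨z, hz, hz0⟩ := intermediate_value_Icc hvM hcont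
    (show (0 : ℝ) ∈ Icc _ _ from ⟨by simpa using hcv.le, by simpa using hM i M le_rfl⟩)
  have hz0 : G.cost i z = G.μ * z ^ G.γ := sub_eq_zero.1 hz0
  have hvz : v < z := lt_of_le_of_ne hz.1 (by rintro rfl; exact hcv.ne hz0)
  have hc := strongConvexOn_iff_convex.1 (H i z (hv.trans hvz) hz0)
  have hd : HasDerivAt (fun t => G.cost i t - β / 2 * ‖t‖ ^ 2) (G.mc i x - β * x) x := by
    have h1 : HasDerivAt (fun t : ℝ => G.cost i t - β / 2 * t ^ 2)
        (G.mc i x - β / 2 * (2 * x)) x := by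
      have h0 : HasDerivAt (fun t : ℝ => β / 2 * t ^ 2) (β / 2 * (2 * x)) x := by
        simpa using ((hasDerivAt_id x).fun_pow 2).const_mul (β / 2)
      exact (G.hasDerivAt_cost i hx).fun_sub h0
    convert h1 using 1
    · ext t; simp
    · ring
  have hxm : x ∈ Icc 0 z := ⟨hx.le, hxv.trans hvz.le⟩
  have hym : y ∈ Icc 0 z := ⟨hy, hyv.trans hvz.le⟩
  rcases lt_trichotomy x y with h | rfl | h
  · have := hc.le_slope_of_hasDerivAt hxm hym h hd
    rw [slope_def_field, le_div_iff₀ (by linarith)] at this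
    simp only [Real.norm_eq_abs, sq_abs] at this
    nlinarith
  · simp
  · have := hc.slope_le_of_hasDerivAt hym hxm h hd
    rw [slope_def_field, div_le_iff₀ (by linarith)] at this
    simp only [Real.norm_eq_abs, sq_abs] at this
    nlinarith

/-- `β` bounds the convexity of the costs from below on the relevant range. -/
def StrongModulus (β : ℝ) : Prop :=
  0 < β ∧ ∀ i, ∀ v : ℝ, 0 < v → G.cost i v < G.μ * v ^ G.γ →
      ∀ x, 0 < x → x ≤ v → ∀ y, 0 ≤ y → y ≤ v →
        G.cost i x + G.mc i x * (y - x) + β / 2 * (y - x) ^ 2 ≤ G.cost i y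

variable {G} {i}

/-- Sum of the strong tangent inequalities based at the two points. -/
lemma StrongModulus.mc_sub {β : ℝ} (h : G.StrongModulus β) {v x : ℝ} (hv : G.cost i v < G.μ * v ^ G.γ)
    (hx : 0 < x) (hxv : x ≤ v) : β * (v - x) ≤ G.mc i v - G.mc i x := by
  rcases hxv.eq_or_lt with rfl | hlt
  · simp
  have hv0 := hx.trans hlt
  have h1 := h.2 i v hv0 hv x hx hxv v hv0.le le_rfl
  have h2 := h.2 i v hv0 hv v hv0 le_rfl x hx.le hxv
  have h3 : (v - x) * (β * (v - x)) ≤ (v - x) * (G.mc i v - G.mc i x) := by nlinarith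
  exact le_of_mul_le_mul_left h3 (sub_pos.2 hlt)

end Game


/-! ### Tangent inequalities for powers -/

lemma rpow_le_tangent {p t T : ℝ} (hp : 0 ≤ p) (hp1 : p ≤ 1) (ht : 0 < t) (hT : 0 < T) :
    t ^ p ≤ T ^ p + p * T ^ (p - 1) * (t - T) := by
  have h := rpow_one_add_le_one_add_mul_self (s := t / T - 1)
    (by have := (div_pos ht hT).le; linarith) hp hp1
  rw [add_sub_cancel, Real.div_rpow ht.le hT.le, div_le_iff₀ (Real.rpow_pos_of_pos hT p)] at h
  rw [Real.rpow_sub_one hT.ne']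
  calc t ^ p ≤ (1 + p * (t / T - 1)) * T ^ p := h
    _ = _ := by field_simp

/-- Reciprocal of the concave bound for the exponent -p: with u the relative increment along the
tangent, that bound reads T^p ≤ t^p (1 - u), and (1 + u)(1 - u) ≤ 1. -/
lemma rpow_ge_tangent {p t T : ℝ} (hp : -1 ≤ p) (hp0 : p ≤ 0) (ht : 0 < t) (hT : 0 < T) :
    T ^ p + p * T ^ (p - 1) * (t - T) ≤ t ^ p := by
  have h := rpow_le_tangent (p := -p) (t := t) (T := T) (by linarith) (by linarith) ht hT
  have h1 : 0 < T ^ p := Real.rpow_pos_of_pos hT p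
  have h2 : 0 < t ^ p := Real.rpow_pos_of_pos ht p
  rw [Real.rpow_sub_one hT.ne', Real.rpow_neg ht.le, Real.rpow_neg hT.le] at h
  rw [Real.rpow_sub_one hT.ne']
  set u := p * ((t - T) / T) with hu
  have h3 : (t ^ p)⁻¹ ≤ (T ^ p)⁻¹ * (1 - u) := by
    calc (t ^ p)⁻¹ ≤ _ := h
      _ = _ := by rw [hu]; field_simp; ring
  have h4 : T ^ p ≤ t ^ p * (1 - u) := by
    have := mul_le_mul_of_nonneg_left h3 (mul_pos h1 h2).le
    calc T ^ p = T ^ p * t ^ p * (t ^ p)⁻¹ := by field_simp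
      _ ≤ _ := this
      _ = _ := by field_simp
  have h5 : T ^ p + p * (T ^ p / T) * (t - T) = T ^ p * (1 + u) := by rw [hu]; field_simp
  rw [h5]
  have h6 : 0 < 1 - u := by
    by_contra! hcon
    nlinarith
  rcases le_or_gt (1 + u) 0 with h7 | h7
  · nlinarith
  · nlinarith [sq_nonneg u]

/-! ### The revenue of a creator as a function of the own quality -/

namespace Game

variable (G : Game)

/-- Coefficient of the revenue of a creator under full sharing. -/
def kap (ρ : ℝ) : ℝ := G.μ * ((1 + G.α * ρ) / (1 + G.α))

/-- Derivative of `x ↦ x (a + x) ^ (γ - 1)` at `x = y`, where `X = a + y`. -/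
def Phi (X y : ℝ) : ℝ := X ^ (G.γ - 2) * (X - (1 - G.γ) * y)

/-- Revenue of a creator with quality `x` and sharing level `s` when the others share the quality `a`. -/
def dev (ρ a x s : ℝ) : ℝ :=
  G.μ * (a + x) ^ G.γ * (x * (1 + G.α * ρ * s) / (a + x + G.α * (a + x * s)))

variable {G}

lemma kap_pos {ρ : ℝ} (hρ : ρ ∈ Icc (0 : ℝ) 1) : 0 < G.kap ρ := by
  have h1 := G.α_pos
  have h2 := G.μ_pos
  have h3 : 0 ≤ G.α * ρ := mul_nonneg h1.le hρ.1
  unfold kap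
  positivity

lemma kap_le {ρ : ℝ} (hρ : ρ ∈ Icc (0 : ℝ) 1) : G.kap ρ ≤ G.μ := by
  have h1 := G.α_pos
  have h2 := G.μ_pos
  have h3 : (1 + G.α * ρ) / (1 + G.α) ≤ 1 := by
    rw [div_le_one (by linarith)]
    nlinarith [hρ.2]
  unfold kap
  nlinarith

lemma kap_zero_le {ρ : ℝ} (hρ : ρ ∈ Icc (0 : ℝ) 1) : G.kap 0 ≤ G.kap ρ := by
  have h1 := G.α_pos
  have h2 := G.μ_pos
  have h3 := hρ.1
  unfold kap
  gcongr

lemma abs_kap_sub (ρ ρ' : ℝ) : |G.kap ρ - G.kap ρ'| ≤ G.μ * |ρ - ρ'| := by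
  have h1 := G.α_pos
  have h2 := G.μ_pos
  have : G.kap ρ - G.kap ρ' = G.μ * (G.α / (1 + G.α)) * (ρ - ρ') := by
    unfold kap; field_simp; ring
  rw [this, abs_mul, abs_of_pos (by positivity)]
  have h3 : G.α / (1 + G.α) ≤ 1 := (div_le_one (by linarith)).2 (by linarith)
  gcongr
  nlinarith

lemma Phi_eq {X y : ℝ} (hX : 0 < X) :
    G.Phi X y = X ^ (G.γ - 1) * (1 - (1 - G.γ) * (y / X)) := by
  unfold Phi
  rw [show G.γ - 2 = G.γ - 1 - 1 by ring, Real.rpow_sub_one hX.ne' (G.γ - 1)]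
  field_simp

lemma Phi_anti {X y y' : ℝ} (hX : 0 < X) (h : y ≤ y') : G.Phi X y' ≤ G.Phi X y := by
  unfold Phi
  have := G.γ_mem.2
  have h1 : (1 - G.γ) * y ≤ (1 - G.γ) * y' := mul_le_mul_of_nonneg_left h (by linarith)
  gcongr

lemma Phi_le {X y : ℝ} (hX : 0 < X) (hy : 0 ≤ y) : G.Phi X y ≤ X ^ (G.γ - 1) := by
  have h := Phi_anti (G := G) hX hy
  rwa [Phi_eq hX (y := 0), zero_div, mul_zero, sub_zero, mul_one] at h

lemma hasDerivAt_share {a y : ℝ} (h : 0 < a + y) :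
    HasDerivAt (fun x => x * (a + x) ^ (G.γ - 1)) (G.Phi (a + y) y) y := by
  have h1 : HasDerivAt (fun x => (a + x) ^ (G.γ - 1)) ((G.γ - 1) * (a + y) ^ (G.γ - 1 - 1)) y := by
    simpa using ((hasDerivAt_id y).const_add a).rpow_const (p := G.γ - 1) (Or.inl h.ne')
  have h2 := (hasDerivAt_id y).fun_mul h1
  refine h2.congr_deriv ?_
  unfold Phi
  rw [show G.γ - 2 = G.γ - 1 - 1 by ring, Real.rpow_sub_one h.ne' (G.γ - 1)]
  simp only [id]
  field_simp
  ring

/-- The function equals (a + x)^γ - a (a + x)^(γ-1), a concave power minus a multiple of a convex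
one. -/
lemma share_le_tangent {a x y : ℝ} (ha : 0 ≤ a) (hx : 0 < a + x) (hy : 0 < a + y) :
    x * (a + x) ^ (G.γ - 1) ≤ y * (a + y) ^ (G.γ - 1) + G.Phi (a + y) y * (x - y) := by
  have hg := G.γ_mem
  have h1 := rpow_le_tangent hg.1 hg.2 hx hy
  have h2 := rpow_ge_tangent (p := G.γ - 1) (by linarith [hg.1]) (by linarith [hg.2]) hx hy
  have e (t : ℝ) (ht : 0 < a + t) : t * (a + t) ^ (G.γ - 1) = (a + t) ^ G.γ - a * (a + t) ^ (G.γ - 1) := by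
    rw [Real.rpow_sub_one ht.ne' G.γ]; field_simp; ring
  rw [e x hx, e y hy]
  have h3 : G.Phi (a + y) y = G.γ * (a + y) ^ (G.γ - 1) - a * ((G.γ - 1) * (a + y) ^ (G.γ - 1 - 1)) := by
    unfold Phi
    rw [show G.γ - 2 = G.γ - 1 - 1 by ring, Real.rpow_sub_one hy.ne' (G.γ - 1)]
    field_simp
    ring
  rw [h3]
  nlinarith [mul_le_mul_of_nonneg_left h2 ha]

/-! ### Utilities -/

lemma total_update (x : Fin G.n → ℝ) (i : Fin G.n) (y : ℝ) :
    G.total (Function.update x i y) = G.total x - x i + y := by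
  unfold total
  rw [Finset.sum_update_of_mem (Finset.mem_univ i), ← Finset.add_sum_erase _ x (Finset.mem_univ i),
    Finset.sdiff_singleton_eq_erase]
  ring

lemma shared_update (x : Fin G.n → ℝ) (i : Fin G.n) (y s : ℝ) :
    G.shared (Function.update x i y) (Function.update G.full i s) = G.total x - x i + y * s := by
  have : G.shared (Function.update x i y) (Function.update G.full i s)
      = G.total (Function.update x i (y * s)) := by
    unfold shared total
    refine Finset.sum_congr rfl fun j _ => ?_
    by_cases h : j = i
    · subst h; simp
    · simp [h, full]
  rw [this, total_update]

lemma update_full_one (i : Fin G.n) : Function.update G.full i 1 = G.full :=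
  Function.update_eq_self i G.full

lemma utility_update {ρ : ℝ} {x : Fin G.n → ℝ} {i : Fin G.n} {y s : ℝ}
    (hy : 0 ≤ y) (hs : s ≤ 1) (h : 0 < G.total x - x i + y * s) :
    G.utility ρ (Function.update x i y) (Function.update G.full i s) i
      = G.dev ρ (G.total x - x i) y s - G.cost i y := by
  have h1 := G.α_pos
  have h2 : 0 < G.total x - x i + y := h.trans_le (by nlinarith)
  have h3 : 0 < G.total x - x i + y + G.α * (G.total x - x i + y * s) := by positivity
  unfold utility traffic alloc qAI dev
  rw [shared_update, total_update, if_pos h]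
  simp only [Function.update_self]
  field_simp

lemma utility_update_full {ρ : ℝ} {x : Fin G.n → ℝ} {i : Fin G.n} {y : ℝ}
    (hy : 0 ≤ y) (h : 0 < G.total x - x i + y) :
    G.utility ρ (Function.update x i y) G.full i
      = G.dev ρ (G.total x - x i) y 1 - G.cost i y := by
  have := utility_update (ρ := ρ) (x := x) (i := i) hy le_rfl (by simpa using h)
  rwa [update_full_one] at this

lemma utility_full {ρ : ℝ} {x : Fin G.n → ℝ} {i : Fin G.n}
    (hy : 0 ≤ x i) (h : 0 < G.total x) :
    G.utility ρ x G.full i = G.dev ρ (G.total x - x i) (x i) 1 - G.cost i (x i) := by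
  have := utility_update_full (ρ := ρ) (x := x) (i := i) hy (by simpa using h)
  rwa [Function.update_eq_self] at this

lemma utility_of_eq_zero {ρ : ℝ} {x s : Fin G.n → ℝ} {i : Fin G.n} (h : x i = 0) :
    G.utility ρ x s i = 0 := by
  unfold utility alloc
  simp [h, G.cost_zero i]

lemma dev_one {ρ a x : ℝ} (h : 0 < a + x) :
    G.dev ρ a x 1 = G.kap ρ * (x * (a + x) ^ (G.γ - 1)) := by
  have h1 := G.α_pos
  have h2 : a + x + G.α * (a + x) ≠ 0 := by positivity
  unfold dev kap
  have h3 : a + x + G.α * (a + x) = (1 + G.α) * (a + x) := by ring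
  rw [Real.rpow_sub_one h.ne', mul_one, mul_one, h3]
  field_simp

lemma apply_le_total {x : Fin G.n → ℝ} (h : ∀ i, 0 ≤ x i) (i : Fin G.n) : x i ≤ G.total x :=
  Finset.single_le_sum (fun i _ => h i) (Finset.mem_univ i)

lemma exists_ne_index (i : Fin G.n) : ∃ j, j ≠ i := by
  have : Nontrivial (Fin G.n) := Fin.nontrivial_iff_two_le.2 G.two_le_n
  exact exists_ne i

lemma add_le_total {x : Fin G.n → ℝ} (h : ∀ i, 0 ≤ x i) {i j : Fin G.n} (hij : j ≠ i) :
    x j ≤ G.total x - x i := by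
  have h1 := total_update x i 0
  have h2 := apply_le_total (x := Function.update x i 0) (fun k => by
    by_cases hk : k = i
    · subst hk; simp
    · simp [hk, h k]) j
  rw [h1] at h2
  simpa [hij] using h2

/-! ### Equilibria under full sharing -/

variable (G) in
/-- First-order conditions for an equilibrium under full sharing. -/
def FOC (κ : ℝ) (z : Fin G.n → ℝ) : Prop :=
  (∀ i, 0 < z i) ∧ ∀ i, G.mc i (z i) = κ * G.Phi (G.total z) (z i)

lemma FOC.total_pos {κ : ℝ} {z : Fin G.n → ℝ} (h : G.FOC κ z) : 0 < G.total z :=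
  (h.1 ⟨0, by linarith [G.two_le_n]⟩).trans_le (apply_le_total (fun i => (h.1 i).le) _)

lemma FOC.others_pos {κ : ℝ} {z : Fin G.n → ℝ} (h : G.FOC κ z) (i : Fin G.n) :
    0 < G.total z - z i := by
  obtain ⟨j, hj⟩ := exists_ne_index i
  exact (h.1 j).trans_le (add_le_total (fun i => (h.1 i).le) hj)

/-- Concave revenue and convex cost make the first-order condition sufficient for a global maximum.
-/
lemma FOC.isESE {ρ : ℝ} (hρ : ρ ∈ Icc (0 : ℝ) 1) {z : Fin G.n → ℝ} (h : G.FOC (G.kap ρ) z) :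
    G.IsESE ρ z := by
  refine ⟨fun i => (h.1 i).le, fun i x hx => ?_⟩
  have ha := h.others_pos i
  have hX := h.total_pos
  rw [utility_update_full hx (by linarith), utility_full (h.1 i).le hX, dev_one (by linarith),
    dev_one (by linarith)]
  have h1 := share_le_tangent (G := G) (x := x) (y := z i) ha.le (by linarith) (by linarith)
  rw [sub_add_cancel] at h1 ⊢
  have h2 := G.cost_ge_tangent i (h.1 i).le hx
  rw [h.2 i] at h2
  have h3 := mul_le_mul_of_nonneg_left h1 (kap_pos (G := G) hρ).le
  linarith

/-- Quality 0 earns 0. A small quality x earns at least κ (a+1)^(γ-1) per unit and costs at most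
c'(x) per unit, which tends to 0. -/
lemma IsESE.pos {ρ : ℝ} (hρ : ρ ∈ Icc (0 : ℝ) 1) {z : Fin G.n → ℝ} (h : G.IsESE ρ z) (i : Fin G.n) :
    0 < z i := by
  refine lt_of_le_of_ne (h.1 i) fun h0 => ?_
  set a := G.total z - z i with ha
  have ha0 : 0 ≤ a := sub_nonneg.2 (apply_le_total h.1 i)
  have hk := kap_pos (G := G) hρ
  have hc : 0 < G.kap ρ * (a + 1) ^ (G.γ - 1) := by positivity
  have hev : ∀ᶠ x in 𝓝 (0 : ℝ), G.mc i x < G.kap ρ * (a + 1) ^ (G.γ - 1) :=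
    (G.continuous_mc i).continuousAt.eventually_lt_const (by simpa using hc)
  obtain ⟨e, he, H⟩ := Metric.eventually_nhds_iff.1 hev
  have hx0 : 0 < min (e / 2) 1 := by positivity
  set x := min (e / 2) 1
  have hx1 : x ≤ 1 := min_le_right _ _
  have hm := H (y := x) (by
    rw [Real.dist_eq, sub_zero, abs_of_pos hx0]
    exact (min_le_left _ _).trans_lt (by linarith))
  have h1 := h.2 i x hx0.le
  rw [utility_of_eq_zero h0.symm, utility_update_full hx0.le (by linarith), dev_one (by linarith),
    ← ha] at h1
  have h2 := G.cost_le_mul_mc i hx0.le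
  have h3 : (a + 1) ^ (G.γ - 1) ≤ (a + x) ^ (G.γ - 1) :=
    Real.rpow_le_rpow_of_nonpos (by linarith) (by linarith) (by linarith [G.γ_mem.2])
  have h4 : x * G.mc i x < x * (G.kap ρ * (a + x) ^ (G.γ - 1)) :=
    mul_lt_mul_of_pos_left (hm.trans_le (mul_le_mul_of_nonneg_left h3 hk.le)) hx0
  nlinarith

lemma IsESE.foc {ρ : ℝ} (hρ : ρ ∈ Icc (0 : ℝ) 1) {z : Fin G.n → ℝ} (h : G.IsESE ρ z) :
    G.FOC (G.kap ρ) z := by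
  refine ⟨h.pos hρ, fun i => ?_⟩
  have hz := h.pos hρ
  have hX : 0 < G.total z := (hz i).trans_le (apply_le_total h.1 i)
  have hX' : 0 < (G.total z - z i) + z i := by linarith
  have hd := ((hasDerivAt_share (G := G) hX').const_mul (G.kap ρ)).fun_sub (G.hasDerivAt_cost i (hz i))
  have hmax : IsLocalMax (fun x => G.kap ρ * (x * (G.total z - z i + x) ^ (G.γ - 1)) - G.cost i x) (z i) := by
    filter_upwards [Ioi_mem_nhds (hz i)] with x hx
    have hx0 : 0 < x := hx
    have ha : 0 ≤ G.total z - z i := sub_nonneg.2 (apply_le_total h.1 i)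
    have h1 := h.2 i x hx0.le
    rwa [utility_update_full hx0.le (by linarith), utility_full (h.1 i) hX, dev_one (by linarith),
      dev_one (by linarith)] at h1
  have := hmax.hasDerivAt_eq_zero hd
  rw [sub_add_cancel] at this
  linarith

/-- This puts equilibrium qualities into the range where `StrongModulus` applies: c(z) < z c'(z) = κ
z Φ(X, z) ≤ κ z^γ. -/
lemma FOC.cost_lt {κ : ℝ} (hκ : 0 ≤ κ) (hκ' : κ ≤ G.μ) {z : Fin G.n → ℝ} (h : G.FOC κ z) (i : Fin G.n) :
    G.cost i (z i) < G.μ * z i ^ G.γ := by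
  have hz := h.1 i
  have hX := h.total_pos
  calc G.cost i (z i) < z i * G.mc i (z i) := G.cost_lt_mul_mc i hz
    _ = κ * (z i * G.Phi (G.total z) (z i)) := by rw [h.2 i]; ring
    _ ≤ κ * (z i * z i ^ (G.γ - 1)) := by
      have h1 := Phi_le (G := G) hX hz.le
      have h2 : G.total z ^ (G.γ - 1) ≤ z i ^ (G.γ - 1) :=
        Real.rpow_le_rpow_of_nonpos hz (apply_le_total (fun i => (h.1 i).le) i) (by linarith [G.γ_mem.2])
      have h3 := h1.trans h2
      gcongr
    _ = κ * z i ^ G.γ := by rw [Real.rpow_sub_one hz.ne']; field_simp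
    _ ≤ G.μ * z i ^ G.γ := by gcongr

end Game


namespace Game

variable {G : Game}

/-! ### Existence of equilibria -/

lemma continuousAt_Phi_left {X y : ℝ} (hX : 0 < X) : ContinuousAt (fun X => G.Phi X y) X := by
  unfold Phi
  exact (continuousAt_id.rpow_const (Or.inl hX.ne')).mul (by fun_prop)

lemma continuous_Phi_right {X : ℝ} : Continuous (fun y => G.Phi X y) := by
  unfold Phi
  fun_prop

lemma exists_root (i : Fin G.n) {κ X : ℝ} (hκ : 0 < κ) (hX : 0 < X) :
    ∃ y, 0 < y ∧ G.mc i y = κ * G.Phi X y := by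
  have hP : 0 < X ^ (G.γ - 1) := Real.rpow_pos_of_pos hX _
  obtain ⟨b, hb, hb0⟩ := (((G.tendsto_mc_atTop i).eventually_gt_atTop (κ * X ^ (G.γ - 1))).and
    (eventually_gt_atTop 0)).exists
  have hcont : Continuous fun y => G.mc i y - κ * G.Phi X y :=
    (G.continuous_mc i).sub (continuous_const.mul continuous_Phi_right)
  have h0 : G.mc i 0 - κ * G.Phi X 0 < 0 := by
    rw [mc_zero, Phi_eq hX, zero_div, mul_zero, sub_zero, mul_one]
    have := mul_pos hκ hP
    linarith
  have h1 : 0 < G.mc i b - κ * G.Phi X b := by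
    have := mul_le_mul_of_nonneg_left (Phi_le (G := G) hX hb0.le) hκ.le
    linarith
  obtain ⟨y, hy, hy0⟩ := intermediate_value_Ioo hb0.le hcont.continuousOn (show (0 : ℝ) ∈ Ioo _ _ from ⟨h0, h1⟩)
  exact ⟨y, hy.1, sub_eq_zero.1 hy0⟩

/-- Marginal cost increases and Φ decreases in y, so the sign of their difference locates the root.
-/
lemma lt_root {i : Fin G.n} {κ X y y' : ℝ} (hκ : 0 ≤ κ) (hX : 0 < X) (h : G.mc i y < κ * G.Phi X y)
    (h' : κ * G.Phi X y' ≤ G.mc i y') : y < y' := by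
  by_contra! hcon
  have h1 := G.mc_mono i hcon
  have h2 := mul_le_mul_of_nonneg_left (Phi_anti (G := G) hX hcon) hκ
  linarith

lemma root_lt {i : Fin G.n} {κ X y y' : ℝ} (hκ : 0 ≤ κ) (hX : 0 < X) (h : κ * G.Phi X y < G.mc i y)
    (h' : G.mc i y' ≤ κ * G.Phi X y') : y' < y := by
  by_contra! hcon
  have h1 := G.mc_mono i hcon
  have h2 := mul_le_mul_of_nonneg_left (Phi_anti (G := G) hX hcon) hκ
  linarith

/-- The strict signs of c' - κ Φ at the two points at distance e from the root persist for nearby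
totals and confine the new root. The lower point is dropped if it is not positive, since roots are
positive. -/
lemma continuousAt_root {i : Fin G.n} {κ : ℝ} (hκ : 0 < κ) {x : ℝ → ℝ}
    (hx : ∀ X, 0 < X → 0 < x X ∧ G.mc i (x X) = κ * G.Phi X (x X)) {X : ℝ} (hX : 0 < X) :
    ContinuousAt x X := by
  rw [Metric.continuousAt_iff']
  intro e he
  obtain ⟨hy, hy0⟩ := hx X hX
  have hup : κ * G.Phi X (x X + e) < G.mc i (x X + e) := by
    have h1 := (G.mc_strictMonoOn i) (mem_Ici.2 hy.le) (mem_Ici.2 (by linarith)) (lt_add_of_pos_right (x X) he)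
    have h2 := mul_le_mul_of_nonneg_left
      (Phi_anti (G := G) hX (lt_add_of_pos_right (x X) he).le) hκ.le
    linarith
  have c1 : ∀ᶠ Y in 𝓝 X, κ * G.Phi Y (x X + e) < G.mc i (x X + e) :=
    ((continuousAt_Phi_left hX).const_mul κ).eventually_lt_const hup
  have c2 : ∀ᶠ Y in 𝓝 X, x X - e ≤ 0 ∨ G.mc i (x X - e) < κ * G.Phi Y (x X - e) := by
    rcases le_or_gt (x X - e) 0 with h | h
    · exact Eventually.of_forall fun _ => Or.inl h
    · have hlow : G.mc i (x X - e) < κ * G.Phi X (x X - e) := by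
        have h1 := (G.mc_strictMonoOn i) (mem_Ici.2 h.le) (mem_Ici.2 hy.le) (sub_lt_self (x X) he)
        have h2 := mul_le_mul_of_nonneg_left (Phi_anti (G := G) hX (sub_lt_self (x X) he).le) hκ.le
        linarith
      exact (((continuousAt_Phi_left hX).const_mul κ).eventually_const_lt hlow).mono fun _ => Or.inr
  filter_upwards [c1, c2, Ioi_mem_nhds hX] with Y h1 h2 hY
  obtain ⟨hz, hz0⟩ := hx Y hY
  have h3 := root_lt hκ.le hY h1 hz0.le
  rw [Real.dist_eq, abs_sub_lt_iff]
  refine ⟨by linarith, ?_⟩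
  rcases h2 with h2 | h2
  · linarith
  · have := lt_root hκ.le hY h2 hz0.ge
    linarith

lemma one_le_n : (1 : ℝ) ≤ G.n := by exact_mod_cast (by linarith [G.two_le_n] : 1 ≤ G.n)

lemma n_pos : (0 : ℝ) < G.n := lt_of_lt_of_le one_pos one_le_n

variable (G) in
-- The sum of the roots minus the total changes sign between p and q. Both are chosen for all κ at
-- once, so that the bounds on equilibria are uniform in ρ.
lemma exists_foc : ∃ p q : ℝ, 0 < p ∧ p ≤ 1 ∧ 1 ≤ q ∧ ∀ κ, G.kap 0 ≤ κ → κ ≤ G.μ →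
    ∃ z, G.FOC κ z ∧ p ≤ G.total z ∧ G.total z ≤ q := by
  have hk0 : 0 < G.kap 0 := kap_pos ⟨le_rfl, zero_le_one⟩
  have hn := n_pos (G := G)
  have hγ := G.γ_mem
  obtain ⟨p, hp, hp0, hp1⟩ : ∃ p : ℝ, (∀ i, G.mc i (p / 2) < G.kap 0 / 2) ∧ 0 < p ∧ p ≤ 1 := by
    have h : ∀ᶠ p : ℝ in 𝓝[>] 0, ∀ i, G.mc i (p / 2) < G.kap 0 / 2 := by
      refine eventually_all.2 fun i => ?_
      have hc : ContinuousAt (fun p : ℝ => G.mc i (p / 2)) 0 :=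
        ((G.continuous_mc i).comp (continuous_id.div_const 2)).continuousAt
      exact (hc.eventually_lt_const (by simpa using hk0)).filter_mono nhdsWithin_le_nhds
    obtain ⟨p, hp, hp'⟩ := (h.and (Ioc_mem_nhdsGT one_pos)).exists
    exact ⟨p, hp, hp'.1, hp'.2⟩
  obtain ⟨q, hq, hq1⟩ : ∃ q : ℝ, (∀ i, G.μ < G.mc i (q / G.n)) ∧ 1 ≤ q := by
    have h : ∀ᶠ q : ℝ in atTop, ∀ i, G.μ < G.mc i (q / G.n) :=
      eventually_all.2 fun i => ((G.tendsto_mc_atTop i).comp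
        (tendsto_id.atTop_div_const hn)).eventually_gt_atTop _
    exact (h.and (eventually_ge_atTop 1)).exists
  refine ⟨p, q, hp0, hp1, hq1, fun κ hκ0 hκ1 => ?_⟩
  have hκ : 0 < κ := hk0.trans_le hκ0
  have : ∀ i, ∀ X, ∃ y, 0 < X → 0 < y ∧ G.mc i y = κ * G.Phi X y := fun i X => by
    by_cases hX : 0 < X
    · obtain ⟨y, hy⟩ := exists_root i hκ hX
      exact ⟨y, fun _ => hy⟩
    · exact ⟨0, fun h => absurd h hX⟩
  choose x hx using this
  have hcont : ContinuousOn (fun X => ∑ i, x i X - X) (Icc p q) := by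
    refine ContinuousOn.sub (continuousOn_finsetSum _ fun i _ => ?_) continuousOn_id
    intro X hX
    exact (continuousAt_root hκ (hx i) (hp0.trans_le hX.1)).continuousWithinAt
  have hlow : 0 ≤ ∑ i, x i p - p := by
    -- Quality p/2 has share 1/2 and p ≤ 1, so its marginal revenue is at least κ/2 and exceeds its
    -- marginal cost. As n ≥ 2, the roots then sum to at least p.
    have h1 : ∀ i, p / 2 ≤ x i p := fun i => by
      refine (lt_root (i := i) hκ.le hp0 ?_ (hx i p hp0).2.ge).le
      rw [Phi_eq hp0]
      have h2 : 1 ≤ p ^ (G.γ - 1) := Real.one_le_rpow_of_pos_of_le_one_of_nonpos hp0 hp1 (by linarith [hγ.2])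
      have h3 : p / 2 / p = 1 / 2 := by field_simp
      rw [h3]
      have h4 : 1 / 2 ≤ 1 - (1 - G.γ) * (1 / 2) := by linarith [hγ.1]
      have h5 : κ * (1 / 2) ≤ κ * (p ^ (G.γ - 1) * (1 - (1 - G.γ) * (1 / 2))) := by
        gcongr
        nlinarith
      linarith [hp i]
    have h2 : ∑ _i : Fin G.n, p / 2 ≤ ∑ i, x i p := Finset.sum_le_sum fun i _ => h1 i
    rw [Finset.sum_const, Finset.card_univ, Fintype.card_fin, nsmul_eq_mul] at h2
    have h3 : (2 : ℝ) ≤ G.n := by exact_mod_cast G.two_le_n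
    nlinarith
  have hhigh : ∑ i, x i q - q ≤ 0 := by
    have hq0 : 0 < q := by linarith
    have h1 : ∀ i, x i q ≤ q / G.n := fun i => by
      refine (root_lt (i := i) hκ.le hq0 ?_ (hx i q hq0).2.le).le
      have h2 : q ^ (G.γ - 1) ≤ 1 := Real.rpow_le_one_of_one_le_of_nonpos hq1 (by linarith [hγ.2])
      have h3 := (Phi_le (G := G) (y := q / G.n) hq0 (by positivity)).trans h2
      have := mul_le_mul_of_nonneg_left h3 hκ.le
      linarith [hq i]
    have h2 : ∑ i, x i q ≤ ∑ _i : Fin G.n, q / G.n := Finset.sum_le_sum fun i _ => h1 i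
    rw [Finset.sum_const, Finset.card_univ, Fintype.card_fin, nsmul_eq_mul, mul_div_cancel₀ _ hn.ne'] at h2
    linarith
  obtain ⟨X, hX, hX0⟩ := intermediate_value_Icc' (hp1.trans hq1) hcont
    (show (0 : ℝ) ∈ Icc _ _ from ⟨hhigh, hlow⟩)
  have hXp : 0 < X := hp0.trans_le hX.1
  have ht : G.total (fun i => x i X) = X := sub_eq_zero.1 hX0
  refine ⟨fun i => x i X, ⟨fun i => (hx i X hXp).1, fun i => ?_⟩, ?_, ?_⟩
  · rw [ht]; exact (hx i X hXp).2
  · rw [ht]; exact hX.1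
  · rw [ht]; exact hX.2

/-! ### Uniqueness and stability -/

/-- The smaller total X pushes the share y/X above the equilibrium share. If y ≥ z_i, this is
arithmetic of shares. Otherwise β(z_i - y) is at most the difference of the marginal costs, hence of
the marginal revenues; these are X^(γ-1) times an affine function of the share, and X^(γ-1) only
grows when X shrinks. D allows for a change of κ. -/
lemma FOC.rate {β κ κ' D X y : ℝ} {z : Fin G.n → ℝ} {i : Fin G.n} (hβ : G.StrongModulus β)
    (hκ : 0 ≤ κ) (hκμ : κ ≤ G.μ) (hz : G.FOC κ z) (hX : 0 < X) (hXz : X ≤ G.total z) (hy : 0 < y)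
    (hyX : y ≤ X) (hκ' : 0 ≤ κ') (hyc : κ' * G.Phi X y ≤ G.mc i y) (hD : 0 ≤ D) (hκD : κ - κ' ≤ D) :
    β * (y / X) * (G.total z - X) ≤ (y / X - z i / G.total z) *
      (β * G.total z + κ * (1 - G.γ) * G.total z ^ (G.γ - 1)) + D * G.total z ^ (G.γ - 1) := by
  have hγ := G.γ_mem
  have hT := hz.total_pos
  set T := G.total z
  have hP : 0 < T ^ (G.γ - 1) := Real.rpow_pos_of_pos hT _
  have hPP : T ^ (G.γ - 1) ≤ X ^ (G.γ - 1) := Real.rpow_le_rpow_of_nonpos hX hXz (by linarith [hγ.2])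
  obtain ⟨s, hs⟩ : ∃ s, s = y / X := ⟨_, rfl⟩
  obtain ⟨t, ht⟩ : ∃ t, t = z i / T := ⟨_, rfl⟩
  have hys : y = s * X := by rw [hs]; field_simp
  have hzt : z i = t * T := by rw [ht]; field_simp
  have hs0 : 0 < s := by rw [hs]; positivity
  have hs1 : s ≤ 1 := by rw [hs]; exact (div_le_one hX).2 hyX
  have hc := hz.2 i
  rw [Phi_eq hT, ← ht] at hc
  rw [Phi_eq hX, ← hs] at hyc
  rw [← hs, ← ht]
  set P := T ^ (G.γ - 1)
  have hβ0 := hβ.1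
  have hg : 0 ≤ 1 - G.γ := by linarith [hγ.2]
  rcases le_or_gt (z i) y with h | h
  · rw [hys, hzt] at h
    have h1 : 0 ≤ s - t := by
      have : t * T ≤ s * T := h.trans (by gcongr)
      have := le_of_mul_le_mul_right this hT
      linarith
    have h2 : 0 ≤ (s - t) * (κ * (1 - G.γ) * P) := by positivity
    have h3 : 0 ≤ D * P := by positivity
    have h4 : β * (t * T) ≤ β * (s * X) := by gcongr
    linarith
  · have h1 := hβ.mc_sub (hz.cost_lt hκ hκμ i) hy h.le
    have hE0 : 0 ≤ 1 - (1 - G.γ) * s := by nlinarith [mul_le_mul_of_nonneg_left hs1 hg, hγ.1]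
    have hE1 : 1 - (1 - G.γ) * s ≤ 1 := by linarith [mul_nonneg hg hs0.le]
    have h2 : κ' * (P * (1 - (1 - G.γ) * s)) ≤ κ' * (X ^ (G.γ - 1) * (1 - (1 - G.γ) * s)) := by gcongr
    have h3 : (κ - κ') * (P * (1 - (1 - G.γ) * s)) ≤ D * (P * 1) := by gcongr
    rw [hys, hzt] at h1
    rw [hys] at hyc
    rw [hzt] at hc
    linarith

lemma sum_div_total {z : Fin G.n → ℝ} (h : 0 < G.total z) : ∑ i, z i / G.total z = 1 := by
  rw [← Finset.sum_div]
  exact div_self h.ne'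

/-- Sum of `FOC.rate` over the creators: both share vectors sum to 1, so the differences of shares
cancel. -/
lemma FOC.total_sub_le {β κ κ' : ℝ} {z z' : Fin G.n → ℝ} (hβ : G.StrongModulus β)
    (hκ : 0 ≤ κ) (hκμ : κ ≤ G.μ) (hκ' : 0 ≤ κ') (hz : G.FOC κ z) (hz' : G.FOC κ' z')
    (h : G.total z' ≤ G.total z) :
    β * (G.total z - G.total z') ≤ G.n * (|κ - κ'| * G.total z ^ (G.γ - 1)) := by
  have h1 := fun i => hz.rate hβ hκ hκμ hz'.total_pos h (hz'.1 i)
    (apply_le_total (fun i => (hz'.1 i).le) i) hκ' (hz'.2 i).ge (abs_nonneg (κ - κ')) (le_abs_self _)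
  have h2 := Finset.sum_le_sum fun i (_ : i ∈ Finset.univ) => h1 i
  rw [Finset.sum_add_distrib, ← Finset.sum_mul, ← Finset.sum_mul, ← Finset.mul_sum, Finset.sum_sub_distrib,
    sum_div_total hz.total_pos, sum_div_total hz'.total_pos, Finset.sum_const, Finset.card_univ,
    Fintype.card_fin, nsmul_eq_mul] at h2
  linarith

/-- For equal coefficients the preceding bound forces equal totals, and for a given total the root
of each condition is unique. -/
lemma FOC.unique {β κ : ℝ} {z z' : Fin G.n → ℝ} (hβ : G.StrongModulus β)
    (hκ : 0 ≤ κ) (hκμ : κ ≤ G.μ) (hz : G.FOC κ z) (hz' : G.FOC κ z') : z = z' := by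
  have key : G.total z = G.total z' := by
    rcases le_total (G.total z') (G.total z) with h | h
    · have := hz.total_sub_le hβ hκ hκμ hκ hz' h
      rw [sub_self, abs_zero, zero_mul, mul_zero] at this
      nlinarith [hβ.1]
    · have := hz'.total_sub_le hβ hκ hκμ hκ hz h
      rw [sub_self, abs_zero, zero_mul, mul_zero] at this
      nlinarith [hβ.1]
  funext i
  have hc := hz.2 i
  have hc' := hz'.2 i
  rw [← key] at hc'
  refine le_antisymm ?_ ?_
  · by_contra! hcon
    have h1 := (G.mc_strictMonoOn i) (mem_Ici.2 (hz'.1 i).le) (mem_Ici.2 (hz.1 i).le) hcon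
    have h2 := mul_le_mul_of_nonneg_left (Phi_anti (G := G) hz.total_pos hcon.le) hκ
    linarith
  · by_contra! hcon
    have h1 := (G.mc_strictMonoOn i) (mem_Ici.2 (hz.1 i).le) (mem_Ici.2 (hz'.1 i).le) hcon
    have h2 := mul_le_mul_of_nonneg_left (Phi_anti (G := G) hz.total_pos hcon.le) hκ
    linarith

end Game


/-! ### Uniform bounds and Lipschitz dependence on the allocation parameter -/

namespace Game

variable {G : Game}

variable (G) in
/-- Uniform bounds on the equilibria for all allocation parameters. -/
def Bounds (θ q : ℝ) : Prop :=
  0 < θ ∧ θ ≤ 1 ∧ 1 ≤ q ∧ ∀ ρ ∈ Icc (0 : ℝ) 1, ∀ z, G.IsESE ρ z → (∀ i, θ ≤ z i) ∧ G.total z ≤ q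

lemma existsUnique_isESE {β : ℝ} (hβ : G.StrongModulus β) {ρ : ℝ} (hρ : ρ ∈ Icc (0 : ℝ) 1) :
    ∃! x, G.IsESE ρ x := by
  obtain ⟨p, q, -, -, -, H⟩ := G.exists_foc
  obtain ⟨z, hz, -⟩ := H (G.kap ρ) (kap_zero_le hρ) (kap_le hρ)
  exact ⟨z, hz.isESE hρ, fun y hy => (hy.foc hρ).unique hβ (kap_pos hρ).le (kap_le hρ) hz⟩

lemma exists_bounds {β : ℝ} (hβ : G.StrongModulus β) : ∃ θ q, G.Bounds θ q := by
  obtain ⟨p, q, hp, hp1, hq, H⟩ := G.exists_foc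
  have hk0 : 0 < G.kap 0 := kap_pos ⟨le_rfl, zero_le_one⟩
  have hq0 : 0 < q := by linarith
  have hc : 0 < G.kap 0 * (q ^ (G.γ - 1) * (1 / 2)) := by positivity
  -- A quality below both t and p/2 would have share at most 1/2, hence marginal revenue at least
  -- this constant, which exceeds its marginal cost.
  obtain ⟨t, ht, ht0⟩ : ∃ t : ℝ, (∀ i, G.mc i t < G.kap 0 * (q ^ (G.γ - 1) * (1 / 2))) ∧ 0 < t := by
    have h : ∀ᶠ t : ℝ in 𝓝[>] 0, ∀ i, G.mc i t < G.kap 0 * (q ^ (G.γ - 1) * (1 / 2)) :=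
      eventually_all.2 fun i => ((G.continuous_mc i).continuousAt.eventually_lt_const
        (by simpa using hc)).filter_mono nhdsWithin_le_nhds
    exact (h.and self_mem_nhdsWithin).exists
  refine ⟨min t (p / 2), q, by positivity, (min_le_right _ _).trans (by linarith), hq, fun ρ hρ z hz => ?_⟩
  obtain ⟨z', hz', h1, h2⟩ := H (G.kap ρ) (kap_zero_le hρ) (kap_le hρ)
  obtain rfl := (hz.foc hρ).unique hβ (kap_pos hρ).le (kap_le hρ) hz'
  refine ⟨fun i => ?_, h2⟩
  by_contra! hcon
  have hT := hz'.total_pos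
  have h3 : G.mc i (z i) ≤ G.mc i t := G.mc_mono i (hcon.le.trans (min_le_left _ _))
  have h4 : z i / G.total z ≤ 1 / 2 := by
    rw [div_le_iff₀ hT]
    have := hcon.le.trans (min_le_right t (p / 2))
    linarith
  have h5 : 1 / 2 ≤ 1 - (1 - G.γ) * (z i / G.total z) := by
    have h0 : 0 ≤ z i / G.total z := div_nonneg (hz'.1 i).le hT.le
    nlinarith [G.γ_mem.1, G.γ_mem.2]
  have h6 : q ^ (G.γ - 1) ≤ G.total z ^ (G.γ - 1) :=
    Real.rpow_le_rpow_of_nonpos hT h2 (by linarith [G.γ_mem.2])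
  have h7 := hz'.2 i
  rw [Phi_eq hT] at h7
  have h8 : G.kap 0 * (q ^ (G.γ - 1) * (1 / 2)) ≤
      G.kap ρ * (G.total z ^ (G.γ - 1) * (1 - (1 - G.γ) * (z i / G.total z))) := by
    have := kap_zero_le (G := G) hρ
    gcongr
    exact (kap_pos hρ).le
  linarith [ht i]

variable (G) in
-- A C¹ function is Lipschitz on a compact convex set; keeping the total away from 0 makes the power
-- smooth. The later Lipschitz lemmas for `dev`, `ddev` and the revenue follow the same pattern.
lemma exists_lipschitz_Phi {p q : ℝ} (hp : 0 < p) :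
    ∃ L, 0 ≤ L ∧ ∀ κ ∈ Icc 0 G.μ, ∀ κ' ∈ Icc 0 G.μ, ∀ X ∈ Icc p q, ∀ X' ∈ Icc p q, ∀ y ∈ Icc 0 q,
      |κ * G.Phi X y - κ' * G.Phi X' y| ≤ L * (|κ - κ'| + |X - X'|) := by
  have hd : ContDiffOn ℝ 1 (fun v : ℝ × ℝ × ℝ => v.1 * G.Phi v.2.1 v.2.2)
      (Icc 0 G.μ ×ˢ Icc p q ×ˢ Icc 0 q) := by
    unfold Phi
    refine contDiffOn_fst.mul (ContDiffOn.mul ?_ (by fun_prop))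
    refine ContDiffOn.rpow_const_of_ne (by fun_prop) fun v hv => ?_
    exact (hp.trans_le hv.2.1.1).ne'
  obtain ⟨K, hK⟩ := hd.exists_lipschitzOnWith one_ne_zero
    ((convex_Icc _ _).prod ((convex_Icc _ _).prod (convex_Icc _ _)))
    (isCompact_Icc.prod (isCompact_Icc.prod isCompact_Icc))
  refine ⟨K, K.2, fun κ hκ κ' hκ' X hX X' hX' y hy => ?_⟩
  have h := hK.dist_le_mul (κ, X, y) ⟨hκ, hX, hy⟩ (κ', X', y) ⟨hκ', hX', hy⟩
  rw [Real.dist_eq] at h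
  refine h.trans (mul_le_mul_of_nonneg_left ?_ K.2)
  rw [Prod.dist_eq, Prod.dist_eq, dist_self, Real.dist_eq, Real.dist_eq]
  simp only
  refine max_le ?_ (max_le ?_ ?_)
  · linarith [abs_nonneg (X - X')]
  · linarith [abs_nonneg (κ - κ')]
  · positivity

/-- If z_i > y, strong convexity bounds β(z_i - y) by the difference of marginal costs, and
monotonicity of Φ moves both marginal revenues to the same y. Only an inequality is known at y, so
the estimate is one-sided; it serves for exact roots and for upper ends of brackets. -/
lemma FOC.sub_le {β κ κ' L p q X y : ℝ} {z : Fin G.n → ℝ} {i : Fin G.n} (hβ : G.StrongModulus β)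
    (hL : ∀ κ ∈ Icc 0 G.μ, ∀ κ' ∈ Icc 0 G.μ, ∀ X ∈ Icc p q, ∀ X' ∈ Icc p q, ∀ y ∈ Icc 0 q,
      |κ * G.Phi X y - κ' * G.Phi X' y| ≤ L * (|κ - κ'| + |X - X'|)) (hL0 : 0 ≤ L)
    (hκ : κ ∈ Icc 0 G.μ) (hκ' : κ' ∈ Icc 0 G.μ) (hz : G.FOC κ z) (hT : G.total z ∈ Icc p q)
    (hX : X ∈ Icc p q) (hy : 0 < y) (hyc : κ' * G.Phi X y ≤ G.mc i y) :
    z i - y ≤ L / β * (|κ - κ'| + |G.total z - X|) := by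
  have hβ0 := hβ.1
  have hR : 0 ≤ L / β * (|κ - κ'| + |G.total z - X|) := by positivity
  rcases le_or_gt (z i) y with h | h
  · linarith
  have h1 := hβ.mc_sub (hz.cost_lt hκ.1 hκ.2 i) hy h.le
  rw [hz.2 i] at h1
  have h2 := mul_le_mul_of_nonneg_left (Phi_anti (G := G) hz.total_pos h.le) hκ.1
  have h3 := hL κ hκ κ' hκ' _ hT X hX y ⟨hy.le, h.le.trans ((apply_le_total (fun i => (hz.1 i).le) i).trans hT.2)⟩
  have h4 := le_abs_self (κ * G.Phi (G.total z) y - κ' * G.Phi X y)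
  rw [div_mul_eq_mul_div, le_div_iff₀ hβ0]
  linarith

/-- The equilibrium depends on the allocation parameter in a Lipschitz way. -/
lemma exists_lipschitz_ESE {β θ q : ℝ} (hβ : G.StrongModulus β) (hb : G.Bounds θ q) :
    ∃ C, 0 ≤ C ∧ ∀ ρ ∈ Icc (0 : ℝ) 1, ∀ ρ' ∈ Icc (0 : ℝ) 1, ∀ z z', G.IsESE ρ z → G.IsESE ρ' z' →
      ∀ i, |z i - z' i| ≤ C * |ρ - ρ'| := by
  obtain ⟨hθ, hθ1, hq, H⟩ := hb
  obtain ⟨L, hL0, hL⟩ := G.exists_lipschitz_Phi (q := q) hθ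
  have hβ0 := hβ.1
  have hμ := G.μ_pos
  set P := θ ^ (G.γ - 1)
  have hP : 0 < P := Real.rpow_pos_of_pos hθ _
  have hn := n_pos (G := G)
  have hmem : ∀ ρ ∈ Icc (0 : ℝ) 1, ∀ z, G.IsESE ρ z → G.total z ∈ Icc θ q := fun ρ hρ z hz =>
    ⟨((H ρ hρ z hz).1 ⟨0, by linarith [G.two_le_n]⟩).trans (apply_le_total hz.1 _), (H ρ hρ z hz).2⟩
  have htot : ∀ ρ ∈ Icc (0 : ℝ) 1, ∀ ρ' ∈ Icc (0 : ℝ) 1, ∀ z z', G.IsESE ρ z → G.IsESE ρ' z' →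
      G.total z' ≤ G.total z → G.total z - G.total z' ≤ G.n * P / β * (G.μ * |ρ - ρ'|) := by
    intro ρ hρ ρ' hρ' z z' hz hz' h
    have h1 := (hz.foc hρ).total_sub_le hβ (kap_pos hρ).le (kap_le hρ) (kap_pos hρ').le (hz'.foc hρ') h
    have h2 : G.total z ^ (G.γ - 1) ≤ P :=
      Real.rpow_le_rpow_of_nonpos hθ (hmem ρ hρ z hz).1 (by linarith [G.γ_mem.2])
    have h3 := abs_kap_sub (G := G) ρ ρ'
    have hz0 := (hz.foc hρ).total_pos
    have h4 : G.n * (|G.kap ρ - G.kap ρ'| * G.total z ^ (G.γ - 1)) ≤ G.n * ((G.μ * |ρ - ρ'|) * P) := by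
      gcongr
    rw [div_mul_eq_mul_div, le_div_iff₀ hβ0]
    linarith
  have habs : ∀ ρ ∈ Icc (0 : ℝ) 1, ∀ ρ' ∈ Icc (0 : ℝ) 1, ∀ z z', G.IsESE ρ z → G.IsESE ρ' z' →
      |G.total z - G.total z'| ≤ G.n * P / β * (G.μ * |ρ - ρ'|) := by
    intro ρ hρ ρ' hρ' z z' hz hz'
    refine abs_le'.2 ⟨?_, ?_⟩
    · rcases le_total (G.total z') (G.total z) with h | h
      · exact htot ρ hρ ρ' hρ' z z' hz hz' h
      · have : 0 ≤ G.n * P / β * (G.μ * |ρ - ρ'|) := by positivity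
        linarith
    · rcases le_total (G.total z) (G.total z') with h | h
      · have := htot ρ' hρ' ρ hρ z' z hz' hz h
        rw [abs_sub_comm] at this
        linarith
      · have : 0 ≤ G.n * P / β * (G.μ * |ρ - ρ'|) := by positivity
        linarith
  have hone : ∀ ρ ∈ Icc (0 : ℝ) 1, ∀ ρ' ∈ Icc (0 : ℝ) 1, ∀ z z', G.IsESE ρ z → G.IsESE ρ' z' →
      ∀ i, z i - z' i ≤ L / β * (G.μ * |ρ - ρ'| + G.n * P / β * (G.μ * |ρ - ρ'|)) := by
    intro ρ hρ ρ' hρ' z z' hz hz' i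
    refine ((hz.foc hρ).sub_le hβ hL hL0 ⟨(kap_pos hρ).le, kap_le hρ⟩ ⟨(kap_pos hρ').le, kap_le hρ'⟩
      (hmem ρ hρ z hz) (hmem ρ' hρ' z' hz') (hz'.pos hρ' i) ((hz'.foc hρ').2 i).ge).trans ?_
    have h1 := abs_kap_sub (G := G) ρ ρ'
    have h2 := habs ρ hρ ρ' hρ' z z' hz hz'
    gcongr
  refine ⟨L / β * (G.μ + G.n * P / β * G.μ), by positivity, fun ρ hρ ρ' hρ' z z' hz hz' i => ?_⟩
  refine abs_le'.2 ⟨?_, ?_⟩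
  · have := hone ρ hρ ρ' hρ' z z' hz hz' i
    linarith
  · have := hone ρ' hρ' ρ hρ z' z hz' hz i
    rw [abs_sub_comm] at this
    linarith

/-! ### Approximate equilibria from bracketing -/

variable (G) in
/-- `l` approximates from below, with accuracy `τ`, the solution in `[0, X]` of the first-order condition of
creator `i` for the total quality `X`. -/
def Bracket (κ X τ : ℝ) (i : Fin G.n) (l : ℝ) : Prop :=
  0 ≤ l ∧ G.mc i l ≤ κ * G.Phi X l ∧
    ∃ u, 0 < u ∧ u ≤ l + τ ∧ u ≤ X ∧ (u = X ∨ κ * G.Phi X u ≤ G.mc i u)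

/-- If the equilibrium total were below X, each l_i would have a strictly smaller share in X than
z_i has in its total, and the l_i would sum to less than X. Only the lower ends enter, so there is
no error in τ. -/
lemma FOC.le_total_of_bracket {κ X τ : ℝ} {z l : Fin G.n → ℝ} (hκ : 0 ≤ κ) (hz : G.FOC κ z) (hX : 0 < X)
    (hl : ∀ i, G.Bracket κ X τ i (l i)) (h : X ≤ G.total l) : X ≤ G.total z := by
  by_contra! hcon
  have hT := hz.total_pos
  have hγ := G.γ_mem
  have key : ∀ i, l i / X < z i / G.total z := by
    intro i
    by_contra! hle
    have h1 : z i < l i := by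
      rw [div_le_div_iff₀ hT hX] at hle
      have := mul_lt_mul_of_pos_left hcon (hz.1 i)
      exact lt_of_mul_lt_mul_right (this.trans_le hle) hT.le
    have h2 := (G.mc_strictMonoOn i) (mem_Ici.2 (hz.1 i).le) (mem_Ici.2 (hl i).1) h1
    have h3 := (hl i).2.1
    rw [hz.2 i, Phi_eq hT] at h2
    rw [Phi_eq hX] at h3
    have hz1 : z i / G.total z ≤ 1 := (div_le_one hT).2 (apply_le_total (fun i => (hz.1 i).le) i)
    have hz0 : 0 ≤ z i / G.total z := div_nonneg (hz.1 i).le hT.le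
    have h4 : 0 ≤ 1 - (1 - G.γ) * (z i / G.total z) := by
      nlinarith [mul_le_mul_of_nonneg_left hz1 (show 0 ≤ 1 - G.γ by linarith [hγ.2]), hγ.1]
    have h5 : X ^ (G.γ - 1) ≤ G.total z ^ (G.γ - 1) :=
      Real.rpow_le_rpow_of_nonpos hT hcon.le (by linarith [hγ.2])
    have h6 : κ * (X ^ (G.γ - 1) * (1 - (1 - G.γ) * (l i / X))) ≤
        κ * (X ^ (G.γ - 1) * (1 - (1 - G.γ) * (z i / G.total z))) := by
      have : (1 - G.γ) * (z i / G.total z) ≤ (1 - G.γ) * (l i / X) :=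
        mul_le_mul_of_nonneg_left hle (by linarith [hγ.2])
      have h7 : 0 < X ^ (G.γ - 1) := Real.rpow_pos_of_pos hX _
      gcongr
    have h7 : κ * (X ^ (G.γ - 1) * (1 - (1 - G.γ) * (z i / G.total z))) ≤
        κ * (G.total z ^ (G.γ - 1) * (1 - (1 - G.γ) * (z i / G.total z))) := by gcongr
    linarith
  have hne : (Finset.univ : Finset (Fin G.n)).Nonempty := ⟨⟨0, by linarith [G.two_le_n]⟩, Finset.mem_univ _⟩
  have := Finset.sum_lt_sum_of_nonempty hne fun i _ => key i
  rw [sum_div_total hT, ← Finset.sum_div, div_lt_one hX] at this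
  exact absurd h (not_le.2 this)

/-- By `FOC.rate` the share of each upper end in X exceeds the equilibrium share by at least m times
the gap of the totals. On the other hand the upper ends sum to at most X + nτ. -/
lemma exists_total_le_of_bracket {β θ q : ℝ} (hβ : G.StrongModulus β) (hb : G.Bounds θ q) :
    ∃ m, 0 < m ∧ ∀ ρ ∈ Icc (0 : ℝ) 1, ∀ z, G.IsESE ρ z → ∀ X τ l, 0 < X → X ≤ G.total z →
      (∀ i, G.Bracket (G.kap ρ) X τ i (l i)) → G.total l ≤ X → m * (G.total z - X) * X ≤ τ := by
  obtain ⟨hθ, hθ1, hq, H⟩ := hb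
  have hβ0 := hβ.1
  have hμ := G.μ_pos
  have hq0 : 0 < q := by linarith
  set P := θ ^ (G.γ - 1)
  have hP : 0 < P := Real.rpow_pos_of_pos hθ _
  have hn := n_pos (G := G)
  have hM : 0 < β * q + G.μ * P := by positivity
  refine ⟨min (β * (θ / q) / (β * q + G.μ * P)) (θ / q / q), by positivity,
    fun ρ hρ z hz X τ l hX hXz hl hs => ?_⟩
  set m := min (β * (θ / q) / (β * q + G.μ * P)) (θ / q / q)
  have hm1 : m ≤ β * (θ / q) / (β * q + G.μ * P) := min_le_left _ _
  have hm2 : m ≤ θ / q / q := min_le_right _ _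
  have hf := hz.foc hρ
  have hT := hf.total_pos
  obtain ⟨hzθ, hTq⟩ := H ρ hρ z hz
  have hTθ : θ ≤ G.total z := (hzθ ⟨0, by linarith [G.two_le_n]⟩).trans (apply_le_total hz.1 _)
  have hd : 0 ≤ G.total z - X := by linarith
  have hζ : ∀ i, θ / q ≤ z i / G.total z := fun i => by
    have h0 := hz.1 i
    have := hzθ i
    gcongr
  choose u hu0 hul huX hu using fun i => (hl i).2.2
  have key : ∀ i, m * (G.total z - X) ≤ u i / X - z i / G.total z := by
    intro i
    rcases hu i with h | h
    -- An upper end at X has share 1, whereas some other creator holds at least θ/q of the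
    -- equilibrium total.
    · rw [h, div_self hX.ne']
      obtain ⟨j, hj⟩ := exists_ne_index i
      have h1 := add_le_total hz.1 hj
      have h2 : θ / q ≤ 1 - z i / G.total z := by
        rw [one_sub_div hT.ne']
        have h0 := (hzθ j).trans h1
        have h3 := hθ.le.trans h0
        gcongr
      calc m * (G.total z - X) ≤ θ / q / q * q := by gcongr; linarith
        _ = θ / q := by field_simp
        _ ≤ _ := h2
    · have h1 := hf.rate hβ (kap_pos hρ).le (kap_le hρ) hX hXz (hu0 i) (huX i) (kap_pos hρ).le h le_rfl
        (sub_self _).le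
      rw [zero_mul, add_zero] at h1
      set E := β * G.total z + G.kap ρ * (1 - G.γ) * G.total z ^ (G.γ - 1)
      have hk := kap_pos (G := G) hρ
      have hg : 0 ≤ 1 - G.γ := by linarith [G.γ_mem.2]
      have hE0 : 0 < E := by positivity
      have hEle : E ≤ β * q + G.μ * P := by
        have h2 : G.total z ^ (G.γ - 1) ≤ P := Real.rpow_le_rpow_of_nonpos hθ hTθ (by linarith)
        have h3 : G.kap ρ * (1 - G.γ) ≤ G.μ := by nlinarith [kap_le (G := G) hρ, G.γ_mem.1]
        show β * G.total z + G.kap ρ * (1 - G.γ) * G.total z ^ (G.γ - 1) ≤ _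
        gcongr
      have hσ : 0 ≤ u i / X - z i / G.total z := by
        have : 0 ≤ β * (u i / X) * (G.total z - X) := by
          have := hu0 i
          positivity
        exact nonneg_of_mul_nonneg_left (this.trans h1) hE0
      have h4 : β * (θ / q) * (G.total z - X) ≤ (u i / X - z i / G.total z) * (β * q + G.μ * P) := by
        calc β * (θ / q) * (G.total z - X) ≤ β * (u i / X) * (G.total z - X) := by
              have := (hζ i).trans (sub_nonneg.1 hσ)
              gcongr
          _ ≤ _ := h1
          _ ≤ _ := by gcongr
      calc m * (G.total z - X) ≤ β * (θ / q) / (β * q + G.μ * P) * (G.total z - X) := by gcongr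
        _ = β * (θ / q) * (G.total z - X) / (β * q + G.μ * P) := by ring
        _ ≤ _ := by rwa [div_le_iff₀ hM]
  have hsum := Finset.sum_le_sum fun i (_ : i ∈ Finset.univ) => key i
  rw [Finset.sum_sub_distrib, sum_div_total hT, ← Finset.sum_div, Finset.sum_const, Finset.card_univ,
    Fintype.card_fin, nsmul_eq_mul] at hsum
  have hul' : ∑ i, u i ≤ X + G.n * τ := by
    calc ∑ i, u i ≤ ∑ i, (l i + τ) := Finset.sum_le_sum fun i _ => hul i
      _ = G.total l + G.n * τ := by
        rw [Finset.sum_add_distrib, Finset.sum_const, Finset.card_univ, Fintype.card_fin, nsmul_eq_mul]; rfl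
      _ ≤ _ := by linarith
  have h5 : (∑ i, u i) / X - 1 ≤ G.n * τ / X := by
    rw [div_sub_one hX.ne']
    gcongr
    linarith
  have h6 := hsum.trans h5
  rw [le_div_iff₀ hX, mul_assoc] at h6
  exact le_of_mul_le_mul_left h6 hn

end Game


namespace Game

variable {G : Game}

/-- The bisection interval for the total quality contains the equilibrium value up to a small error. -/
lemma FOC.total_mem_of_bracket {m θ A κ τ lo hi : ℝ} {z : Fin G.n → ℝ} (hf : G.FOC κ z) (hκ : 0 ≤ κ)
    (hm : 0 < m) (hθ : 0 < θ)
    (Hm : ∀ X l, 0 < X → X ≤ G.total z → (∀ i, G.Bracket κ X τ i (l i)) → G.total l ≤ X →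
      m * (G.total z - X) * X ≤ τ)
    (hTθ : θ ≤ G.total z) (hTA : G.total z ≤ A) (hA : 2 / θ ≤ A) (hA' : 2 / (m * θ) < A) (hA1 : 1 ≤ A)
    (hτ : 0 < τ) (hτA : τ * A ^ 3 ≤ 1) (hlo : 1 / A ≤ lo)
    (hlo' : lo = 1 / A ∨ ∃ l', (∀ i, G.Bracket κ lo τ i (l' i)) ∧ lo ≤ G.total l')
    (hhi' : hi = A ∨ 1 / A ≤ hi ∧ ∃ l', (∀ i, G.Bracket κ hi τ i (l' i)) ∧ G.total l' ≤ hi) :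
    lo ≤ G.total z ∧ G.total z ≤ hi + 2 / (m * θ) * τ := by
  have hA0 : 0 < A := by linarith
  have hinv : 1 / A ≤ θ / 2 := by
    rw [div_le_iff₀ hθ] at hA
    rw [div_le_div_iff₀ hA0 two_pos]
    linarith
  have hinv0 : 0 < 1 / A := by positivity
  constructor
  · rcases hlo' with h | ⟨l', h1, h2⟩
    · linarith
    · exact hf.le_total_of_bracket hκ (hinv0.trans_le hlo) h1 h2
  have hpos : 0 < 2 / (m * θ) * τ := by positivity
  rcases hhi' with h | ⟨h0, l', h1, h2⟩
  · linarith
  rcases le_or_gt (G.total z) hi with h3 | h3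
  · linarith
  have h4 := Hm hi l' (hinv0.trans_le h0) h3.le h1 h2
  have hd : 0 < G.total z - hi := by linarith
  rcases le_or_gt (θ / 2) hi with h5 | h5
  · have h6 : m * (G.total z - hi) * (θ / 2) ≤ τ := le_trans (by gcongr) h4
    have : G.total z - hi ≤ 2 / (m * θ) * τ := by
      rw [div_mul_eq_mul_div, le_div_iff₀ (by positivity)]
      linarith
    linarith
  -- Here the gap exceeds θ/2 although hi ≥ 1/A, which contradicts τ A³ ≤ 1 because A > 2/(mθ).
  · exfalso
    have h6 : m * (θ / 2) * (1 / A) ≤ τ := le_trans (by gcongr; linarith) h4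
    have h7 : m * (θ / 2) * (1 / A) * A ^ 3 ≤ 1 := le_trans (by gcongr) hτA
    have h8 : m * (θ / 2) * (1 / A) * A ^ 3 = (m * θ) * (A ^ 2 / 2) := by field_simp
    rw [h8] at h7
    have h9 : A ≤ A ^ 2 := le_self_pow₀ hA1 two_ne_zero
    have h10 := hA'.trans_le h9
    rw [div_lt_iff₀ (by positivity)] at h10
    linarith

/-- Bracketing at a total quality `X` close to the equilibrium value gives an approximate equilibrium. -/
lemma FOC.near_of_bracket {β θ q L c κ τ e X : ℝ} {z l : Fin G.n → ℝ} (hf : G.FOC κ z)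
    (hβ : G.StrongModulus β) (hκ : κ ∈ Icc 0 G.μ) (hθ : 0 < θ) (hL0 : 0 ≤ L)
    (hL : ∀ κ ∈ Icc 0 G.μ, ∀ κ' ∈ Icc 0 G.μ, ∀ X ∈ Icc (θ / 2) (q + 1), ∀ X' ∈ Icc (θ / 2) (q + 1),
      ∀ y ∈ Icc 0 (q + 1), |κ * G.Phi X y - κ' * G.Phi X' y| ≤ L * (|κ - κ'| + |X - X'|))
    (hc : c = L / β + 1) (hTθ : θ ≤ G.total z) (hTq : G.total z ≤ q) (hτe : τ ≤ e) (he0 : 0 < e)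
    (he1 : e ≤ 1) (hsm : G.n * (c * e) ≤ θ / 2) (hXT : G.total z < X) (hXT' : X ≤ G.total z + e)
    (hl : ∀ i, G.Bracket κ X τ i (l i)) (i : Fin G.n) :
    |l i - z i| ≤ (1 + G.n * c) * e ∧ G.mc i (l i) - κ * G.Phi (G.total l) (l i) ≤ L * ((1 + G.n * c) * e) := by
  have hβ0 := hβ.1
  have hT := hf.total_pos
  have hn := n_pos (G := G)
  have hn1 := one_le_n (G := G)
  have hX0 : 0 < X := hT.trans hXT
  have hc0 : 0 < c := by rw [hc]; positivity
  have hce : 0 < c * e := by positivity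
  have hz0 := fun i => (hf.1 i).le
  -- This is why X has to overshoot the equilibrium total: the computed total then stays below X.
  have hlX : G.total l < X := by
    by_contra! hcon
    exact absurd (hf.le_total_of_bracket hκ.1 hX0 hl hcon) (not_le.2 hXT)
  have hXm : X ∈ Icc (θ / 2) (q + 1) := ⟨by linarith, by linarith⟩
  have hlow : ∀ i, z i - l i ≤ c * e := by
    intro i
    obtain ⟨u, hu0, hul, huX, hu⟩ := (hl i).2.2
    have h0 : c * e = L / β * e + e := by rw [hc]; ring
    have h00 : 0 ≤ L / β * e := by positivity
    have h1 : z i - u ≤ L / β * e := by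
      rcases hu with hu | hu
      · have h2 := apply_le_total hz0 i
        linarith
      · have h2 := hf.sub_le hβ hL hL0 hκ hκ ⟨by linarith, by linarith⟩ hXm hu0 hu
        rw [sub_self, abs_zero, zero_add, abs_sub_comm, abs_of_pos (by linarith)] at h2
        refine h2.trans (mul_le_mul_of_nonneg_left (by linarith) (by positivity))
    linarith
  have hsum : G.total z - G.total l ≤ G.n * (c * e) := by
    have h1 := Finset.sum_le_sum fun i (_ : i ∈ Finset.univ) => hlow i
    rw [Finset.sum_sub_distrib, Finset.sum_const, Finset.card_univ, Fintype.card_fin, nsmul_eq_mul] at h1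
    exact h1
  have h0 : (1 + G.n * c) * e = e + G.n * (c * e) := by ring
  have h00 : c * e ≤ G.n * (c * e) := le_mul_of_one_le_left hce.le hn1
  -- The upper bound comes from the sum: all terms l_j - z_j + c e are nonnegative, and they add up
  -- to at most e + n c e.
  have hup : l i - z i ≤ (1 + G.n * c) * e := by
    have h1 : l i - z i + c * e ≤ ∑ j, (l j - z j + c * e) :=
      Finset.single_le_sum (f := fun j => l j - z j + c * e) (fun j _ => by linarith [hlow j]) (Finset.mem_univ i)
    rw [Finset.sum_add_distrib, Finset.sum_sub_distrib, Finset.sum_const, Finset.card_univ, Fintype.card_fin,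
      nsmul_eq_mul] at h1
    change _ ≤ G.total l - G.total z + _ at h1
    linarith
  refine ⟨abs_le'.2 ⟨hup, ?_⟩, ?_⟩
  · have := hlow i
    linarith
  · have h1 := hL _ hκ _ hκ X hXm (G.total l) ⟨by linarith, by linarith⟩ (l i)
      ⟨(hl i).1, (apply_le_total (fun i => (hl i).1) i).trans (by linarith)⟩
    rw [sub_self, abs_zero, zero_add, abs_of_pos (show 0 < X - G.total l by linarith)] at h1
    have h2 := (le_abs_self _).trans h1
    have h3 := (hl i).2.1
    have h4 : L * (X - G.total l) ≤ L * ((1 + G.n * c) * e) :=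
      mul_le_mul_of_nonneg_left (by linarith) hL0
    linarith

lemma exists_approx_ESE {β θ q : ℝ} (hβ : G.StrongModulus β) (hb : G.Bounds θ q) :
    ∃ C, 1 ≤ C ∧ ∀ A, C ≤ A → ∀ ρ ∈ Icc (0 : ℝ) 1, ∀ z, G.IsESE ρ z → ∀ τ lo hi (l : Fin G.n → ℝ), 0 < τ →
      τ * A ^ 3 ≤ 1 → 1 / A ≤ lo → hi - lo ≤ τ →
      (lo = 1 / A ∨ ∃ l', (∀ i, G.Bracket (G.kap ρ) lo τ i (l' i)) ∧ lo ≤ G.total l') →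
      (hi = A ∨ 1 / A ≤ hi ∧ ∃ l', (∀ i, G.Bracket (G.kap ρ) hi τ i (l' i)) ∧ G.total l' ≤ hi) →
      (∀ i, G.Bracket (G.kap ρ) (lo + A * τ) τ i (l i)) →
      ∀ i, |l i - z i| ≤ C * (A * τ) ∧
        G.mc i (l i) - G.kap ρ * G.Phi (G.total l) (l i) ≤ C * (A * τ) := by
  obtain ⟨m, hm, Hm⟩ := exists_total_le_of_bracket hβ hb
  obtain ⟨hθ, hθ1, hq, H⟩ := hb
  obtain ⟨L, hL0, hL⟩ := G.exists_lipschitz_Phi (p := θ / 2) (q := q + 1) (by positivity)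
  have hβ0 := hβ.1
  have hn := n_pos (G := G)
  obtain ⟨c, hc⟩ : ∃ c, c = L / β + 1 := ⟨_, rfl⟩
  have hc1 : 0 < c := by rw [hc]; positivity
  have p1 : 0 < 2 / θ := by positivity
  have p2 : 0 < 2 / (m * θ) := by positivity
  have p3 : 0 < 2 * (G.n * c) / θ := by positivity
  have p4 : 0 < 1 + G.n * c := by positivity
  have p5 : 0 ≤ L * (1 + G.n * c) := by positivity
  obtain ⟨C, hC⟩ : ∃ C, C = 2 + q + 2 / θ + 2 / (m * θ) + 2 * (G.n * c) / θ + (1 + G.n * c) +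
    L * (1 + G.n * c) := ⟨_, rfl⟩
  have c1 : 2 / θ ≤ C := by linarith
  have c2 : 2 + 2 / (m * θ) ≤ C := by linarith
  have c3 : 2 * (G.n * c) / θ ≤ C := by linarith
  have c4 : 1 + G.n * c ≤ C := by linarith
  have c5 : L * (1 + G.n * c) ≤ C := by linarith
  have c6 : q ≤ C := by linarith
  clear hC
  refine ⟨C, by linarith, fun A hA ρ hρ z hz τ lo hi l hτ hτA hlo hlh hlo' hhi' hl i => ?_⟩
  have hA1 : 1 ≤ A := by linarith
  have hA0 : 0 < A := by linarith
  have hf := hz.foc hρ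
  obtain ⟨hzθ, hTq⟩ := H ρ hρ z hz
  have hTθ : θ ≤ G.total z := (hzθ ⟨0, by linarith [G.two_le_n]⟩).trans (apply_le_total hz.1 _)
  obtain ⟨h1, h2⟩ := hf.total_mem_of_bracket (kap_pos hρ).le hm hθ (fun X l => Hm ρ hρ z hz X τ l) hTθ
    (by linarith) (by linarith) (by linarith) hA1 hτ hτA hlo hlo' hhi'
  have hτe : τ ≤ A * τ := le_mul_of_one_le_left hτ.le hA1
  have heA : A * τ * A ≤ 1 := by
    have : τ * A ^ 2 ≤ τ * A ^ 3 := mul_le_mul_of_nonneg_left (pow_le_pow_right₀ hA1 (by norm_num)) hτ.le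
    calc A * τ * A = τ * A ^ 2 := by ring
      _ ≤ 1 := this.trans hτA
  have he0 : 0 < A * τ := by positivity
  have he1 : A * τ ≤ 1 := le_trans (le_mul_of_one_le_right he0.le hA1) heA
  have hsm : G.n * (c * (A * τ)) ≤ θ / 2 := by
    have h3 : 2 * (G.n * c) ≤ A * θ := (div_le_iff₀ hθ).1 (c3.trans hA)
    have h4 := mul_le_mul_of_nonneg_left h3 he0.le
    have h5 := mul_le_mul_of_nonneg_right heA hθ.le
    linarith
  -- The equilibrium total is at most (1 + 2/(mθ)) τ above lo, so a shift by A τ overshoots it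
  -- without knowledge of m and θ.
  have hXT : G.total z < lo + A * τ := by
    have h3 : (1 + 2 / (m * θ)) * τ < A * τ := mul_lt_mul_of_pos_right (by linarith) hτ
    linarith
  obtain ⟨h3, h4⟩ := hf.near_of_bracket hβ ⟨(kap_pos hρ).le, kap_le hρ⟩ hθ hL0 hL hc hTθ hTq hτe he0 he1 hsm hXT
    (by linarith) hl i
  refine ⟨h3.trans (mul_le_mul_of_nonneg_right c4 he0.le), h4.trans ?_⟩
  rw [← mul_assoc]
  exact mul_le_mul_of_nonneg_right c5 he0.le

/-- Lowering a quality by `r` from a value near the best response loses an amount of order `r ^ 2`. -/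
lemma utility_drop {β κ a l r E : ℝ} {z : Fin G.n → ℝ} {i : Fin G.n} (hβ : G.StrongModulus β)
    (hκ : 0 ≤ κ) (hκμ : κ ≤ G.μ) (hz : G.FOC κ z) (ha : 0 < a) (hr : 0 < r) (hrl : r ≤ l)
    (hlz : l - r / 2 ≤ z i) (hE : G.mc i l - κ * G.Phi (a + l) l ≤ E) :
    κ * ((l - r) * (a + (l - r)) ^ (G.γ - 1)) - G.cost i (l - r) ≤
      κ * (l * (a + l) ^ (G.γ - 1)) - G.cost i l + E * r - β * r ^ 2 / 8 := by
  have h1 := share_le_tangent (G := G) (x := l - r) (y := l) ha.le (by linarith) (by linarith)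
  have h2 := mul_le_mul_of_nonneg_left h1 hκ
  -- Strong convexity is available only up to z_i, which l may exceed by r/2. It is used on [l - r,
  -- l - r/2], with gain (β/2)(r/2)², and plain convexity on the rest.
  have h3 := hβ.2 i (z i) (hz.1 i) (hz.cost_lt hκ hκμ i) (l - r / 2) (by linarith) hlz (l - r) (by linarith)
    (by linarith)
  have h4 := G.cost_ge_tangent i (x := l) (y := l - r / 2) (by linarith) (by linarith)
  have h5 := G.mc_mono i (show l - r / 2 ≤ l by linarith)
  have h6 := mul_le_mul_of_nonneg_right hE hr.le
  have h7 := mul_le_mul_of_nonneg_right h5 hr.le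
  nlinarith

/-! ### Deviations -/

lemma dev_le {ρ a x s : ℝ} (hρ : ρ ∈ Icc (0 : ℝ) 1) (hs : s ∈ Icc (0 : ℝ) 1) (ha : 0 ≤ a) (hx : 0 < x) :
    G.dev ρ a x s ≤ G.μ * x ^ G.γ := by
  have hα := G.α_pos
  have hμ := G.μ_pos
  have h0 : 0 ≤ x * s := mul_nonneg hx.le hs.1
  have hD : 0 < a + x + G.α * (a + x * s) := by positivity
  have h1 : x * (1 + G.α * ρ * s) / (a + x + G.α * (a + x * s)) ≤ x / (a + x) := by
    rw [div_le_div_iff₀ hD (by linarith), mul_assoc]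
    refine mul_le_mul_of_nonneg_left ?_ hx.le
    have h2 : ρ * s ≤ 1 := mul_le_one₀ hρ.2 hs.1 hs.2
    have h3 : ρ * s * a ≤ a := mul_le_of_le_one_left ha h2
    have h4 : ρ * (x * s) ≤ x * s := mul_le_of_le_one_left h0 hρ.2
    nlinarith
  calc G.dev ρ a x s ≤ G.μ * (a + x) ^ G.γ * (x / (a + x)) := by
        unfold dev; gcongr
    _ = G.μ * (x * (a + x) ^ (G.γ - 1)) := by
        rw [Real.rpow_sub_one (by positivity)]; field_simp
    _ ≤ G.μ * (x * x ^ (G.γ - 1)) := by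
        have : (a + x) ^ (G.γ - 1) ≤ x ^ (G.γ - 1) :=
          Real.rpow_le_rpow_of_nonpos hx (by linarith) (by linarith [G.γ_mem.2])
        gcongr
    _ = G.μ * x ^ G.γ := by rw [Real.rpow_sub_one hx.ne']; field_simp

/-- The utility of a deviation is largest for full or for no sharing. -/
lemma dev_le_of_endpoints {ρ a x s B : ℝ} (hs : s ∈ Icc (0 : ℝ) 1) (ha : 0 < a) (hx : 0 ≤ x)
    (h0 : G.dev ρ a x 0 ≤ B) (h1 : G.dev ρ a x 1 ≤ B) : G.dev ρ a x s ≤ B := by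
  have hα := G.α_pos
  have hμ := G.μ_pos
  have hxs : 0 ≤ x * s := mul_nonneg hx hs.1
  unfold dev at *
  -- After multiplication by the positive denominator the inequality is affine in s.
  rw [← mul_div_assoc, div_le_iff₀ (by positivity)] at *
  nlinarith [mul_le_mul_of_nonneg_left h0 (show 0 ≤ 1 - s by linarith [hs.2]),
    mul_le_mul_of_nonneg_left h1 hs.1]

variable (G) in
lemma exists_lipschitz_dev {p q : ℝ} (hp : 0 < p) :
    ∃ L, 0 ≤ L ∧ ∀ ρ ∈ Icc (0 : ℝ) 1, ∀ ρ' ∈ Icc (0 : ℝ) 1, ∀ a ∈ Icc p q, ∀ a' ∈ Icc p q,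
      ∀ x ∈ Icc 0 q, ∀ x' ∈ Icc 0 q, ∀ s ∈ Icc (0 : ℝ) 1,
      |G.dev ρ a x s - G.dev ρ' a' x' s| ≤ L * (|ρ - ρ'| + |a - a'| + |x - x'|) := by
  have hα := G.α_pos
  have hd : ContDiffOn ℝ 1 (fun v : ℝ × ℝ × ℝ × ℝ => G.dev v.1 v.2.1 v.2.2.1 v.2.2.2)
      (Icc 0 1 ×ˢ Icc p q ×ˢ Icc 0 q ×ˢ Icc 0 1) := by
    unfold dev
    refine ContDiffOn.mul (contDiffOn_const.mul (ContDiffOn.rpow_const_of_ne (by fun_prop) fun v hv => ?_))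
      (ContDiffOn.div (by fun_prop) (by fun_prop) fun v hv => ?_)
    · exact (add_pos_of_pos_of_nonneg (hp.trans_le hv.2.1.1) hv.2.2.1.1).ne'
    · have h1 := hp.trans_le hv.2.1.1
      have h2 := hv.2.2.1.1
      have h3 := mul_nonneg h2 hv.2.2.2.1
      positivity
  obtain ⟨K, hK⟩ := hd.exists_lipschitzOnWith one_ne_zero
    ((convex_Icc _ _).prod ((convex_Icc _ _).prod ((convex_Icc _ _).prod (convex_Icc _ _))))
    (isCompact_Icc.prod (isCompact_Icc.prod (isCompact_Icc.prod isCompact_Icc)))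
  refine ⟨K, K.2, fun ρ hρ ρ' hρ' a ha a' ha' x hx x' hx' s hs => ?_⟩
  have h := hK.dist_le_mul (ρ, a, x, s) ⟨hρ, ha, hx, hs⟩ (ρ', a', x', s) ⟨hρ', ha', hx', hs⟩
  rw [Real.dist_eq] at h
  refine h.trans (mul_le_mul_of_nonneg_left ?_ K.2)
  rw [Prod.dist_eq, Prod.dist_eq, Prod.dist_eq, dist_self, Real.dist_eq, Real.dist_eq, Real.dist_eq]
  simp only
  have h1 := abs_nonneg (ρ - ρ')
  have h2 := abs_nonneg (a - a')
  have h3 := abs_nonneg (x - x')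
  refine max_le ?_ (max_le ?_ (max_le ?_ ?_)) <;> linarith

/-- Positive totals of the others keep every deviation away from the conventions for 0/0. -/
lemma isApproxFSE_iff {η ρ : ℝ} {x : Fin G.n → ℝ} (hx : ∀ i, 0 ≤ x i) (ha : ∀ i, 0 < G.total x - x i) :
    G.IsApproxFSE η ρ x ↔ ∀ i, ∀ y, 0 ≤ y → ∀ s ∈ Icc (0 : ℝ) 1,
      G.dev ρ (G.total x - x i) y s - G.cost i y ≤
        G.dev ρ (G.total x - x i) (x i) 1 - G.cost i (x i) + η := by
  have key : ∀ i, ∀ y, 0 ≤ y → ∀ s ∈ Icc (0 : ℝ) 1,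
      G.utility ρ (Function.update x i y) (Function.update G.full i s) i =
        G.dev ρ (G.total x - x i) y s - G.cost i y := fun i y hy s hs =>
    utility_update hy hs.2 (by have := mul_nonneg hy hs.1; have := ha i; linarith)
  have key' : ∀ i, G.utility ρ x G.full i = G.dev ρ (G.total x - x i) (x i) 1 - G.cost i (x i) :=
    fun i => utility_full (hx i) (by linarith [ha i, hx i])
  constructor
  · intro h i y hy s hs
    rw [← key i y hy s hs, ← key' i]
    exact h.2 i y hy s hs
  · intro h
    refine ⟨hx, fun i y hy s hs => ?_⟩
    rw [key i y hy s hs, key' i]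
    exact h i y hy s hs

/-- The gain from deviations to the sharing level `s` is stable. -/
lemma exists_gain_stability {p q : ℝ} (hp : 0 < p) (hq : 1 ≤ q) :
    ∃ C, 0 ≤ C ∧ ∀ ρ ∈ Icc (0 : ℝ) 1, ∀ ρ' ∈ Icc (0 : ℝ) 1, ∀ x y : Fin G.n → ℝ, ∀ e, |ρ - ρ'| ≤ e →
      (∀ i, p ≤ x i) → (∀ i, p ≤ y i) → G.total x ≤ q → G.total y ≤ q → (∀ i, |x i - y i| ≤ e) →
      ∀ i, ∀ s ∈ Icc (0 : ℝ) 1, ∀ η, 0 ≤ η →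
      (∀ u, 0 ≤ u → G.dev ρ (G.total x - x i) u s - G.cost i u ≤
        G.dev ρ (G.total x - x i) (x i) 1 - G.cost i (x i) + η) →
      ∀ u, 0 ≤ u → G.dev ρ' (G.total y - y i) u s - G.cost i u ≤
        G.dev ρ' (G.total y - y i) (y i) 1 - G.cost i (y i) + (η + C * e) := by
  obtain ⟨M, hM1, hM⟩ := G.exists_cost_ge_traffic
  obtain ⟨L, hL0, hL⟩ := G.exists_lipschitz_dev (q := q + M) hp
  have hn := n_pos (G := G)
  have hD : 0 ≤ ∑ i, G.mc i q := Finset.sum_nonneg fun i _ => G.mc_nonneg i q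
  refine ⟨2 * (L * (2 + G.n)) + ∑ i, G.mc i q, by positivity,
    fun ρ hρ ρ' hρ' x y e hρe hx hy hxq hyq hxy i s hs η hη H u hu => ?_⟩
  have he : 0 ≤ e := (abs_nonneg _).trans hρe
  have hx0 := fun i => hp.le.trans (hx i)
  have hy0 := fun i => hp.le.trans (hy i)
  obtain ⟨j, hj⟩ := exists_ne_index i
  have hax : G.total x - x i ∈ Icc p (q + M) :=
    ⟨(hx j).trans (add_le_total hx0 hj), by linarith [hx0 i]⟩
  have hay : G.total y - y i ∈ Icc p (q + M) :=
    ⟨(hy j).trans (add_le_total hy0 hj), by linarith [hy0 i]⟩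
  have haa : |G.total x - x i - (G.total y - y i)| ≤ G.n * e := by
    have h1 : G.total x - x i - (G.total y - y i) = ∑ j ∈ Finset.univ.erase i, (x j - y j) := by
      unfold total
      rw [Finset.sum_sub_distrib, ← Finset.add_sum_erase _ x (Finset.mem_univ i),
        ← Finset.add_sum_erase _ y (Finset.mem_univ i)]
      ring
    rw [h1]
    calc _ ≤ ∑ j ∈ Finset.univ.erase i, |x j - y j| := Finset.abs_sum_le_sum_abs _ _
      _ ≤ ∑ j, |x j - y j| := Finset.sum_le_univ_sum_of_nonneg fun j => abs_nonneg _
      _ ≤ ∑ _j : Fin G.n, e := Finset.sum_le_sum fun j _ => hxy j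
      _ = G.n * e := by rw [Finset.sum_const, Finset.card_univ, Fintype.card_fin, nsmul_eq_mul]
  have hxq' := (apply_le_total hx0 i).trans hxq
  have hyq' := (apply_le_total hy0 i).trans hyq
  have hU := hL ρ hρ ρ' hρ' _ hax _ hay (x i) ⟨hx0 i, by linarith⟩ (y i) ⟨hy0 i, by linarith⟩ 1 ⟨zero_le_one, le_rfl⟩
  have hc := G.abs_cost_sub_le i (hx0 i) (hy0 i) hxq' hyq'
  have hcs : G.mc i q * |x i - y i| ≤ (∑ i, G.mc i q) * e := by
    have := Finset.single_le_sum (f := fun i => G.mc i q) (fun i _ => G.mc_nonneg i q) (Finset.mem_univ i)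
    gcongr
    exact hxy i
  have hU' : L * (|ρ - ρ'| + |G.total x - x i - (G.total y - y i)| + |x i - y i|) ≤ L * (2 + G.n) * e := by
    rw [mul_assoc]
    refine mul_le_mul_of_nonneg_left ?_ hL0
    linarith [hxy i]
  have hUxy : G.dev ρ (G.total x - x i) (x i) 1 - G.cost i (x i) ≤
      G.dev ρ' (G.total y - y i) (y i) 1 - G.cost i (y i) + (L * (2 + G.n) * e + (∑ i, G.mc i q) * e) := by
    have h1 := (le_abs_self _).trans (hU.trans hU')
    have h2 := (neg_abs_le _).trans' (neg_le_neg (hc.trans hcs))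
    linarith
  have hLe : 0 ≤ L * (2 + G.n) * e := by positivity
  -- Up to M the payoffs are compared by their Lipschitz bounds. Beyond M a deviation earns at most
  -- 0, while the hypothesis for the deviation to 0 bounds the utility at x below by -η.
  rcases le_or_gt u M with h | h
  · have hd := hL ρ' hρ' ρ hρ _ hay _ hax u ⟨hu, by linarith⟩ u ⟨hu, by linarith⟩ s hs
    rw [sub_self, abs_zero, add_zero, abs_sub_comm ρ' ρ, abs_sub_comm (G.total y - y i)] at hd
    have h1 : L * (|ρ - ρ'| + |G.total x - x i - (G.total y - y i)|) ≤ L * (2 + G.n) * e := by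
      rw [mul_assoc]
      refine mul_le_mul_of_nonneg_left ?_ hL0
      linarith
    have h2 := (le_abs_self _).trans (hd.trans h1)
    have := H u hu
    linarith
  · have h1 := dev_le (G := G) hρ' hs (hp.le.trans hay.1) (by linarith : 0 < u)
    have h2 := hM i u h.le
    have h3 := H 0 le_rfl
    have h4 : G.dev ρ (G.total x - x i) 0 s = 0 := by simp [dev]
    rw [h4, G.cost_zero i] at h3
    linarith

end Game


namespace Game

variable {G : Game}

/-! ### Deviations without sharing -/

/-- The parameter ρ drops out, so deviations without sharing may be evaluated with ρ = 0. -/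
lemma dev_zero {ρ a x : ℝ} :
    G.dev ρ a x 0 = G.μ * (a + x) ^ G.γ * (x / ((1 + G.α) * a + x)) := by
  unfold dev
  congr 2 <;> ring

variable (G) in
/-- Derivative of the revenue of a creator who does not share. -/
def ddev (a x : ℝ) : ℝ :=
  G.μ * (G.γ * (a + x) ^ (G.γ - 1)) * (x / ((1 + G.α) * a + x))
    + G.μ * (a + x) ^ G.γ * ((1 + G.α) * a / ((1 + G.α) * a + x) ^ 2)

lemma hasDerivAt_dev_zero {ρ a x : ℝ} (ha : 0 < a) (hx : 0 ≤ x) :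
    HasDerivAt (fun x => G.dev ρ a x 0) (G.ddev a x) x := by
  have hα := G.α_pos
  have h0 : 0 < a + x := by linarith
  have hb : 0 < (1 + G.α) * a + x := by positivity
  have h1 : HasDerivAt (fun x => G.μ * (a + x) ^ G.γ) (G.μ * (G.γ * (a + x) ^ (G.γ - 1))) x := by
    simpa using (((hasDerivAt_id x).const_add a).rpow_const (p := G.γ) (Or.inl h0.ne')).const_mul G.μ
  have h2 : HasDerivAt (fun x => x / ((1 + G.α) * a + x)) ((1 + G.α) * a / ((1 + G.α) * a + x) ^ 2) x := by
    refine ((hasDerivAt_id x).fun_div ((hasDerivAt_id x).const_add ((1 + G.α) * a)) hb.ne').congr_deriv ?_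
    simp
  simp_rw [dev_zero]
  exact h1.fun_mul h2

variable (G) in
lemma exists_lipschitz_ddev {p q M : ℝ} (hp : 0 < p) :
    ∃ L, 0 ≤ L ∧ ∀ a ∈ Icc p q, ∀ x ∈ Icc 0 M, ∀ y ∈ Icc 0 M, |G.ddev a x - G.ddev a y| ≤ L * |x - y| := by
  have hα := G.α_pos
  have hd : ContDiffOn ℝ 1 (fun v : ℝ × ℝ => G.ddev v.1 v.2) (Icc p q ×ˢ Icc 0 M) := by
    have e0 : ∀ v ∈ Icc p q ×ˢ Icc 0 M, v.1 + v.2 ≠ 0 := fun v hv =>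
      (add_pos_of_pos_of_nonneg (hp.trans_le hv.1.1) hv.2.1).ne'
    have e1 : ∀ v ∈ Icc p q ×ˢ Icc 0 M, (1 + G.α) * v.1 + v.2 ≠ 0 := fun v hv => by
      have h1 := hp.trans_le hv.1.1
      have h2 := hv.2.1
      positivity
    unfold ddev
    refine ContDiffOn.add (ContDiffOn.mul (contDiffOn_const.mul (contDiffOn_const.mul
      (ContDiffOn.rpow_const_of_ne (by fun_prop) e0))) (ContDiffOn.div (by fun_prop) (by fun_prop) e1)) ?_
    refine ContDiffOn.mul (contDiffOn_const.mul (ContDiffOn.rpow_const_of_ne (by fun_prop) e0))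
      (ContDiffOn.div (by fun_prop) (by fun_prop) fun v hv => pow_ne_zero 2 (e1 v hv))
  obtain ⟨K, hK⟩ := hd.exists_lipschitzOnWith one_ne_zero ((convex_Icc _ _).prod (convex_Icc _ _))
    (isCompact_Icc.prod isCompact_Icc)
  refine ⟨K, K.2, fun a ha x hx y hy => ?_⟩
  have h := hK.dist_le_mul (a, x) ⟨ha, hx⟩ (a, y) ⟨ha, hy⟩
  rw [Real.dist_eq] at h
  refine h.trans (mul_le_mul_of_nonneg_left ?_ K.2)
  rw [Prod.dist_eq, dist_self, Real.dist_eq]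
  exact max_le (abs_nonneg _) le_rfl

variable (G) in
/-- The largest utility without sharing is found, up to a second order error, on a grid that is adapted to the
marginal cost. -/
lemma exists_scan_bound {p q M : ℝ} (hp : 0 < p) (hM : 1 ≤ M)
    (hM' : ∀ i, ∀ x, M ≤ x → G.μ * x ^ G.γ ≤ G.cost i x) :
    ∃ L, 0 ≤ L ∧ ∀ i, ∀ a ∈ Icc p q, ∀ best h tol, 0 ≤ best → 0 ≤ h → 0 ≤ tol →
      (∀ x ∈ Ico 0 M, ∃ y, 0 ≤ y ∧ y ≤ x ∧ x - y ≤ h ∧ (x - y) * (G.mc i x - G.mc i y) ≤ tol ∧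
        G.dev 0 a y 0 - G.cost i y ≤ best) →
      ∀ x, 0 ≤ x → G.dev 0 a x 0 - G.cost i x ≤ best + L * h ^ 2 + tol := by
  obtain ⟨L, hL0, hL⟩ := G.exists_lipschitz_ddev (q := q) (M := M) hp
  refine ⟨L, hL0, fun i a ha best h tol hbest hh htol H x hx => ?_⟩
  have ha0 : 0 < a := hp.trans_le ha.1
  have hLh : 0 ≤ L * h ^ 2 := by positivity
  have hbig : ∀ x, M ≤ x → G.dev 0 a x 0 - G.cost i x ≤ 0 := fun x hx => by
    have h1 := dev_le (G := G) (ρ := 0) (s := 0) ⟨le_rfl, zero_le_one⟩ ⟨le_rfl, zero_le_one⟩ ha0.le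
      (by linarith : 0 < x)
    have h2 := hM' i x hx
    linarith
  rcases le_or_gt M x with hxM | hxM
  · linarith [hbig x hxM]
  have hcont : ContinuousOn (fun x => G.dev 0 a x 0 - G.cost i x) (Icc 0 M) := by
    refine ContinuousOn.sub (fun y hy => ?_) ((G.continuousOn_cost i).mono fun y hy => hy.1)
    exact (hasDerivAt_dev_zero ha0 hy.1).continuousAt.continuousWithinAt
  obtain ⟨z, hz, hmax⟩ := isCompact_Icc.exists_isMaxOn (nonempty_Icc.2 (by linarith : (0:ℝ) ≤ M)) hcont
  refine (hmax ⟨hx, hxM.le⟩ : _ ≤ G.dev 0 a z 0 - G.cost i z).trans ?_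
  rcases le_or_gt (G.dev 0 a z 0 - G.cost i z) 0 with h0 | h0
  · linarith
  have hzM : z < M := by
    by_contra! hcon
    exact absurd (hbig z hcon) (not_le.2 h0)
  have hz0 : 0 < z := by
    refine lt_of_le_of_ne hz.1 ?_
    rintro rfl
    simp [dev, G.cost_zero i] at h0
  have hder : ∀ y, 0 < y → HasDerivAt (fun x => G.dev 0 a x 0 - G.cost i x) (G.ddev a y - G.mc i y) y :=
    fun y hy => (hasDerivAt_dev_zero ha0 hy.le).fun_sub (G.hasDerivAt_cost i hy)
  have hcrit : G.ddev a z - G.mc i z = 0 :=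
    (hmax.isLocalMax (Icc_mem_nhds hz0 hzM)).hasDerivAt_eq_zero (hder z hz0)
  obtain ⟨y, hy0, hyz, hyh, hyt, hyb⟩ := H z ⟨hz0.le, hzM⟩
  rcases hyz.eq_or_lt with rfl | hyz
  · linarith
  -- The derivative vanishes at z. At w the revenue part differs by at most L h, and the cost part
  -- by at most c'(z) - c'(y); no bound on c'' is available near 0, so the latter is kept as a
  -- separate error.
  obtain ⟨w, hw, hw'⟩ := exists_hasDerivAt_eq_slope _ _ hyz
    (hcont.mono (Icc_subset_Icc hy0 hz.2)) fun w hw => hder w (hy0.trans_lt hw.1)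
  rw [eq_div_iff (by linarith)] at hw'
  have h1 := hL a ha w ⟨hy0.trans hw.1.le, hw.2.le.trans hz.2⟩ z hz
  have h2 := G.mc_mono i hw.1.le
  have h3 : |w - z| ≤ h := by
    rw [abs_sub_comm, abs_of_pos (by linarith [hw.2])]
    linarith [hw.1]
  have h4 : G.ddev a w - G.mc i w ≤ L * h + (G.mc i z - G.mc i y) := by
    have := (le_abs_self _).trans h1
    have := mul_le_mul_of_nonneg_left h3 hL0
    linarith
  have h5 : (G.ddev a w - G.mc i w) * (z - y) ≤ (L * h + (G.mc i z - G.mc i y)) * (z - y) :=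
    mul_le_mul_of_nonneg_right h4 (by linarith)
  have h6 : L * h * (z - y) ≤ L * h * h := mul_le_mul_of_nonneg_left hyh (by positivity)
  linarith

/-! ### Full sharing is stable when the creators obtain almost the whole revenue -/

lemma isFSE_iff {ρ : ℝ} {x : Fin G.n → ℝ} : G.IsFSE ρ x ↔ G.IsApproxFSE 0 ρ x := by
  simp [IsFSE, IsApproxFSE]

lemma IsESE.others_pos {ρ : ℝ} (hρ : ρ ∈ Icc (0 : ℝ) 1) {z : Fin G.n → ℝ} (h : G.IsESE ρ z) (i : Fin G.n) :
    0 < G.total z - z i := (h.foc hρ).others_pos i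

lemma IsESE.total_pos {ρ : ℝ} (hρ : ρ ∈ Icc (0 : ℝ) 1) {z : Fin G.n → ℝ} (h : G.IsESE ρ z) :
    0 < G.total z := (h.foc hρ).total_pos

lemma IsESE.dev_one_le {ρ : ℝ} (hρ : ρ ∈ Icc (0 : ℝ) 1) {z : Fin G.n → ℝ} (h : G.IsESE ρ z) (i : Fin G.n)
    {x : ℝ} (hx : 0 ≤ x) : G.dev ρ (G.total z - z i) x 1 - G.cost i x ≤
      G.dev ρ (G.total z - z i) (z i) 1 - G.cost i (z i) := by
  have ha := h.others_pos hρ i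
  rw [← utility_update_full hx (by linarith), ← utility_full (h.1 i) (h.total_pos hρ)]
  exact h.2 i x hx

/-- Cross-multiplication leaves, up to nonnegative factors, α (s' - s)(ρ(1+α)a - (1-ρ)x). -/
lemma dev_mono_right {ρ a x s s' : ℝ} (ha : 0 < a) (hx : 0 ≤ x) (hs : 0 ≤ s) (hss : s ≤ s')
    (h : (1 - ρ) * x ≤ ρ * ((1 + G.α) * a)) : G.dev ρ a x s ≤ G.dev ρ a x s' := by
  have hα := G.α_pos
  have hμ := G.μ_pos
  have hs' := hs.trans hss
  unfold dev
  refine mul_le_mul_of_nonneg_left ?_ (by positivity)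
  rw [div_le_div_iff₀ (by positivity) (by positivity), mul_assoc x, mul_assoc x]
  refine mul_le_mul_of_nonneg_left ?_ hx
  have h1 : 0 ≤ G.α * ((s' - s) * (ρ * ((1 + G.α) * a) - (1 - ρ) * x)) := by
    have := sub_nonneg.2 h
    have := sub_nonneg.2 hss
    positivity
  nlinarith

/-- The parameter solves (1-ρ)M = ρ(1+α)θ. Then full sharing is best for every quality up to M, and
larger qualities do not pay. That ρ < 1 gives the platform positive revenue. -/
lemma exists_isFSE {β θ q : ℝ} (hβ : G.StrongModulus β) (hb : G.Bounds θ q) :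
    ∃ ρ ∈ Ico (0 : ℝ) 1, ∃ z, G.IsESE ρ z ∧ G.IsFSE ρ z := by
  obtain ⟨M, hM1, hM⟩ := G.exists_cost_ge_traffic
  obtain ⟨hθ, hθ1, hq, H⟩ := hb
  have hα := G.α_pos
  have hM0 : 0 < M := by linarith
  set ρ := M / (M + (1 + G.α) * θ)
  have hρ0 : 0 ≤ ρ := by positivity
  have hρ1 : ρ < 1 := (div_lt_one (by positivity)).2 (lt_add_of_pos_right _ (by positivity))
  have hρ : ρ ∈ Icc (0 : ℝ) 1 := ⟨hρ0, hρ1.le⟩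
  obtain ⟨z, hz, -⟩ := existsUnique_isESE hβ hρ
  refine ⟨ρ, ⟨hρ0, hρ1⟩, z, hz, ?_⟩
  rw [isFSE_iff, isApproxFSE_iff hz.1 (hz.others_pos hρ)]
  intro i y hy s hs
  rw [add_zero]
  have ha := hz.others_pos hρ i
  obtain ⟨j, hj⟩ := exists_ne_index i
  have haθ : θ ≤ G.total z - z i := ((H ρ hρ z hz).1 j).trans (add_le_total hz.1 hj)
  rcases le_or_gt y M with h | h
  · refine le_trans ?_ (hz.dev_one_le hρ i hy)
    refine sub_le_sub_right (dev_mono_right ha hy hs.1 hs.2 ?_) _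
    have e : (1 - ρ) * M = ρ * ((1 + G.α) * θ) := by
      simp only [ρ]
      field_simp
      ring
    calc (1 - ρ) * y ≤ (1 - ρ) * M := mul_le_mul_of_nonneg_left h (by linarith)
      _ = ρ * ((1 + G.α) * θ) := e
      _ ≤ _ := by gcongr
  · have h1 := dev_le (G := G) hρ hs ha.le (by linarith : 0 < y)
    have h2 := hM i y h.le
    have h3 := hz.dev_one_le hρ i le_rfl
    have h4 : G.dev ρ (G.total z - z i) 0 1 = 0 := by simp [dev]
    rw [h4, G.cost_zero i] at h3
    linarith

/-! ### Revenue of the platform -/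

lemma revenue_full {ρ : ℝ} {x : Fin G.n → ℝ} (h : 0 < G.total x) :
    G.revenue ρ x G.full = G.μ * G.total x ^ G.γ * (G.α / (1 + G.α)) * (1 - ρ) := by
  have hα := G.α_pos
  have hs : G.shared x G.full = G.total x := by simp [shared, total, full]
  have hp : G.allocPlatform ρ x G.full = 1 - ρ := by
    unfold allocPlatform alloc
    simp only [hs, h, if_true, full, mul_one]
    rw [← Finset.mul_sum, sum_div_total h, mul_one]
  unfold revenue qAI traffic
  rw [hp, hs]
  congr 2
  field_simp

lemma revenue_full_nonneg {ρ : ℝ} (hρ : ρ ≤ 1) {x : Fin G.n → ℝ} (h : 0 < G.total x) :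
    0 ≤ G.revenue ρ x G.full := by
  have hα := G.α_pos
  have hμ := G.μ_pos
  rw [revenue_full h]
  have : 0 ≤ 1 - ρ := by linarith
  positivity

lemma revenue_full_le {ρ q : ℝ} (hρ : ρ ∈ Icc (0 : ℝ) 1) (hq : 1 ≤ q) {x : Fin G.n → ℝ} (h : 0 < G.total x)
    (hxq : G.total x ≤ q) : G.revenue ρ x G.full ≤ G.μ * q := by
  have hα := G.α_pos
  have hμ := G.μ_pos
  rw [revenue_full h]
  have h1 : G.total x ^ G.γ ≤ q := by
    calc G.total x ^ G.γ ≤ q ^ G.γ := Real.rpow_le_rpow h.le hxq G.γ_mem.1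
      _ ≤ q := by simpa using Real.rpow_le_rpow_of_exponent_le hq G.γ_mem.2
  have h2 : G.α / (1 + G.α) ≤ 1 := (div_le_one (by linarith)).2 (by linarith)
  have h3 : 1 - ρ ≤ 1 := by linarith [hρ.1]
  have h4 : 0 ≤ 1 - ρ := by linarith [hρ.2]
  calc _ ≤ G.μ * q * 1 * 1 := by gcongr
    _ = _ := by ring

variable (G) in
lemma exists_lipschitz_revenue {p q : ℝ} (hp : 0 < p) :
    ∃ L, 0 ≤ L ∧ ∀ ρ ∈ Icc (0 : ℝ) 1, ∀ ρ' ∈ Icc (0 : ℝ) 1, ∀ x y : Fin G.n → ℝ, ∀ e, |ρ - ρ'| ≤ e →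
      (∀ i, p ≤ x i) → (∀ i, p ≤ y i) → G.total x ≤ q → G.total y ≤ q → (∀ i, |x i - y i| ≤ e) →
      G.revenue ρ x G.full ≤ G.revenue ρ' y G.full + L * e := by
  have hd : ContDiffOn ℝ 1 (fun v : ℝ × ℝ => G.μ * v.2 ^ G.γ * (G.α / (1 + G.α)) * (1 - v.1))
      (Icc 0 1 ×ˢ Icc p q) := by
    refine ContDiffOn.mul (ContDiffOn.mul (contDiffOn_const.mul
      (ContDiffOn.rpow_const_of_ne (by fun_prop) fun v hv => (hp.trans_le hv.2.1).ne')) contDiffOn_const)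
      (by fun_prop)
  obtain ⟨K, hK⟩ := hd.exists_lipschitzOnWith one_ne_zero ((convex_Icc _ _).prod (convex_Icc _ _))
    (isCompact_Icc.prod isCompact_Icc)
  refine ⟨K * G.n, mul_nonneg K.2 (Nat.cast_nonneg _), fun ρ hρ ρ' hρ' x y e he hx hy hxq hyq hxy => ?_⟩
  have he0 : 0 ≤ e := (abs_nonneg _).trans he
  have i₀ : Fin G.n := ⟨0, by linarith [G.two_le_n]⟩
  have hx0 : p ≤ G.total x := (hx i₀).trans (apply_le_total (fun i => hp.le.trans (hx i)) i₀)
  have hy0 : p ≤ G.total y := (hy i₀).trans (apply_le_total (fun i => hp.le.trans (hy i)) i₀)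
  rw [revenue_full (hp.trans_le hx0), revenue_full (hp.trans_le hy0)]
  have h := hK.dist_le_mul (ρ, G.total x) ⟨hρ, hx0, hxq⟩ (ρ', G.total y) ⟨hρ', hy0, hyq⟩
  rw [Real.dist_eq, Prod.dist_eq, Real.dist_eq, Real.dist_eq] at h
  have hn1 := one_le_n (G := G)
  have h1 : max |ρ - ρ'| |G.total x - G.total y| ≤ G.n * e := by
    refine max_le (he.trans (le_mul_of_one_le_left he0 hn1)) ?_
    unfold total
    rw [← Finset.sum_sub_distrib]
    calc _ ≤ ∑ j, |x j - y j| := Finset.abs_sum_le_sum_abs _ _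
      _ ≤ ∑ _j : Fin G.n, e := Finset.sum_le_sum fun j _ => hxy j
      _ = G.n * e := by rw [Finset.sum_const, Finset.card_univ, Fintype.card_fin, nsmul_eq_mul]
  have h2 := (le_abs_self _).trans (h.trans (mul_le_mul_of_nonneg_left h1 K.2))
  simp only at h2
  linarith

lemma feasibleRevenues_nonempty {β θ q : ℝ} (hβ : G.StrongModulus β) (hb : G.Bounds θ q) :
    G.feasibleRevenues.Nonempty := by
  obtain ⟨ρ, hρ, z, hz, hz'⟩ := exists_isFSE hβ hb
  exact ⟨_, ρ, ⟨hρ.1, hρ.2.le⟩, z, hz, hz', rfl⟩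

lemma le_of_mem_feasibleRevenues {θ q u : ℝ} (hb : G.Bounds θ q) (hu : u ∈ G.feasibleRevenues) :
    u ≤ G.μ * q := by
  obtain ⟨ρ, hρ, z, hz, -, rfl⟩ := hu
  exact revenue_full_le hρ hb.2.2.1 (hz.total_pos hρ) (hb.2.2.2 ρ hρ z hz).2

lemma isLUB_opt {β θ q : ℝ} (hβ : G.StrongModulus β) (hb : G.Bounds θ q) :
    IsLUB G.feasibleRevenues G.opt :=
  isLUB_csSup (feasibleRevenues_nonempty hβ hb) ⟨_, fun _ hu => le_of_mem_feasibleRevenues hb hu⟩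

end Game


namespace Game

variable {G : Game}

/-! ### Guarantees for the outputs of the algorithm -/

lemma gridPoint_mem (δ : ℝ) (t : ℕ) : gridPoint δ t ∈ Icc (0 : ℝ) 1 :=
  ⟨le_min (by positivity) zero_le_one, min_le_right _ _⟩

lemma one_le_ceil {δ : ℝ} (hδ : 0 < δ) : 1 ≤ ⌈1 / δ⌉₊ := Nat.ceil_pos.2 (by positivity)

lemma gridPoint_of_le {δ : ℝ} (hδ : 0 < δ) {t : ℕ} (ht : t ≤ ⌈1 / δ⌉₊) :
    gridPoint δ t = (t : ℝ) / (⌈1 / δ⌉₊ : ℝ) := by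
  have h : (0 : ℝ) < ⌈1 / δ⌉₊ := by exact_mod_cast one_le_ceil hδ
  exact min_eq_left ((div_le_one h).2 (by exact_mod_cast ht))

lemma exists_gridPoint_near {δ ρ : ℝ} (hδ : 0 < δ) (hρ : ρ ∈ Icc (0 : ℝ) 1) :
    ∃ k < ⌈1 / δ⌉₊, |gridPoint δ (k + 1) - ρ| ≤ δ := by
  have hN1 := one_le_ceil hδ
  have hNδ : 1 / δ ≤ (⌈1 / δ⌉₊ : ℝ) := Nat.le_ceil _
  have hN : (0 : ℝ) < ⌈1 / δ⌉₊ := by exact_mod_cast hN1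
  set N := ⌈1 / δ⌉₊
  have hδN : 1 ≤ δ * N := by rwa [div_le_iff₀ hδ, mul_comm] at hNδ
  have h0 := mul_nonneg hρ.1 hN.le
  have hf : ⌊ρ * N⌋₊ ≤ N := Nat.floor_le_of_le (mul_le_of_le_one_left hN.le hρ.2)
  -- The examined indices k + 1 run from 1 to N, so ρ is rounded up; the minimum is needed for ρ =
  -- 1, where the floor is already N.
  refine ⟨min ⌊ρ * N⌋₊ (N - 1), by omega, ?_⟩
  rw [gridPoint_of_le hδ (by omega)]
  have h1 := Nat.floor_le h0
  have h2 := Nat.lt_floor_add_one (ρ * N)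
  have h3 : ((N : ℕ) : ℝ) - 1 = ((N - 1 : ℕ) : ℝ) := by push_cast [hN1]; ring
  have hle : (N : ℝ) * ρ ≤ N := mul_le_of_le_one_right hN.le hρ.2
  rcases le_total ⌊ρ * N⌋₊ (N - 1) with h | h
  · rw [min_eq_left h, abs_le]
    push_cast
    constructor
    · rw [neg_le_sub_iff_le_add, ← sub_le_iff_le_add, le_div_iff₀ hN]
      nlinarith
    · rw [sub_le_iff_le_add, div_le_iff₀ hN]
      nlinarith
  · rw [min_eq_right h, abs_le]
    have h4 : ((N - 1 : ℕ) : ℝ) ≤ ⌊ρ * N⌋₊ := by exact_mod_cast h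
    push_cast
    rw [← h3] at h4 ⊢
    constructor
    · rw [neg_le_sub_iff_le_add, ← sub_le_iff_le_add, le_div_iff₀ hN]
      nlinarith
    · rw [sub_le_iff_le_add, div_le_iff₀ hN]
      nlinarith

lemma NearESE.abs_sub_le {δ ρ : ℝ} {x z : Fin G.n → ℝ} {β : ℝ} (hβ : G.StrongModulus β)
    (hρ : ρ ∈ Icc (0 : ℝ) 1) (h : G.NearESE δ ρ x) (hz : G.IsESE ρ z) (i : Fin G.n) :
    |x i - z i| ≤ δ := by
  obtain ⟨z', hz', hd⟩ := h.2
  obtain rfl := (existsUnique_isESE hβ hρ).unique hz hz'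
  rw [dist_eq_norm] at hd
  exact (PiLp.norm_apply_le (WithLp.toLp 2 x - WithLp.toLp 2 z) i).trans hd

/-- All that the analysis uses of an execution: the origin of the recorded pair, and that it
dominates every accepted profile. -/
lemma AlgState.invariant {δ η : ℝ} {t : ℕ} {ρ u : ℝ} (h : G.AlgState δ η t ρ u) :
    0 ≤ u ∧ (ρ = 0 ∧ u = 0 ∨ ∃ k x, ρ = gridPoint δ k ∧ G.NearESE δ ρ x ∧ G.IsApproxFSE η ρ x ∧
      u = G.revenue ρ x G.full) ∧
    ∀ k < t, ∃ x, G.NearESE δ (gridPoint δ (k + 1)) x ∧ (G.IsApproxFSE η (gridPoint δ (k + 1)) x →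
      G.revenue (gridPoint δ (k + 1)) x G.full ≤ u) := by
  induction h with
  | start => exact ⟨le_rfl, Or.inl ⟨rfl, rfl⟩, fun k hk => absurd hk (Nat.not_lt_zero k)⟩
  | @update t ρ' u x _ hx hu ih =>
    refine ⟨ih.1.trans hu.2.le, Or.inr ⟨t + 1, x, rfl, hx, hu.1, rfl⟩, fun k hk => ?_⟩
    rcases Nat.lt_succ_iff_lt_or_eq.1 hk with hk | rfl
    · obtain ⟨y, hy, hy'⟩ := ih.2.2 k hk
      exact ⟨y, hy, fun h => (hy' h).trans hu.2.le⟩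
    · exact ⟨x, hx, fun _ => le_rfl⟩
  | @keep t ρ' u x _ hx hu ih =>
    refine ⟨ih.1, ih.2.1, fun k hk => ?_⟩
    rcases Nat.lt_succ_iff_lt_or_eq.1 hk with hk | rfl
    · exact ih.2.2 k hk
    · exact ⟨x, hx, fun h => not_lt.1 fun h' => hu ⟨h, h'⟩⟩

lemma IsOutput.mem {δ η ρ : ℝ} (h : G.IsOutput δ η ρ) : ρ ∈ Icc (0 : ℝ) 1 := by
  obtain ⟨u, hu⟩ := h
  rcases hu.invariant.2.1 with h | ⟨k, x, rfl, -⟩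
  · rw [h.1]; exact ⟨le_rfl, zero_le_one⟩
  · exact gridPoint_mem _ _

/-- For large `ε` the guarantees are trivial. -/
lemma guarantee_of_large {β θ q M ε ρ : ℝ} (hβ : G.StrongModulus β) (hb : G.Bounds θ q) (hM1 : 1 ≤ M)
    (hM : ∀ i, ∀ x, M ≤ x → G.μ * x ^ G.γ ≤ G.cost i x) (hε : G.μ * (M + q) ≤ ε)
    (hρ : ρ ∈ Icc (0 : ℝ) 1) {z : Fin G.n → ℝ} (hz : G.IsESE ρ z) :
    G.IsApproxFSE ε ρ z ∧ G.opt - ε ≤ G.revenue ρ z G.full := by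
  have hμ := G.μ_pos
  have hq := hb.2.2.1
  have h1 : G.μ * M ≤ ε := le_trans (by gcongr; linarith) hε
  have h2 : G.μ * q ≤ ε := le_trans (by gcongr; linarith) hε
  constructor
  · rw [isApproxFSE_iff hz.1 (hz.others_pos hρ)]
    intro i y hy s hs
    have h3 := hz.dev_one_le hρ i le_rfl
    have h4 (s : ℝ) : G.dev ρ (G.total z - z i) 0 s = 0 := by simp [dev]
    rw [h4, G.cost_zero i] at h3
    have hε0 : 0 ≤ ε := le_trans (by positivity) h2
    rcases hy.eq_or_lt with rfl | hy
    · rw [h4, G.cost_zero i]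
      linarith
    have h5 := dev_le (G := G) hρ hs (hz.others_pos hρ i).le hy
    rcases le_total y M with h | h
    · have h6 : y ^ G.γ ≤ M := by
        calc y ^ G.γ ≤ M ^ G.γ := Real.rpow_le_rpow hy.le h G.γ_mem.1
          _ ≤ M := by simpa using Real.rpow_le_rpow_of_exponent_le hM1 G.γ_mem.2
      have h7 := mul_le_mul_of_nonneg_left h6 hμ.le
      have h8 := G.cost_nonneg i hy.le
      linarith
    · have := hM i y h
      linarith
  · have h3 := (isLUB_opt hβ hb).2 fun u hu => le_of_mem_feasibleRevenues hb hu
    have h4 := revenue_full_nonneg hρ.2 (hz.total_pos hρ)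
    linarith

/-- Two transfers: from a feasible ρ to the profile of a nearby grid point, which is therefore
accepted, and from the recorded profile back to the exact equilibrium of its parameter. -/
lemma guarantee_of_small {β θ q Ce Cg Cr δ ε r₀ ρ' : ℝ} (hβ : G.StrongModulus β) (hb : G.Bounds θ q)
    (hCe0 : 0 ≤ Ce) (hCe : ∀ ρ ∈ Icc (0 : ℝ) 1, ∀ ρ' ∈ Icc (0 : ℝ) 1, ∀ z z', G.IsESE ρ z → G.IsESE ρ' z' →
      ∀ i, |z i - z' i| ≤ Ce * |ρ - ρ'|)
    (hCg0 : 0 ≤ Cg) (hCg : ∀ ρ ∈ Icc (0 : ℝ) 1, ∀ ρ' ∈ Icc (0 : ℝ) 1, ∀ x y : Fin G.n → ℝ, ∀ e, |ρ - ρ'| ≤ e →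
      (∀ i, θ / 2 ≤ x i) → (∀ i, θ / 2 ≤ y i) → G.total x ≤ q + 1 → G.total y ≤ q + 1 →
      (∀ i, |x i - y i| ≤ e) → ∀ i, ∀ s ∈ Icc (0 : ℝ) 1, ∀ η, 0 ≤ η →
      (∀ u, 0 ≤ u → G.dev ρ (G.total x - x i) u s - G.cost i u ≤
        G.dev ρ (G.total x - x i) (x i) 1 - G.cost i (x i) + η) →
      ∀ u, 0 ≤ u → G.dev ρ' (G.total y - y i) u s - G.cost i u ≤
        G.dev ρ' (G.total y - y i) (y i) 1 - G.cost i (y i) + (η + Cg * e))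
    (hCr : ∀ ρ ∈ Icc (0 : ℝ) 1, ∀ ρ' ∈ Icc (0 : ℝ) 1, ∀ x y : Fin G.n → ℝ, ∀ e, |ρ - ρ'| ≤ e →
      (∀ i, θ / 2 ≤ x i) → (∀ i, θ / 2 ≤ y i) → G.total x ≤ q + 1 → G.total y ≤ q + 1 →
      (∀ i, |x i - y i| ≤ e) → G.revenue ρ x G.full ≤ G.revenue ρ' y G.full + Cr * e)
    (hr₀ : r₀ ∈ G.feasibleRevenues) (hδ : 0 < δ) (hδθ : δ ≤ θ / 2) (hδn : G.n * δ ≤ 1)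
    (hδr : Cr * ((1 + Ce) * δ) < r₀)
    (h1 : Cg * ((1 + Ce) * δ) ≤ ε / 4) (h2 : Cr * ((2 + Ce) * δ) ≤ ε) (hε : 0 < ε)
    (hout : G.IsOutput δ (ε / 4) ρ') {z : Fin G.n → ℝ} (hz : G.IsESE ρ' z) :
    G.IsApproxFSE ε ρ' z ∧ G.opt - ε ≤ G.revenue ρ' z G.full := by
  have hlub := isLUB_opt hβ hb
  have hρ' := hout.mem
  obtain ⟨hθ, hθ1, hq, H⟩ := hb
  obtain ⟨u, hu⟩ := hout
  obtain ⟨hu0, hcase, hall⟩ := hu.invariant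
  have hn := n_pos (G := G)
  have hnear : ∀ ρ ∈ Icc (0 : ℝ) 1, ∀ x z, G.NearESE δ ρ x → G.IsESE ρ z →
      (∀ i, θ / 2 ≤ x i) ∧ G.total x ≤ q + 1 := by
    intro ρ hρ x z hx hz
    have h3 := fun i => hx.abs_sub_le hβ hρ hz i
    have h4 := H ρ hρ z hz
    refine ⟨fun i => ?_, ?_⟩
    · have := (abs_le.1 (h3 i)).1
      linarith [h4.1 i]
    · have : G.total x ≤ ∑ i, (z i + δ) :=
        Finset.sum_le_sum fun i _ => by have := (abs_le.1 (h3 i)).2; linarith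
      rw [Finset.sum_add_distrib, Finset.sum_const, Finset.card_univ, Fintype.card_fin, nsmul_eq_mul] at this
      change _ ≤ G.total z + _ at this
      linarith [h4.2]
  have hESE : ∀ ρ ∈ Icc (0 : ℝ) 1, ∀ z, G.IsESE ρ z → (∀ i, θ / 2 ≤ z i) ∧ G.total z ≤ q + 1 := by
    intro ρ hρ z hz
    have h4 := H ρ hρ z hz
    exact ⟨fun i => by linarith [h4.1 i], by linarith [h4.2]⟩
  have hothers : ∀ x : Fin G.n → ℝ, (∀ i, θ / 2 ≤ x i) → ∀ i, 0 < G.total x - x i := fun x hx i => by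
    obtain ⟨j, hj⟩ := exists_ne_index i
    have := add_le_total (fun i => le_trans (by positivity) (hx i)) hj
    linarith [hx j]
  -- The profile x of the grid point σ is within (1 + Ce) δ of y: the equilibria differ by at most
  -- Ce δ, and x adds δ. The gain at y is at most 0, so that at x is at most ε/4.
  have hfeas : ∀ r ∈ G.feasibleRevenues, r ≤ u + Cr * ((1 + Ce) * δ) := by
    rintro _ ⟨ρ, hρ, y, hy, hy', rfl⟩
    obtain ⟨k, hk, hkρ⟩ := exists_gridPoint_near hδ hρ
    obtain ⟨x, hx, hxu⟩ := hall k hk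
    have hg := gridPoint_mem δ (k + 1)
    set σ := gridPoint δ (k + 1)
    obtain ⟨w, hw, -⟩ := existsUnique_isESE hβ hg
    obtain ⟨hx1, hx2⟩ := hnear σ hg x w hx hw
    obtain ⟨hy1, hy2⟩ := hESE ρ hρ y hy
    have hd : ∀ i, |y i - x i| ≤ (1 + Ce) * δ := fun i => by
      have h3 := hx.abs_sub_le hβ hg hw i
      have h4 := hCe σ hg ρ hρ w y hw hy i
      have h5 := mul_le_mul_of_nonneg_left hkρ hCe0
      have h6 := abs_sub_le (y i) (w i) (x i)
      rw [abs_sub_comm (y i) (w i), abs_sub_comm (w i) (x i)] at h6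
      linarith
    have hρσ : |ρ - σ| ≤ (1 + Ce) * δ := by
      rw [abs_sub_comm]
      nlinarith
    have hfse : G.IsApproxFSE (ε / 4) σ x := by
      rw [isApproxFSE_iff hx.1 (hothers x hx1)]
      intro i v hv s hs
      rw [isFSE_iff, isApproxFSE_iff hy.1 (hothers y hy1)] at hy'
      have := hCg ρ hρ σ hg y x _ hρσ hy1 hx1 hy2 hx2 hd i s hs 0 le_rfl (fun v hv => hy' i v hv s hs) v hv
      linarith
    have h3 := hCr ρ hρ σ hg y x _ hρσ hy1 hx1 hy2 hx2 hd
    have := hxu hfse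
    linarith
  -- This excludes the untouched initial pair, whose parameter 0 carries no guarantee.
  have hupos : 0 < u := by
    have := hfeas r₀ hr₀
    linarith
  rcases hcase with ⟨-, h⟩ | ⟨k, x, -, hx, hfse, hux⟩
  · exact absurd h hupos.ne'
  obtain ⟨hx1, hx2⟩ := hnear ρ' hρ' x z hx hz
  obtain ⟨hz1, hz2⟩ := hESE ρ' hρ' z hz
  have hd := fun i => hx.abs_sub_le hβ hρ' hz i
  have hρρ : |ρ' - ρ'| ≤ δ := by simpa using hδ.le
  have e1 : Cg * δ ≤ Cg * ((1 + Ce) * δ) := mul_le_mul_of_nonneg_left (by nlinarith) hCg0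
  constructor
  · rw [isApproxFSE_iff hz.1 (hothers z hz1)]
    intro i v hv s hs
    rw [isApproxFSE_iff hx.1 (hothers x hx1)] at hfse
    have := hCg ρ' hρ' ρ' hρ' x z δ hρρ hx1 hz1 hx2 hz2 hd i s hs (ε / 4) (by positivity)
      (fun v hv => hfse i v hv s hs) v hv
    linarith
  · have h3 := hCr ρ' hρ' ρ' hρ' x z δ hρρ hx1 hz1 hx2 hz2 hd
    have h4 : G.opt ≤ u + Cr * ((1 + Ce) * δ) := hlub.2 hfeas
    linarith

theorem exists_guarantee {β θ q : ℝ} (hβ : G.StrongModulus β) (hb : G.Bounds θ q) :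
    ∃ C, 1 ≤ C ∧ ∀ A, C ≤ A → ∀ ε, 0 < ε → ∀ ρ', G.IsOutput (ε / A) (ε / 4) ρ' → ∀ z, G.IsESE ρ' z →
      G.IsApproxFSE ε ρ' z ∧ G.opt - ε ≤ G.revenue ρ' z G.full := by
  obtain ⟨M, hM1, hM⟩ := G.exists_cost_ge_traffic
  obtain ⟨Ce, hCe0, hCe⟩ := exists_lipschitz_ESE hβ hb
  obtain ⟨ρ₀, hρ₀, z₀, hz₀, hf₀⟩ := exists_isFSE hβ hb
  have hθ := hb.1
  have hq := hb.2.2.1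
  have hμ := G.μ_pos
  have hn := n_pos (G := G)
  obtain ⟨Cg, hCg0, hCg⟩ := exists_gain_stability (G := G) (p := θ / 2) (q := q + 1) (by positivity) (by linarith)
  obtain ⟨Cr, hCr0, hCr⟩ := G.exists_lipschitz_revenue (p := θ / 2) (q := q + 1) (by positivity)
  have hρ₀' : ρ₀ ∈ Icc (0 : ℝ) 1 := ⟨hρ₀.1, hρ₀.2.le⟩
  obtain ⟨r₀, hr₀⟩ : ∃ r₀, r₀ = G.revenue ρ₀ z₀ G.full := ⟨_, rfl⟩
  have hr₀' : 0 < r₀ := by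
    have hα := G.α_pos
    have h0 := hz₀.total_pos hρ₀'
    have h1 : 0 < 1 - ρ₀ := by linarith [hρ₀.2]
    rw [hr₀, revenue_full h0]
    positivity
  -- Up to δ = d the Lipschitz estimates apply and the revenue loss stays below r₀. For δ > d the
  -- size of A gives ε = A δ ≥ μ(M + q), the trivial case.
  obtain ⟨d, hd⟩ : ∃ d, d = min (θ / 2) (min (1 / G.n) (r₀ / (2 * (Cr * (1 + Ce) + 1)))) := ⟨_, rfl⟩
  have hd0 : 0 < d := by rw [hd]; positivity
  have hd1 : d ≤ θ / 2 := by rw [hd]; exact min_le_left _ _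
  have hd2 : d ≤ 1 / G.n := by rw [hd]; exact (min_le_right _ _).trans (min_le_left _ _)
  have hd3 : d ≤ r₀ / (2 * (Cr * (1 + Ce) + 1)) := by rw [hd]; exact (min_le_right _ _).trans (min_le_right _ _)
  rw [le_div_iff₀ (by positivity)] at hd2 hd3
  have p1 : 0 ≤ G.μ * (M + q) / d := by positivity
  have p2 : 0 ≤ 4 * (Cg * (1 + Ce)) := by positivity
  have p3 : 0 ≤ Cr * (2 + Ce) := by positivity
  refine ⟨1 + G.μ * (M + q) / d + 4 * (Cg * (1 + Ce)) + Cr * (2 + Ce), by linarith, fun A hA ε hε ρ' hout z hz => ?_⟩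
  have hA0 : 0 < A := by linarith
  obtain ⟨δ, hδ⟩ : ∃ δ, δ = ε / A := ⟨_, rfl⟩
  have hεδ : ε = A * δ := by rw [hδ]; field_simp
  have hδ0 : 0 < δ := by rw [hδ]; positivity
  rw [← hδ] at hout
  rcases le_or_gt δ d with h | h
  · have a1 : G.n * δ ≤ G.n * d := mul_le_mul_of_nonneg_left h hn.le
    have a2 : Cr * ((1 + Ce) * δ) ≤ Cr * ((1 + Ce) * d) := by gcongr
    have a3 : (4 * (Cg * (1 + Ce))) * δ ≤ A * δ := mul_le_mul_of_nonneg_right (by linarith) hδ0.le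
    have a4 : (Cr * (2 + Ce)) * δ ≤ A * δ := mul_le_mul_of_nonneg_right (by linarith) hδ0.le
    have a5 : 0 ≤ Cr * ((1 + Ce) * d) := by positivity
    exact guarantee_of_small hβ hb hCe0 hCe hCg0 hCg hCr ⟨ρ₀, hρ₀', z₀, hz₀, hf₀, hr₀⟩ hδ0
      (by linarith) (by linarith) (by linarith) (by linarith) (by linarith) hε hout hz
  · refine guarantee_of_large hβ hb hM1 hM ?_ hout.mem hz
    have a1 : G.μ * (M + q) / d ≤ A := by linarith
    rw [div_le_iff₀ hd0] at a1
    have a2 : A * d ≤ A * δ := mul_le_mul_of_nonneg_left h.le hA0.le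
    linarith

end Game


/-! ### Compilation of arithmetic expressions and structured programs -/

/-- Arithmetic expressions. -/
inductive Ex
  | reg (k : ℕ)
  | cell (a j : ℕ)
  | const (q : ℚ)
  | add (a b : Ex)
  | sub (a b : Ex)
  | mul (a b : Ex)
  | div (a b : Ex)
  | traffic (a : Ex)
  | cost (j : ℕ) (a : Ex)
  | marginal (j : ℕ) (a : Ex)

namespace Ex

instance : Add Ex := ⟨Ex.add⟩
instance : Sub Ex := ⟨Ex.sub⟩
instance : Mul Ex := ⟨Ex.mul⟩
instance : Div Ex := ⟨Ex.div⟩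

/-- Value of an expression. -/
def eval (G : Game) (s : Store) : Ex → ℝ
  | .reg k => s.reg k
  | .cell a j => s.arr a (s.idx j)
  | .const q => q
  | .add a b => a.eval G s + b.eval G s
  | .sub a b => a.eval G s - b.eval G s
  | .mul a b => a.eval G s * b.eval G s
  | .div a b => a.eval G s / b.eval G s
  | .traffic a => G.μ * (max (a.eval G s) 0) ^ G.γ
  | .cost j a => G.costAt (s.idx j) (a.eval G s)
  | .marginal j a => G.marginalAt (s.idx j) (a.eval G s)

/-- Number of instructions needed for the evaluation. -/
def size : Ex → ℕ
  | .reg _ | .cell _ _ | .const _ => 1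
  | .add a b | .sub a b | .mul a b | .div a b => a.size + (b.size + 1)
  | .traffic a | .cost _ a | .marginal _ a => a.size + 1

/-- All registers that occur are below `60`; the others are kept for intermediate results. -/
def low : Ex → Bool
  | .reg k => k < 60
  | .cell _ _ | .const _ => true
  | .add a b | .sub a b | .mul a b | .div a b => a.low && b.low
  | .traffic a | .cost _ a | .marginal _ a => a.low

/-- Program that puts the value of the expression into register `d`, using the registers from `d` on. -/
def code : Ex → ℕ → Prog
  | .reg k, d => .instr (.move (.reg d) (.reg k))
  | .cell a j, d => .instr (.move (.reg d) (.cell a j))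
  | .const q, d => .instr (.const (.reg d) q)
  | .add a b, d => .seq (a.code d) (.seq (b.code (d + 1)) (.instr (.add (.reg d) (.reg d) (.reg (d + 1)))))
  | .sub a b, d => .seq (a.code d) (.seq (b.code (d + 1)) (.instr (.sub (.reg d) (.reg d) (.reg (d + 1)))))
  | .mul a b, d => .seq (a.code d) (.seq (b.code (d + 1)) (.instr (.mul (.reg d) (.reg d) (.reg (d + 1)))))
  | .div a b, d => .seq (a.code d) (.seq (b.code (d + 1)) (.instr (.div (.reg d) (.reg d) (.reg (d + 1)))))
  | .traffic a, d => .seq (a.code d) (.instr (.traffic (.reg d) (.reg d)))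
  | .cost j a, d => .seq (a.code d) (.instr (.cost (.reg d) j (.reg d)))
  | .marginal j a, d => .seq (a.code d) (.instr (.marginal (.reg d) j (.reg d)))

end Ex

/-- Equality of memories up to the registers for intermediate results. -/
def Sim (s t : Store) : Prop := (∀ k < 60, s.reg k = t.reg k) ∧ s.arr = t.arr ∧ s.idx = t.idx

lemma Sim.refl (s : Store) : Sim s s := ⟨fun _ _ => rfl, rfl, rfl⟩

variable {G : Game}

lemma Ex.eval_sim {e : Ex} (he : e.low = true) {s t : Store} (h : Sim s t) : e.eval G s = e.eval G t := by
  induction e with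
  | reg k => exact h.1 k (by simpa [Ex.low] using he)
  | cell a j => simp only [Ex.eval, h.2.1, h.2.2]
  | const q => rfl
  | add a b iha ihb | sub a b iha ihb | mul a b iha ihb | div a b iha ihb =>
    rw [Ex.low, Bool.and_eq_true] at he
    simp only [Ex.eval, iha he.1, ihb he.2]
  | traffic a ih | cost j a ih | marginal j a ih =>
    simp only [Ex.eval, ih he, h.2.2]

lemma Ex.code_runs {e : Ex} (he : e.low = true) {s : Store} {d : ℕ} (hd : 60 ≤ d) :
    ∃ t, Runs G (e.code d) s e.size t ∧ t.reg d = e.eval G s ∧ (∀ k < d, t.reg k = s.reg k) ∧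
      t.arr = s.arr ∧ t.idx = s.idx := by
  induction e generalizing s d with
  | reg k | cell a j | const q =>
    refine ⟨_, Runs.instr _ _, ?_, fun k hk => ?_, rfl, rfl⟩
    · simp [Instr.exec, Store.set, Store.get, Ex.eval]
    · simp [Instr.exec, Store.set, hk.ne]
  | add a b iha ihb | sub a b iha ihb | mul a b iha ihb | div a b iha ihb =>
    rw [Ex.low, Bool.and_eq_true] at he
    obtain ⟨t, ht, h1, h2, h3, h4⟩ := iha (s := s) he.1 hd
    obtain ⟨u, hu, h5, h6, h7, h8⟩ := ihb (s := t) (d := d + 1) he.2 (by omega)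
    have hs : Sim t s := ⟨fun k hk => h2 k (by omega), h3, h4⟩
    rw [Ex.eval_sim he.2 hs] at h5
    refine ⟨_, Runs.seq ht (Runs.seq hu (Runs.instr _ _)), ?_, fun k hk => ?_, ?_, ?_⟩
    · simp [Instr.exec, Store.set, Store.get, Ex.eval, h5, h6 d (by omega), h1]
    · simp [Instr.exec, Store.set, hk.ne, h6 k (by omega), h2 k hk]
    · simp [Instr.exec, Store.set, h7, h3]
    · simp [Instr.exec, Store.set, h8, h4]
  | traffic a ih | cost j a ih | marginal j a ih =>
    obtain ⟨t, ht, h1, h2, h3, h4⟩ := ih (s := s) he hd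
    refine ⟨_, Runs.seq ht (Runs.instr _ _), ?_, fun k hk => ?_, ?_, ?_⟩
    · simp [Instr.exec, Store.set, Store.get, Ex.eval, h1, h4]
    · simp [Instr.exec, Store.set, hk.ne, h2 k hk]
    · simp [Instr.exec, Store.set, h3]
    · simp [Instr.exec, Store.set, h4]

/-- Assignment to a register. -/
def Store.put (s : Store) (d : ℕ) (v : ℝ) : Store := s.set (.reg d) v

/-- Assignment to an array cell. -/
def Store.putCell (s : Store) (a j : ℕ) (v : ℝ) : Store := s.set (.cell a j) v

namespace Store

@[simp] lemma put_reg (s : Store) (d k : ℕ) (v : ℝ) :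
    (s.put d v).reg k = if k = d then v else s.reg k := by
  simp [put, set, Function.update_apply]

@[simp] lemma put_arr (s : Store) (d : ℕ) (v : ℝ) : (s.put d v).arr = s.arr := rfl

@[simp] lemma put_idx (s : Store) (d : ℕ) (v : ℝ) : (s.put d v).idx = s.idx := rfl

@[simp] lemma putCell_reg (s : Store) (a j : ℕ) (v : ℝ) : (s.putCell a j v).reg = s.reg := rfl

@[simp] lemma putCell_idx (s : Store) (a j : ℕ) (v : ℝ) : (s.putCell a j v).idx = s.idx := rfl

@[simp] lemma putCell_arr (s : Store) (a j : ℕ) (v : ℝ) :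
    (s.putCell a j v).arr a = Function.update (s.arr a) (s.idx j) v := by
  simp [putCell, set]

@[simp] lemma setIdx_reg (s : Store) (j v : ℕ) : (s.setIdx j v).reg = s.reg := rfl

@[simp] lemma setIdx_arr (s : Store) (j v : ℕ) : (s.setIdx j v).arr = s.arr := rfl

@[simp] lemma setIdx_idx (s : Store) (j k v : ℕ) :
    (s.setIdx j v).idx k = if k = j then v else s.idx k := by
  simp [setIdx, Function.update_apply]

end Store

/-- `Exec G p s k t`: started in `s`, the program `p` reaches `t` after at most `k` steps, where the registers for
intermediate results are ignored. -/
def Exec (G : Game) (p : Prog) (s : Store) (k : ℝ) (t : Store) : Prop :=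
  ∀ s₀, Sim s₀ s → ∃ (k₀ : ℕ) (t₀ : Store), Runs G p s₀ k₀ t₀ ∧ (k₀ : ℝ) ≤ k ∧ Sim t₀ t

lemma Exec.nonneg {p : Prog} {s t : Store} {k : ℝ} (h : Exec G p s k t) : 0 ≤ k := by
  obtain ⟨k₀, -, -, hk, -⟩ := h s (Sim.refl s)
  exact (Nat.cast_nonneg k₀).trans hk

lemma Exec.mono {p : Prog} {s t : Store} {k l : ℝ} (h : Exec G p s k t) (hkl : k ≤ l) : Exec G p s l t :=
  fun s₀ hs => by
    obtain ⟨k₀, t₀, h1, h2, h3⟩ := h s₀ hs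
    exact ⟨k₀, t₀, h1, h2.trans hkl, h3⟩

lemma Exec.skip (s : Store) : Exec G .skip s 0 s := fun s₀ hs => ⟨0, s₀, Runs.skip s₀, by simp, hs⟩

lemma Exec.seq {p q : Prog} {s t u : Store} {k l : ℝ} (h : Exec G p s k t) (h' : Exec G q t l u) :
    Exec G (.seq p q) s (k + l) u := fun s₀ hs => by
  obtain ⟨k₀, t₀, h1, h2, h3⟩ := h s₀ hs
  obtain ⟨l₀, u₀, h4, h5, h6⟩ := h' t₀ h3
  exact ⟨k₀ + l₀, u₀, Runs.seq h1 h4, by push_cast; linarith, h6⟩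

/-- Evaluate an expression and assign the value to a register. -/
def assign (d : ℕ) (e : Ex) : Prog := .seq (e.code 60) (.instr (.move (.reg d) (.reg 60)))

lemma Exec.assign {d : ℕ} {e : Ex} (s : Store) (he : e.low = true) :
    Exec G (assign d e) s (e.size + 1) (s.put d (e.eval G s)) := fun s₀ hs => by
  obtain ⟨t, h1, h2, h3, h4, h5⟩ := e.code_runs (G := G) he (s := s₀) (d := 60) le_rfl
  refine ⟨_, _, Runs.seq h1 (Runs.instr _ _), by push_cast; rfl, fun k hk => ?_, ?_, ?_⟩
  · rw [Ex.eval_sim he hs] at h2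
    simp only [Instr.exec, Store.set, Store.get, Function.update_apply, Store.put_reg, h2]
    split_ifs
    · rfl
    · rw [h3 k hk, hs.1 k hk]
  · simp [Instr.exec, Store.set, h4, hs.2.1]
  · simp [Instr.exec, Store.set, h5, hs.2.2]

/-- Evaluate an expression and assign the value to an array cell. -/
def assignCell (a j : ℕ) (e : Ex) : Prog := .seq (e.code 60) (.instr (.move (.cell a j) (.reg 60)))

lemma Exec.assignCell {a j : ℕ} {e : Ex} (s : Store) (he : e.low = true) :
    Exec G (assignCell a j e) s (e.size + 1) (s.putCell a j (e.eval G s)) := fun s₀ hs => by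
  obtain ⟨t, h1, h2, h3, h4, h5⟩ := e.code_runs (G := G) he (s := s₀) (d := 60) le_rfl
  rw [Ex.eval_sim he hs] at h2
  refine ⟨_, _, Runs.seq h1 (Runs.instr _ _), by push_cast; rfl, fun k hk => ?_, ?_, ?_⟩
  · simp [Instr.exec, Store.set, h3 k hk, hs.1 k hk]
  · simp [Instr.exec, Store.set, Store.get, Store.putCell, h2, h4, h5, hs.2.1, hs.2.2]
  · simp [Instr.exec, Store.set, h5, hs.2.2]

lemma Exec.setIdx {c : Instr} {s : Store} {j : ℕ} {f : (ℕ → ℕ) → ℕ}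
    (h : ∀ s, c.exec G s = s.setIdx j (f s.idx)) : Exec G (.instr c) s 1 (s.setIdx j (f s.idx)) :=
  fun s₀ hs => ⟨1, _, Runs.instr _ _, by simp, by
    rw [h, hs.2.2]
    exact ⟨fun k hk => hs.1 k hk, hs.2.1, by simp only [Store.setIdx, hs.2.2]⟩⟩

lemma Exec.idxConst (j k : ℕ) (s : Store) : Exec G (.instr (.idxConst j k)) s 1 (s.setIdx j k) :=
  Exec.setIdx (f := fun _ => k) fun _ => rfl

lemma Exec.idxMove (j i : ℕ) (s : Store) : Exec G (.instr (.idxMove j i)) s 1 (s.setIdx j (s.idx i)) :=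
  Exec.setIdx (f := fun x => x i) fun _ => rfl

lemma Exec.idxSucc (j : ℕ) (s : Store) : Exec G (.instr (.idxSucc j)) s 1 (s.setIdx j (s.idx j + 1)) :=
  Exec.setIdx (f := fun x => x j + 1) fun _ => rfl

/-- Evaluation of two expressions for a comparison. -/
def evalTwo (e₁ e₂ : Ex) : Prog := .seq (e₁.code 60) (e₂.code 61)

lemma evalTwo_runs {e₁ e₂ : Ex} (h₁ : e₁.low = true) (h₂ : e₂.low = true) {s₀ s : Store} (hs : Sim s₀ s) :
    ∃ t, Runs G (evalTwo e₁ e₂) s₀ (e₁.size + e₂.size) t ∧ t.reg 60 = e₁.eval G s ∧ t.reg 61 = e₂.eval G s ∧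
      Sim t s := by
  obtain ⟨t, ht, a1, a2, a3, a4⟩ := e₁.code_runs (G := G) h₁ (s := s₀) (d := 60) le_rfl
  obtain ⟨u, hu, b1, b2, b3, b4⟩ := e₂.code_runs (G := G) h₂ (s := t) (d := 61) (by norm_num)
  have hts : Sim t s := ⟨fun k hk => (a2 k hk).trans (hs.1 k hk), a3.trans hs.2.1, a4.trans hs.2.2⟩
  refine ⟨u, Runs.seq ht hu, ?_, ?_, fun k hk => ?_, b3.trans hts.2.1, b4.trans hts.2.2⟩
  · rw [b2 60 (by norm_num), a1, Ex.eval_sim h₁ hs]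
  · rw [b1, Ex.eval_sim h₂ hts]
  · rw [b2 k (by omega), hts.1 k hk]

/-- Case distinction by the comparison of two expressions. -/
def ifLt (e₁ e₂ : Ex) (p q : Prog) : Prog := .seq (evalTwo e₁ e₂) (.ite (.lt (.reg 60) (.reg 61)) p q)

lemma Exec.ifLt_pos {e₁ e₂ : Ex} {p q : Prog} {s t : Store} {k : ℝ} (h₁ : e₁.low = true) (h₂ : e₂.low = true)
    (h : e₁.eval G s < e₂.eval G s) (hp : Exec G p s k t) :
    Exec G (ifLt e₁ e₂ p q) s (k + (e₁.size + e₂.size + 1)) t := fun s₀ hs => by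
  obtain ⟨u, hu, a1, a2, a3⟩ := evalTwo_runs (G := G) h₁ h₂ hs
  obtain ⟨k₀, t₀, b1, b2, b3⟩ := hp u a3
  refine ⟨_, t₀, Runs.seq hu (Runs.ite_true ?_ b1), ?_, b3⟩
  · show u.reg 60 < u.reg 61
    rwa [a1, a2]
  · push_cast; linarith

lemma Exec.ifLt_neg {e₁ e₂ : Ex} {p q : Prog} {s t : Store} {k : ℝ} (h₁ : e₁.low = true) (h₂ : e₂.low = true)
    (h : ¬ e₁.eval G s < e₂.eval G s) (hq : Exec G q s k t) :
    Exec G (ifLt e₁ e₂ p q) s (k + (e₁.size + e₂.size + 1)) t := fun s₀ hs => by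
  obtain ⟨u, hu, a1, a2, a3⟩ := evalTwo_runs (G := G) h₁ h₂ hs
  obtain ⟨k₀, t₀, b1, b2, b3⟩ := hq u a3
  refine ⟨_, t₀, Runs.seq hu (Runs.ite_false ?_ b1), ?_, b3⟩
  · show ¬ u.reg 60 < u.reg 61
    rwa [a1, a2]
  · push_cast; linarith

/-- Loop that is controlled by the comparison of two expressions. -/
def whileLt (e₁ e₂ : Ex) (p : Prog) : Prog :=
  .seq (evalTwo e₁ e₂) (.loop (.lt (.reg 60) (.reg 61)) (.seq p (evalTwo e₁ e₂)))

/-- A loop whose body decreases a potential by at least its running time. -/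
lemma Exec.whileLt {e₁ e₂ : Ex} {p : Prog} (h₁ : e₁.low = true) (h₂ : e₂.low = true) (Inv : Store → Prop)
    (Φ : Store → ℝ) (hΦ : ∀ s, Inv s → 0 ≤ Φ s)
    (hstep : ∀ s, Inv s → e₁.eval G s < e₂.eval G s → ∃ t k, Exec G p s k t ∧ Inv t ∧
      k + (e₁.size + e₂.size + 1) + Φ t ≤ Φ s) {s : Store} (hs : Inv s) :
    ∃ t, Exec G (whileLt e₁ e₂ p) s (Φ s + (e₁.size + e₂.size + 1)) t ∧ Inv t ∧
      ¬ e₁.eval G t < e₂.eval G t := by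
  -- The test alone uses at least one unit of potential per round, so a natural bound on the
  -- potential bounds the rounds. The operands of the next test are assumed to be in registers 60
  -- and 61, where `evalTwo` leaves them.
  have key : ∀ n : ℕ, ∀ s, Inv s → Φ s < n → ∃ t, Inv t ∧ ¬ e₁.eval G t < e₂.eval G t ∧
      ∀ s₀, Sim s₀ s → s₀.reg 60 = e₁.eval G s → s₀.reg 61 = e₂.eval G s →
      ∃ (k₀ : ℕ) (t₀ : Store), Runs G (.loop (.lt (.reg 60) (.reg 61)) (.seq p (evalTwo e₁ e₂))) s₀ k₀ t₀ ∧
        (k₀ : ℝ) ≤ Φ s + 1 ∧ Sim t₀ t := by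
    intro n
    induction n with
    | zero =>
      intro s hs h
      have := hΦ s hs
      rw [Nat.cast_zero] at h
      linarith
    | succ n ih =>
      intro s hs hn
      by_cases ht : e₁.eval G s < e₂.eval G s
      · obtain ⟨t, k, hp, hInv, hk⟩ := hstep s hs ht
        have hk0 := hp.nonneg
        push_cast at hn
        have c1 : (0 : ℝ) ≤ e₁.size := Nat.cast_nonneg _
        have c2 : (0 : ℝ) ≤ e₂.size := Nat.cast_nonneg _
        obtain ⟨u, hu, hu', H⟩ := ih t hInv (by linarith)
        refine ⟨u, hu, hu', fun s₀ hs₀ a1 a2 => ?_⟩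
        obtain ⟨k₀, t₀, b1, b2, b3⟩ := hp s₀ hs₀
        obtain ⟨v, d1, d2, d3, d4⟩ := evalTwo_runs (G := G) h₁ h₂ b3
        obtain ⟨l₀, u₀, f1, f2, f3⟩ := H v d4 d2 d3
        refine ⟨_, u₀, Runs.loop_step ?_ (Runs.seq b1 d1) f1, ?_, f3⟩
        · show s₀.reg 60 < s₀.reg 61
          rwa [a1, a2]
        · push_cast; linarith
      · refine ⟨s, hs, ht, fun s₀ hs₀ a1 a2 => ⟨1, s₀, Runs.loop_done ?_, ?_, hs₀⟩⟩
        · show ¬ s₀.reg 60 < s₀.reg 61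
          rwa [a1, a2]
        · have := hΦ s hs
          push_cast; linarith
  obtain ⟨n, hn⟩ := exists_nat_gt (Φ s)
  obtain ⟨t, ht, ht', H⟩ := key n s hs hn
  refine ⟨t, fun s₀ hs₀ => ?_, ht, ht'⟩
  obtain ⟨u, a1, a2, a3, a4⟩ := evalTwo_runs (G := G) h₁ h₂ hs₀
  obtain ⟨k₀, t₀, b1, b2, b3⟩ := H u a4 a2 a3
  exact ⟨_, t₀, Runs.seq a1 b1, by push_cast; linarith, b3⟩

/-- A loop over an index register, with a potential. -/
lemma Exec.whileIdx {i j : ℕ} {p : Prog} (Inv : Store → Prop)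
    (Φ : Store → ℝ) (hΦ : ∀ s, Inv s → 0 ≤ Φ s)
    (hstep : ∀ s, Inv s → s.idx i < s.idx j → ∃ t k, Exec G p s k t ∧ Inv t ∧ k + 1 + Φ t ≤ Φ s)
    {s : Store} (hs : Inv s) :
    ∃ t, Exec G (.loop (.idxLt i j) p) s (Φ s + 1) t ∧ Inv t ∧ ¬ t.idx i < t.idx j := by
  have key : ∀ n : ℕ, ∀ s, Inv s → Φ s < n → ∃ t, Exec G (.loop (.idxLt i j) p) s (Φ s + 1) t ∧ Inv t ∧
      ¬ t.idx i < t.idx j := by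
    intro n
    induction n with
    | zero =>
      intro s hs h
      have := hΦ s hs
      rw [Nat.cast_zero] at h
      linarith
    | succ n ih =>
      intro s hs hn
      by_cases ht : s.idx i < s.idx j
      · obtain ⟨t, k, hp, hInv, hk⟩ := hstep s hs ht
        have hk0 := hp.nonneg
        push_cast at hn
        obtain ⟨u, H, hu, hu'⟩ := ih t hInv (by linarith)
        refine ⟨u, fun s₀ hs₀ => ?_, hu, hu'⟩
        obtain ⟨k₀, t₀, b1, b2, b3⟩ := hp s₀ hs₀
        obtain ⟨l₀, u₀, f1, f2, f3⟩ := H t₀ b3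
        refine ⟨_, u₀, Runs.loop_step ?_ b1 f1, ?_, f3⟩
        · show s₀.idx i < s₀.idx j
          rwa [hs₀.2.2]
        · push_cast; linarith
      · refine ⟨s, fun s₀ hs₀ => ⟨1, s₀, Runs.loop_done ?_, ?_, hs₀⟩, hs, ht⟩
        · show ¬ s₀.idx i < s₀.idx j
          rwa [hs₀.2.2]
        · have := hΦ s hs
          push_cast; linarith
  obtain ⟨n, hn⟩ := exists_nat_gt (Φ s)
  exact key n s hs hn



namespace Ex

variable (G) (s : Store) (a b : Ex)

@[simp] lemma eval_hAdd : (a + b).eval G s = a.eval G s + b.eval G s := rfl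
@[simp] lemma eval_hSub : (a - b).eval G s = a.eval G s - b.eval G s := rfl
@[simp] lemma eval_hMul : (a * b).eval G s = a.eval G s * b.eval G s := rfl
@[simp] lemma eval_hDiv : (a / b).eval G s = a.eval G s / b.eval G s := rfl
@[simp] lemma eval_reg (k : ℕ) : (Ex.reg k).eval G s = s.reg k := rfl
@[simp] lemma eval_cell (a j : ℕ) : (Ex.cell a j).eval G s = s.arr a (s.idx j) := rfl
@[simp] lemma eval_const (q : ℚ) : (Ex.const q).eval G s = q := rfl
@[simp] lemma eval_traffic : (Ex.traffic a).eval G s = G.μ * (max (a.eval G s) 0) ^ G.γ := rfl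
@[simp] lemma eval_cost (j : ℕ) : (Ex.cost j a).eval G s = G.costAt (s.idx j) (a.eval G s) := rfl
@[simp] lemma eval_marginal (j : ℕ) : (Ex.marginal j a).eval G s = G.marginalAt (s.idx j) (a.eval G s) := rfl

end Ex

lemma Game.marginalAt_eq (i : Fin G.n) (v : ℝ) : G.marginalAt i v = G.mc i v := by
  simp [Game.marginalAt, Game.mc]

lemma Game.costAt_eq (i : Fin G.n) {v : ℝ} (hv : 0 ≤ v) : G.costAt i v = G.cost i v := by
  simp [Game.costAt, hv]

/-- The square root of the normalised interval length is the potential for bisection. It is cruder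
than a logarithm, but the product for two nested bisections is still of order 1/τ. -/
lemma sqrt_half_le {v : ℝ} (hv : 1 ≤ v) : √(v / 2) + 1 / 4 ≤ √v := by
  have h1 : 1 ≤ √v := Real.one_le_sqrt.2 hv
  have h2 : √(v / 2) ≤ 3 / 4 * √v := by
    rw [Real.sqrt_le_left (by positivity), mul_pow, Real.sq_sqrt (by linarith)]
    linarith
  linarith

/-! ### The quality of one creator for a given total quality -/

/-- The marginal revenue `κ Φ(X, y)`. -/
def slopeEx (y : Ex) : Ex :=
  .reg 12 * (.traffic (.reg 22) / (.reg 22 * .reg 22)) * (.reg 22 - (.const 1 - .reg 4) * y)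

/-- There is no instruction for general powers: X^(γ-2) comes from the traffic divided by X². The
traffic contains the factor μ, so register 12 holds κ/μ. -/
lemma slopeEx_eval {κ : ℝ} {s : Store} (y : Ex) (h12 : s.reg 12 * G.μ = κ) (h4 : s.reg 4 = G.γ)
    (hX : 0 < s.reg 22) : (slopeEx y).eval G s = κ * G.Phi (s.reg 22) (y.eval G s) := by
  simp only [slopeEx, Ex.eval_hMul, Ex.eval_hDiv, Ex.eval_hSub, Ex.eval_reg, Ex.eval_const, Ex.eval_traffic,
    Game.Phi, max_eq_left hX.le, h4, ← h12, Real.rpow_sub hX, Real.rpow_two]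
  push_cast
  field_simp

/-- Bisection step for the quality of a creator. -/
def bisectOneStep : Prog :=
  .seq (assign 42 ((.reg 40 + .reg 41) / .const 2))
    (ifLt (slopeEx (.reg 42)) (.marginal 1 (.reg 42)) (assign 41 (.reg 42)) (assign 40 (.reg 42)))

/-- Bisection for the quality of the creator whose number is in index register `1`. -/
def bisectOne : Prog :=
  .seq (.seq (assign 40 (.const 0)) (assign 41 (.reg 22)))
    (whileLt (.reg 14) (.reg 41 - .reg 40) bisectOneStep)

lemma bisectOne_spec {κ X τ : ℝ} {i : Fin G.n} {s : Store} (hκ : 0 < κ) (h12 : s.reg 12 * G.μ = κ)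
    (h4 : s.reg 4 = G.γ) (h22 : s.reg 22 = X) (h14 : s.reg 14 = τ) (hX : 0 < X) (hτ : 0 < τ)
    (hi : s.idx 1 = i) :
    ∃ t, Exec G bisectOne s (400 * √(X / τ) + 20) t ∧ G.Bracket κ X τ i (t.reg 40) ∧
      (∀ k < 40, t.reg k = s.reg k) ∧ t.arr = s.arr ∧ t.idx = s.idx := by
  -- The upper end starts at X, where no sign is known; hence the alternative in the last clause.
  let Inv : Store → Prop := fun t => ((∀ k < 40, t.reg k = s.reg k) ∧ t.arr = s.arr ∧ t.idx = s.idx) ∧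
    (0 ≤ t.reg 40 ∧ G.mc i (t.reg 40) ≤ κ * G.Phi X (t.reg 40)) ∧
    0 < t.reg 41 ∧ t.reg 41 ≤ X ∧ (t.reg 41 = X ∨ κ * G.Phi X (t.reg 41) ≤ G.mc i (t.reg 41))
  have hinit : Exec G (.seq (assign 40 (.const 0)) (assign 41 (.reg 22))) s _ _ :=
    (Exec.assign s rfl).seq (Exec.assign _ rfl)
  obtain ⟨t, ht, hInv, htest⟩ := Exec.whileLt (G := G) (e₁ := .reg 14) (e₂ := .reg 41 - .reg 40)
    (p := bisectOneStep) rfl rfl Inv (fun t => 400 * √((t.reg 41 - t.reg 40) / τ)) (fun _ _ => by positivity)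
    (by
      rintro t ⟨⟨f1, f2, f3⟩, ⟨a1, a2⟩, b1, b2, b3⟩ htest
      simp only [Ex.eval_reg, Ex.eval_hSub, f1 14 (by norm_num), h14] at htest
      have hv : 1 ≤ (t.reg 41 - t.reg 40) / τ := by
        rw [le_div_iff₀ hτ]; linarith
      have hsq := sqrt_half_le hv
      set m := (t.reg 40 + t.reg 41) / 2 with hm
      have e1 : (m - t.reg 40) / τ = (t.reg 41 - t.reg 40) / τ / 2 := by rw [hm]; ring
      have e2 : (t.reg 41 - m) / τ = (t.reg 41 - t.reg 40) / τ / 2 := by rw [hm]; ring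
      have hu : Exec G (assign 42 ((.reg 40 + .reg 41) / .const 2)) t 6 (t.put 42 m) := by
        refine (Exec.assign (G := G) t rfl).mono ?_
        norm_num [Ex.size, show ((.reg 40 + .reg 41) / .const 2 : Ex).size = 5 from rfl]
      have hs1 : (slopeEx (.reg 42)).eval G (t.put 42 m) = κ * G.Phi X m := by
        rw [slopeEx_eval (κ := κ)]
        · simp [f1 22 (by norm_num), h22]
        · simpa [f1 12 (by norm_num)] using h12
        · simpa [f1 4 (by norm_num)] using h4
        · simpa [f1 22 (by norm_num), h22] using hX
      have hs2 : (Ex.marginal 1 (.reg 42)).eval G (t.put 42 m) = G.mc i m := by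
        simp [f3, hi, Game.marginalAt_eq]
      have hsz : (slopeEx (.reg 42)).size = 16 := rfl
      have hsz2 : (Ex.marginal 1 (.reg 42)).size = 2 := rfl
      have hsz3 : (Ex.reg 14).size = 1 := rfl
      have hsz4 : (Ex.reg 41 - Ex.reg 40 : Ex).size = 3 := rfl
      have hsz5 : (Ex.reg 42).size = 1 := rfl
      by_cases hc : κ * G.Phi X m < G.mc i m
      · refine ⟨_, _, hu.seq (Exec.ifLt_pos rfl rfl (by rwa [hs1, hs2]) (Exec.assign _ rfl)),
          ⟨⟨fun k hk => ?_, f2, f3⟩, ⟨?_, ?_⟩, ?_, ?_, ?_⟩, ?_⟩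
        · rw [← f1 k hk]
          simp [show k ≠ 41 by omega, show k ≠ 42 by omega]
        · simpa using a1
        · simpa using a2
        · simp only [Store.put_reg, Ex.eval_reg, if_true]; linarith
        · simp only [Store.put_reg, Ex.eval_reg, if_true]; linarith
        · simp only [Store.put_reg, Ex.eval_reg, if_true]; exact Or.inr hc.le
        · simp only [Store.put_reg, Ex.eval_reg, if_true, hsz, hsz2, hsz3, hsz4, hsz5]
          norm_num
          rw [e1]
          linarith
      · refine ⟨_, _, hu.seq (Exec.ifLt_neg rfl rfl (by rwa [hs1, hs2]) (Exec.assign _ rfl)),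
          ⟨⟨fun k hk => ?_, f2, f3⟩, ⟨?_, ?_⟩, ?_, ?_, ?_⟩, ?_⟩
        · rw [← f1 k hk]
          simp [show k ≠ 40 by omega, show k ≠ 42 by omega]
        · simp only [Store.put_reg, Ex.eval_reg, if_true]; linarith
        · simp only [Store.put_reg, Ex.eval_reg, if_true]; exact not_lt.1 hc
        · simpa using b1
        · simpa using b2
        · simpa using b3
        · simp only [Store.put_reg, Ex.eval_reg, if_true, hsz, hsz2, hsz3, hsz4, hsz5]
          norm_num
          rw [e2]
          linarith)
    (s := (s.put 40 0).put 41 X) ⟨⟨fun k hk => by simp [show k ≠ 41 by omega, show k ≠ 40 by omega], rfl, rfl⟩,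
      ⟨by simp, by
        simp only [Store.put_reg]
        norm_num
        rw [Game.Phi_eq hX, zero_div, mul_zero, sub_zero, mul_one]
        positivity⟩, by simpa using hX, by simp, by simp⟩
  obtain ⟨⟨f1, f2, f3⟩, ⟨a1, a2⟩, b1, b2, b3⟩ := hInv
  simp only [Ex.eval_reg, Ex.eval_hSub, f1 14 (by norm_num), h14, not_lt] at htest
  have hinit' : Exec G (.seq (assign 40 (.const 0)) (assign 41 (.reg 22))) s 4 ((s.put 40 0).put 41 X) := by
    have : ((s.put 40 ((Ex.const 0).eval G s)).put 41 ((Ex.reg 22).eval G (s.put 40 ((Ex.const 0).eval G s))))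
        = (s.put 40 0).put 41 X := by simp [h22]
    rw [← this]
    refine hinit.mono ?_
    norm_num [Ex.size]
  refine ⟨t, (hinit'.seq ht).mono ?_, ⟨a1, a2, t.reg 41, b1, by linarith, b2, b3⟩, f1, f2, f3⟩
  have hsz4 : (Ex.reg 41 - Ex.reg 40 : Ex).size = 3 := rfl
  simp [hsz4, Ex.size]
  linarith

/-! ### The qualities of all creators for a given total quality -/

/-- Loop body: the quality of one creator is stored and added. -/
def sumStep : Prog :=
  .seq bisectOne (.seq (assignCell 0 1 (.reg 40)) (.seq (assign 30 (.reg 30 + .cell 0 1)) (.instr (.idxSucc 1))))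

/-- The qualities of all creators for the total quality in register `22`, and their sum. -/
def sumAll : Prog :=
  .seq (.seq (.instr (.idxConst 1 0)) (assign 30 (.const 0))) (.loop (.idxLt 1 0) sumStep)

lemma sumAll_spec {κ X τ : ℝ} {s : Store} (hκ : 0 < κ) (h12 : s.reg 12 * G.μ = κ)
    (h4 : s.reg 4 = G.γ) (h22 : s.reg 22 = X) (h14 : s.reg 14 = τ) (hX : 0 < X) (hτ : 0 < τ)
    (h0 : s.idx 0 = G.n) :
    ∃ t, Exec G sumAll s (G.n * (400 * √(X / τ) + 30) + 4) t ∧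
      (∀ i : Fin G.n, G.Bracket κ X τ i (t.arr 0 i)) ∧
      t.reg 30 = G.total (fun i : Fin G.n => t.arr 0 i) ∧ (∀ k < 30, t.reg k = s.reg k) ∧ t.idx 0 = G.n := by
  let Inv : Store → Prop := fun t => (∀ k < 30, t.reg k = s.reg k) ∧ t.idx 0 = G.n ∧ t.idx 1 ≤ G.n ∧
    (∀ i : Fin G.n, (i : ℕ) < t.idx 1 → G.Bracket κ X τ i (t.arr 0 i)) ∧
    t.reg 30 = ∑ j ∈ Finset.range (t.idx 1), t.arr 0 j
  have hT : 0 ≤ 400 * √(X / τ) + 30 := by positivity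
  obtain ⟨t, ht, ⟨f1, f2, f3, f4, f5⟩, htest⟩ := Exec.whileIdx (G := G) (i := 1) (j := 0) (p := sumStep) Inv
    (fun t => (G.n - t.idx 1) * (400 * √(X / τ) + 30))
    (fun t ht => mul_nonneg (sub_nonneg.2 (by exact_mod_cast ht.2.2.1)) hT) (by
      rintro t ⟨f1, f2, f3, f4, f5⟩ htest
      rw [f2] at htest
      obtain ⟨u, hu, hb, g1, g2, g3⟩ := bisectOne_spec (G := G) (i := ⟨t.idx 1, htest⟩) (s := t) hκ
        (by rw [f1 12 (by norm_num)]; exact h12) (by rw [f1 4 (by norm_num)]; exact h4)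
        (by rw [f1 22 (by norm_num)]; exact h22) (by rw [f1 14 (by norm_num)]; exact h14) hX hτ rfl
      refine ⟨_, _, hu.seq ((Exec.assignCell _ rfl).seq ((Exec.assign _ rfl).seq (Exec.idxSucc 1 _))),
        ⟨fun k hk => ?_, ?_, ?_, ?_, ?_⟩, ?_⟩
      · simp [show k ≠ 30 by omega, g1 k (by omega), f1 k hk]
      · simp [g3, f2]
      · simp [g3]; omega
      · intro i hi
        simp only [Store.setIdx_idx, Store.put_idx, Store.putCell_idx, g3, if_true] at hi
        simp only [Store.setIdx_arr, Store.put_arr, Store.putCell_arr, g2, g3, Ex.eval_reg]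
        rcases Nat.lt_succ_iff_lt_or_eq.1 hi with hi | hi
        · rw [Function.update_of_ne hi.ne]
          exact f4 i hi
        · have : i = ⟨t.idx 1, htest⟩ := Fin.ext hi
          subst this
          simpa using hb
      · simp only [Store.setIdx_reg, Store.put_reg, Store.setIdx_idx, Store.put_idx, Store.putCell_idx, g3, if_true,
          Store.setIdx_arr, Store.put_arr, Store.putCell_arr, Ex.eval_hAdd, Ex.eval_reg, Ex.eval_cell,
          Store.putCell_reg, g1 30 (by norm_num), g2, f5, Function.update_self, Finset.sum_range_succ]
        congr 1
        refine Finset.sum_congr rfl fun j hj => ?_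
        rw [Function.update_of_ne (Finset.mem_range.1 hj).ne]
      · simp only [Ex.size, Store.setIdx_idx, Store.put_idx, Store.putCell_idx, g3, if_true]
        push_cast
        linarith)
    (s := (s.setIdx 1 0).put 30 0) ⟨fun k hk => by simp [show k ≠ 30 by omega], by simp [h0], by simp, by simp, by simp⟩
  have hinit : Exec G (.seq (.instr (.idxConst 1 0)) (assign 30 (.const 0))) s 3 ((s.setIdx 1 0).put 30 0) := by
    have := (Exec.idxConst (G := G) 1 0 s).seq (Exec.assign (d := 30) (e := .const 0) _ rfl)
    simp only [Ex.eval_const, Rat.cast_zero] at this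
    refine this.mono ?_
    norm_num [Ex.size]
  rw [f2, not_lt] at htest
  have h1 : t.idx 1 = G.n := le_antisymm f3 htest
  refine ⟨t, (hinit.seq ht).mono ?_, fun i => f4 i (by rw [h1]; exact i.2), ?_, f1, f2⟩
  · simp
    linarith
  · rw [f5, h1, Finset.sum_range]
    rfl

/-! ### Bisection for the total quality -/

/-- Bisection step for the total quality. -/
def bisectTotalStep : Prog :=
  .seq (assign 22 ((.reg 20 + .reg 21) / .const 2))
    (.seq sumAll (ifLt (.reg 30) (.reg 22) (assign 21 (.reg 22)) (assign 20 (.reg 22))))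

/-- Bisection for the total quality in the equilibrium. -/
def bisectTotal : Prog :=
  .seq (.seq (assign 20 (.const 1 / .reg 5)) (assign 21 (.reg 5)))
    (.seq (whileLt (.reg 14) (.reg 21 - .reg 20) bisectTotalStep)
      (.seq (assign 22 (.reg 20 + .reg 5 * .reg 14)) sumAll))

lemma bisectTotal_spec {κ A τ : ℝ} {s : Store} (hκ : 0 < κ) (h12 : s.reg 12 * G.μ = κ)
    (h4 : s.reg 4 = G.γ) (h5 : s.reg 5 = A) (h14 : s.reg 14 = τ) (hA : 1 ≤ A) (hτ : 0 < τ) (hτ1 : τ ≤ 1)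
    (h0 : s.idx 0 = G.n) :
    ∃ t lo hi, Exec G bisectTotal s (10000 * G.n * (A / τ)) t ∧
      1 / A ≤ lo ∧ hi - lo ≤ τ ∧
      (lo = 1 / A ∨ ∃ l' : Fin G.n → ℝ, (∀ i, G.Bracket κ lo τ i (l' i)) ∧ lo ≤ G.total l') ∧
      (hi = A ∨ 1 / A ≤ hi ∧ ∃ l' : Fin G.n → ℝ, (∀ i, G.Bracket κ hi τ i (l' i)) ∧ G.total l' ≤ hi) ∧
      (∀ i : Fin G.n, G.Bracket κ (lo + A * τ) τ i (t.arr 0 i)) ∧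
      t.reg 30 = G.total (fun i : Fin G.n => t.arr 0 i) ∧ (∀ k < 20, t.reg k = s.reg k) ∧ t.idx 0 = G.n := by
  have hA0 : 0 < A := by linarith
  have hinv0 : 0 < 1 / A := by positivity
  have hinvA : 1 / A ≤ A := (div_le_one hA0).2 hA |>.trans hA
  let Inv : Store → Prop := fun t => ((∀ k < 20, t.reg k = s.reg k) ∧ t.idx 0 = G.n) ∧
    (1 / A ≤ t.reg 20 ∧ t.reg 20 ≤ A ∧
      (t.reg 20 = 1 / A ∨ ∃ l' : Fin G.n → ℝ, (∀ i, G.Bracket κ (t.reg 20) τ i (l' i)) ∧ t.reg 20 ≤ G.total l')) ∧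
    (1 / A ≤ t.reg 21 ∧ t.reg 21 ≤ A ∧
      (t.reg 21 = A ∨ ∃ l' : Fin G.n → ℝ, (∀ i, G.Bracket κ (t.reg 21) τ i (l' i)) ∧ G.total l' ≤ t.reg 21))
  -- All totals passed to `sumAll` are at most 2A, so y bounds the square root in each inner
  -- bisection as well as that of the outer one. The cost is of order n y² = 2 n A/τ.
  obtain ⟨y, hy⟩ : ∃ y, y = √(2 * A / τ) := ⟨_, rfl⟩
  have hy2 : y ^ 2 = 2 * A / τ := by rw [hy, Real.sq_sqrt (by positivity)]
  have hy1 : 1 ≤ y := by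
    rw [hy, Real.one_le_sqrt, le_div_iff₀ hτ]
    linarith
  have hn1 : (1 : ℝ) ≤ G.n := Game.one_le_n
  obtain ⟨T, hT⟩ : ∃ T, T = 4 * ((G.n : ℝ) * (400 * y + 30) + 30) := ⟨_, rfl⟩
  have hT0 : 0 ≤ T := by rw [hT]; positivity
  have hsum : ∀ X, 0 < X → X ≤ 2 * A → G.n * (400 * √(X / τ) + 30) ≤ (G.n : ℝ) * (400 * y + 30) := by
    intro X hX hXA
    rw [hy]
    gcongr
  obtain ⟨t, ht, ⟨⟨f1, f2⟩, ⟨a1, a2, a3⟩, b1, b2, b3⟩, htest⟩ := Exec.whileLt (G := G) (e₁ := .reg 14)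
    (e₂ := .reg 21 - .reg 20) (p := bisectTotalStep) rfl rfl Inv
    (fun t => T * √((t.reg 21 - t.reg 20) / τ)) (fun _ _ => by positivity) (by
      rintro t ⟨⟨f1, f2⟩, ⟨a1, a2, a3⟩, b1, b2, b3⟩ htest
      simp only [Ex.eval_reg, Ex.eval_hSub, f1 14 (by norm_num), h14] at htest
      have hv : 1 ≤ (t.reg 21 - t.reg 20) / τ := by
        rw [le_div_iff₀ hτ]; linarith
      have hsq := mul_le_mul_of_nonneg_left (sqrt_half_le hv) hT0
      set m := (t.reg 20 + t.reg 21) / 2 with hm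
      have e1 : (m - t.reg 20) / τ = (t.reg 21 - t.reg 20) / τ / 2 := by rw [hm]; ring
      have e2 : (t.reg 21 - m) / τ = (t.reg 21 - t.reg 20) / τ / 2 := by rw [hm]; ring
      have hm0 : 1 / A ≤ m := by linarith
      have hmA : m ≤ A := by linarith
      have hu : Exec G (assign 22 ((.reg 20 + .reg 21) / .const 2)) t 6 (t.put 22 m) := by
        refine (Exec.assign (G := G) t rfl).mono ?_
        norm_num [Ex.size, show ((.reg 20 + .reg 21) / .const 2 : Ex).size = 5 from rfl]
      obtain ⟨v, hv, c1, c2, c3, c4⟩ := sumAll_spec (G := G) (s := t.put 22 m) (X := m) hκ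
        (by simpa [f1 12 (by norm_num)] using h12) (by simpa [f1 4 (by norm_num)] using h4) (by simp)
        (by simpa [f1 14 (by norm_num)] using h14) (by linarith) hτ (by simpa using f2)
      have hfr : ∀ k < 20, v.reg k = s.reg k := fun k hk => by
        rw [c3 k (by omega), ← f1 k hk]; simp [show k ≠ 22 by omega]
      have h22 : v.reg 22 = m := by rw [c3 22 (by norm_num)]; simp
      have h20 : v.reg 20 = t.reg 20 := by rw [c3 20 (by norm_num)]; simp
      have h21 : v.reg 21 = t.reg 21 := by rw [c3 21 (by norm_num)]; simp
      have hcost := hsum m (by linarith) (by linarith)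
      have hsz3 : (Ex.reg 14).size = 1 := rfl
      have hsz4 : (Ex.reg 21 - Ex.reg 20 : Ex).size = 3 := rfl
      have hsz5 : (Ex.reg 22).size = 1 := rfl
      have hsz6 : (Ex.reg 30).size = 1 := rfl
      by_cases hc : v.reg 30 < v.reg 22
      · refine ⟨_, _, hu.seq (hv.seq (Exec.ifLt_pos rfl rfl hc (Exec.assign _ rfl))),
          ⟨⟨fun k hk => ?_, ?_⟩, ⟨?_, ?_, ?_⟩, ?_, ?_, ?_⟩, ?_⟩
        · simp [show k ≠ 21 by omega, hfr k hk]
        · simpa using c4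
        · simpa [h20] using a1
        · simpa [h20] using a2
        · simpa [h20] using a3
        · simpa [h22] using hm0
        · simpa [h22] using hmA
        · refine Or.inr ⟨fun i => v.arr 0 i, fun i => ?_, ?_⟩
          · simpa [h22] using c1 i
          · simpa [c2] using hc.le
        · simp only [Store.put_reg, Ex.eval_reg, if_true, h20, h22, hsz3, hsz4, hsz5, hsz6]
          norm_num [h20]
          rw [e1]
          linarith
      · refine ⟨_, _, hu.seq (hv.seq (Exec.ifLt_neg rfl rfl hc (Exec.assign _ rfl))),
          ⟨⟨fun k hk => ?_, ?_⟩, ⟨?_, ?_, ?_⟩, ?_, ?_, ?_⟩, ?_⟩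
        · simp [show k ≠ 20 by omega, hfr k hk]
        · simpa using c4
        · simpa [h22] using hm0
        · simpa [h22] using hmA
        · refine Or.inr ⟨fun i => v.arr 0 i, fun i => ?_, ?_⟩
          · simpa [h22] using c1 i
          · simpa [c2] using not_lt.1 hc
        · simpa [h21] using b1
        · simpa [h21] using b2
        · simpa [h21] using b3
        · simp only [Store.put_reg, Ex.eval_reg, if_true, h21, h22, hsz3, hsz4, hsz5, hsz6]
          norm_num [h21]
          rw [e2]
          linarith)
    (s := (s.put 20 (1 / A)).put 21 A) ⟨⟨fun k hk => by simp [show k ≠ 20 by omega, show k ≠ 21 by omega], by simpa using h0⟩,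
      ⟨by simp, by simpa using hinvA, by simp⟩, by simpa using hinvA, by simp, by simp⟩
  have hinit : Exec G (.seq (assign 20 (.const 1 / .reg 5)) (assign 21 (.reg 5))) s 6 ((s.put 20 (1 / A)).put 21 A) := by
    have := (Exec.assign (G := G) (d := 20) (e := .const 1 / .reg 5) s rfl).seq
      (Exec.assign (d := 21) (e := .reg 5) _ rfl)
    simp only [Ex.eval_hDiv, Ex.eval_const, Ex.eval_reg, Rat.cast_one, Store.put_reg, h5] at this
    norm_num at this ⊢
    refine this.mono ?_
    rw [show (Ex.const 1 / Ex.reg 5 : Ex).size = 3 from rfl]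
    norm_num [Ex.size, h5]
  simp only [Ex.eval_reg, Ex.eval_hSub, f1 14 (by norm_num), h14, not_lt] at htest
  have hlast : Exec G (assign 22 (.reg 20 + .reg 5 * .reg 14)) t 6 (t.put 22 (t.reg 20 + A * τ)) := by
    have := Exec.assign (G := G) (d := 22) (e := .reg 20 + .reg 5 * .reg 14) t rfl
    simp only [Ex.eval_hAdd, Ex.eval_hMul, Ex.eval_reg, f1 5 (by norm_num), h5, f1 14 (by norm_num), h14] at this
    refine this.mono ?_
    rw [show (Ex.reg 20 + Ex.reg 5 * Ex.reg 14 : Ex).size = 5 from rfl]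
    norm_num
  have hX0 : 0 < t.reg 20 + A * τ := by
    have : 0 < A * τ := by positivity
    linarith
  have hXA : t.reg 20 + A * τ ≤ 2 * A := by nlinarith
  obtain ⟨v, hv, c1, c2, c3, c4⟩ := sumAll_spec (G := G) (s := t.put 22 (t.reg 20 + A * τ)) (X := t.reg 20 + A * τ) hκ
    (by simpa [f1 12 (by norm_num)] using h12) (by simpa [f1 4 (by norm_num)] using h4) (by simp)
    (by simpa [f1 14 (by norm_num)] using h14) hX0 hτ (by simpa using f2)
  refine ⟨v, t.reg 20, t.reg 21, (hinit.seq (ht.seq (hlast.seq hv))).mono ?_, a1, htest, a3, ?_, c1, c2,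
    fun k hk => ?_, c4⟩
  · have h1 := hsum _ hX0 hXA
    have h2 : √((A - 1 / A) / τ) ≤ y := by
      rw [hy]
      gcongr
      linarith
    have h3 := mul_le_mul_of_nonneg_left h2 hT0
    rw [show (Ex.reg 21 - Ex.reg 20 : Ex).size = 3 from rfl, show (Ex.reg 14).size = 1 from rfl]
    simp only [Store.put_reg]
    norm_num
    rw [one_div] at h3
    have h4 : T * y + T ≤ 2 * T * y := by nlinarith
    have h5 : T ≤ 1840 * G.n * y := by
      rw [hT]
      nlinarith
    have h6 : 2 * T * y ≤ 3680 * G.n * y ^ 2 := by nlinarith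
    have h7 : 10000 * G.n * (A / τ) = 5000 * G.n * y ^ 2 := by rw [hy2]; ring
    have h8 : 30 ≤ 30 * (G.n * y ^ 2) := by
      have : 1 ≤ y ^ 2 := one_le_pow₀ hy1
      nlinarith
    rw [h7]
    linarith
  · rcases b3 with h | h
    · exact Or.inl h
    · exact Or.inr ⟨b1, h⟩
  · rw [c3 k (by omega), ← f1 k hk]; simp [show k ≠ 22 by omega]



/-! ### The search for deviations without sharing -/

/-- Every quality below `c` is so close to a quality whose value for a deviation without sharing is at most `b` that
the value at the former can be estimated. -/
def Game.Covered (G : Game) (a h tol : ℝ) (i : Fin G.n) (c b : ℝ) : Prop :=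
  ∀ x ∈ Ico 0 c, ∃ y, 0 ≤ y ∧ y ≤ x ∧ x - y ≤ h ∧ (x - y) * (G.mc i x - G.mc i y) ≤ tol ∧
    G.dev 0 a y 0 - G.cost i y ≤ b

/-- Utility for the deviation without sharing to the quality in register `33`. -/
def devEx : Ex :=
  .traffic (.reg 26 + .reg 33) * (.reg 33 / ((.const 1 + .reg 3) * .reg 26 + .reg 33)) - .cost 1 (.reg 33)

lemma devEx_eval {s : Store} {a : ℝ} {i : Fin G.n} (h3 : s.reg 3 = G.α) (h26 : s.reg 26 = a) (hi : s.idx 1 = i)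
    (ha : 0 < a) (hx : 0 ≤ s.reg 33) :
    devEx.eval G s = G.dev 0 a (s.reg 33) 0 - G.cost i (s.reg 33) := by
  simp only [devEx, Ex.eval_hAdd, Ex.eval_hSub, Ex.eval_hMul, Ex.eval_hDiv, Ex.eval_reg, Ex.eval_const,
    Ex.eval_traffic, Ex.eval_cost, h3, h26, hi, Game.costAt_eq i hx, Game.dev_zero,
    max_eq_left (add_nonneg ha.le hx)]
  push_cast
  ring

/-- Width of the steps in the current interval. -/
def widthEx : Ex :=
  .reg 15 * .reg 16 / (.reg 16 + .reg 15 * (.marginal 1 (.reg 30 + .reg 15) - .marginal 1 (.reg 30)))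

/-- Evaluation of one deviation. -/
def scanPoint : Prog :=
  .seq (ifLt (.reg 32) devEx (assign 32 devEx) .skip) (assign 33 (.reg 33 + .reg 31))

/-- Search in the interval between the values of register `30` and register `30` plus register `15`. -/
def scanInterval : Prog :=
  .seq (.seq (assign 31 widthEx) (assign 33 (.reg 30)))
    (.seq (whileLt (.reg 33) (.reg 30 + .reg 15) scanPoint) (assign 30 (.reg 30 + .reg 15)))

/-- Search for the best deviation without sharing of the creator whose number is in index register `1`. -/
def scan : Prog :=
  .seq (.seq (assign 30 (.const 0)) (assign 32 (.const 0))) (whileLt (.reg 30) (.reg 5) scanInterval)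

/-- The state of the search in which the qualities below `c` have been covered. -/
def ScanState (G : Game) (s : Store) (a h tol : ℝ) (i : Fin G.n) (c : ℝ) (t : Store) : Prop :=
  ((∀ k < 30, t.reg k = s.reg k) ∧ t.arr = s.arr ∧ t.idx = s.idx) ∧
    0 ≤ t.reg 32 ∧ (∃ y, 0 ≤ y ∧ t.reg 32 = G.dev 0 a y 0 - G.cost i y) ∧ G.Covered a h tol i c (t.reg 32)

lemma ScanState.congr {s t u : Store} {a h tol c : ℝ} {i : Fin G.n} (H : ScanState G s a h tol i c t)
    (h₁ : ∀ k < 30, u.reg k = t.reg k) (h₂ : u.arr = t.arr) (h₃ : u.idx = t.idx) (h₄ : u.reg 32 = t.reg 32) :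
    ScanState G s a h tol i c u := by
  obtain ⟨⟨f1, f2, f3⟩, H⟩ := H
  refine ⟨⟨fun k hk => (h₁ k hk).trans (f1 k hk), h₂.trans f2, h₃.trans f3⟩, ?_⟩
  rwa [h₄]

/-- The new points in [x, c') are served by x itself: they lie within w of it, and the marginal cost
rises by at most D on the way. -/
lemma Game.Covered.extend {a h tol c c' b b' w x D : ℝ} {i : Fin G.n} (H : G.Covered a h tol i c b) (hb : b ≤ b')
    (hx : 0 ≤ x) (hV : G.dev 0 a x 0 - G.cost i x ≤ b') (hxc : x ≤ c) (hw : w ≤ h) (hc' : c' ≤ x + w)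
    (hD : ∀ y ∈ Ico x c', G.mc i y - G.mc i x ≤ D) (hwD : w * D ≤ tol) (hD0 : 0 ≤ D) :
    G.Covered a h tol i c' b' := by
  intro y hy
  by_cases hyx : y < x
  · obtain ⟨z, h1, h2, h3, h4, h5⟩ := H y ⟨hy.1, hyx.trans_le hxc⟩
    exact ⟨z, h1, h2, h3, h4, h5.trans hb⟩
  · rw [not_lt] at hyx
    have hyc := hy.2
    refine ⟨x, hx, hyx, by linarith, ?_, hV⟩
    calc (y - x) * (G.mc i y - G.mc i x) ≤ (y - x) * D :=
          mul_le_mul_of_nonneg_left (hD y ⟨hyx, hyc⟩) (by linarith)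
      _ ≤ w * D := mul_le_mul_of_nonneg_right (by linarith) hD0
      _ ≤ tol := hwD

lemma scanPoint_spec {s t : Store} {a h tol c c' D : ℝ} {i : Fin G.n} (ha : 0 < a)
    (h3 : s.reg 3 = G.α) (h26 : s.reg 26 = a) (hi : s.idx 1 = i)
    (H : ScanState G s a h tol i c t) (hx : 0 ≤ t.reg 33) (hxc : t.reg 33 ≤ c) (hw : t.reg 31 ≤ h)
    (hc' : c' ≤ t.reg 33 + t.reg 31)
    (hD : ∀ y ∈ Ico (t.reg 33) c', G.mc i y - G.mc i (t.reg 33) ≤ D) (hwD : t.reg 31 * D ≤ tol) (hD0 : 0 ≤ D) :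
    ∃ u, Exec G scanPoint t 45 u ∧ ScanState G s a h tol i c' u ∧ u.reg 33 = t.reg 33 + t.reg 31 ∧
      u.reg 30 = t.reg 30 ∧ u.reg 31 = t.reg 31 := by
  obtain ⟨⟨f1, f2, f3⟩, hb, hy, hc⟩ := H
  have hV := devEx_eval (G := G) (s := t) (a := a) (i := i) (by rw [f1 3 (by norm_num), h3])
    (by rw [f1 26 (by norm_num), h26]) (by rw [f3, hi]) ha hx
  have hsz : devEx.size = 17 := rfl
  have hsz1 : (Ex.reg 32).size = 1 := rfl
  have hsz2 : (Ex.reg 33 + Ex.reg 31 : Ex).size = 3 := rfl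
  by_cases hlt : t.reg 32 < devEx.eval G t
  · refine ⟨_, ((Exec.ifLt_pos (e₁ := .reg 32) (e₂ := devEx) rfl rfl hlt (Exec.assign _ rfl)).seq (Exec.assign _ rfl)).mono ?_,
      ⟨⟨fun k hk => ?_, f2, f3⟩, ?_, ⟨t.reg 33, hx, ?_⟩, ?_⟩, ?_, ?_, ?_⟩
    · rw [hsz, hsz1, hsz2]; norm_num
    · simp [show k ≠ 33 by omega, show k ≠ 32 by omega, f1 k hk]
    · simpa using hb.trans hlt.le
    · simpa using hV
    · have := hc.extend (b' := devEx.eval G t) hlt.le hx hV.ge hxc hw hc' hD hwD hD0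
      simpa using this
    · simp
    · simp
    · simp
  · refine ⟨_, ((Exec.ifLt_neg (e₁ := .reg 32) (e₂ := devEx) rfl rfl hlt (Exec.skip _)).seq (Exec.assign _ rfl)).mono ?_,
      ⟨⟨fun k hk => ?_, f2, f3⟩, ?_, ?_, ?_⟩, ?_, ?_, ?_⟩
    · rw [hsz, hsz1, hsz2]; norm_num
    · simp [show k ≠ 33 by omega, f1 k hk]
    · simpa using hb
    · simpa using hy
    · have := hc.extend (b' := t.reg 32) le_rfl hx (hV ▸ not_lt.1 hlt) hxc hw hc' hD hwD hD0
      simpa using this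
    · simp
    · simp
    · simp

/-- The width w = h tol/(tol + h D), with D the rise of the marginal cost on the interval, satisfies
w ≤ h and w D ≤ tol, while h/w = 1 + (h/tol) D. So the cost is a constant plus a multiple of D. -/
lemma scanInterval_spec {s t : Store} {a h tol : ℝ} {i : Fin G.n} (ha : 0 < a) (hh : 0 < h) (htol : 0 < tol)
    (h3 : s.reg 3 = G.α) (h15 : s.reg 15 = h) (h16 : s.reg 16 = tol) (h26 : s.reg 26 = a) (hi : s.idx 1 = i)
    (H : ScanState G s a h tol i (t.reg 30) t) (hp : 0 ≤ t.reg 30) :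
    ∃ u, Exec G scanInterval t (127 + 50 * (h / tol) * (G.mc i (t.reg 30 + h) - G.mc i (t.reg 30))) u ∧
      ScanState G s a h tol i (u.reg 30) u ∧ u.reg 30 = t.reg 30 + h := by
  obtain ⟨p, hpe⟩ : ∃ p, p = t.reg 30 := ⟨_, rfl⟩
  obtain ⟨D, hDe⟩ : ∃ D, D = G.mc i (p + h) - G.mc i p := ⟨_, rfl⟩
  rw [← hpe] at hp H ⊢
  have hD0 : 0 ≤ D := by
    rw [hDe, sub_nonneg]; exact Game.mc_mono G i (by linarith)
  obtain ⟨w, hwe⟩ : ∃ w, w = h * tol / (tol + h * D) := ⟨_, rfl⟩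
  have hden : 0 < tol + h * D := by positivity
  have hw0 : 0 < w := by rw [hwe]; positivity
  have hwh : w ≤ h := by
    rw [hwe, div_le_iff₀ hden]
    nlinarith [mul_nonneg hh.le (mul_nonneg hh.le hD0)]
  have hwD : w * D ≤ tol := by
    rw [hwe, div_mul_eq_mul_div, div_le_iff₀ hden]
    nlinarith [mul_pos htol htol]
  have hhw : h / w = 1 + h / tol * D := by
    rw [hwe]; field_simp
  obtain ⟨⟨f1, f2, f3⟩, -⟩ := id H
  have hinit : Exec G (.seq (assign 31 widthEx) (assign 33 (.reg 30))) t 18 ((t.put 31 w).put 33 p) := by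
    have := (Exec.assign (G := G) (d := 31) (e := widthEx) t rfl).seq (Exec.assign (d := 33) (e := .reg 30) _ rfl)
    have e1 : widthEx.eval G t = w := by
      simp only [widthEx, Ex.eval_hAdd, Ex.eval_hSub, Ex.eval_hMul, Ex.eval_hDiv, Ex.eval_reg, Ex.eval_marginal,
        f1 15 (by norm_num), f1 16 (by norm_num), f3, hi, h15, h16, Game.marginalAt_eq, ← hpe, hwe, hDe]
    simp only [e1, Ex.eval_reg, Store.put_reg, ← hpe] at this
    norm_num at this
    refine this.mono ?_
    rw [show widthEx.size = 15 from rfl]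
    norm_num [Ex.size]
  obtain ⟨u, hu, ⟨H1, c1, c2, c3, c4⟩, htest⟩ := Exec.whileLt (G := G) (e₁ := .reg 33) (e₂ := .reg 30 + .reg 15)
    (p := scanPoint) rfl rfl
    -- The last step may pass p + h, beyond which D no longer bounds the rise of the marginal cost;
    -- coverage is claimed only up to p + h.
    (fun u => ScanState G s a h tol i (min (u.reg 33) (p + h)) u ∧ u.reg 30 = p ∧ u.reg 31 = w ∧ p ≤ u.reg 33 ∧
      u.reg 33 ≤ p + h + w)
    (fun u => 50 * ((p + h + w - u.reg 33) / w))
    (fun u hu => by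
      have := hu.2.2.2.2
      have : 0 ≤ (p + h + w - u.reg 33) / w := div_nonneg (by linarith) hw0.le
      positivity)
    (by
      rintro u ⟨H1, c1, c2, c3, c4⟩ htest
      simp only [Ex.eval_reg, Ex.eval_hAdd, c1, H1.1.1 15 (by norm_num), h15] at htest
      rw [min_eq_left htest.le] at H1
      obtain ⟨v, hv, H2, d1, d2, d3⟩ := scanPoint_spec (c' := min (u.reg 33 + w) (p + h)) (D := D) ha h3 h26 hi H1
        (by linarith) le_rfl (by rw [c2]; exact hwh) (by rw [c2]; exact min_le_left _ _) (fun y hy => by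
          have := hy.2.trans_le (min_le_right _ _)
          have e1 : G.mc i y ≤ G.mc i (p + h) := Game.mc_mono G i this.le
          have e2 : G.mc i p ≤ G.mc i (u.reg 33) := Game.mc_mono G i c3
          rw [hDe]; linarith) (by rw [c2]; exact hwD) hD0
      rw [c2] at d1
      refine ⟨v, _, hv, ⟨by rw [d1]; exact H2, d2.trans c1, d3.trans c2, by linarith, by linarith⟩, ?_⟩
      have e1 : (p + h + w - v.reg 33) / w = (p + h + w - u.reg 33) / w - 1 := by
        rw [d1]; field_simp; ring
      rw [e1, show (Ex.reg 33).size = 1 from rfl, show (Ex.reg 30 + Ex.reg 15 : Ex).size = 3 from rfl]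
      push_cast
      linarith)
    (s := (t.put 31 w).put 33 p) ⟨by
      simp only [Store.put_reg, if_true, min_eq_left (show p ≤ p + h by linarith)]
      exact H.congr (fun k hk => by simp [show k ≠ 33 by omega, show k ≠ 31 by omega]) rfl rfl (by simp),
      by simp [hpe], by simp, by simp, by simp; linarith⟩
  simp only [Ex.eval_reg, Ex.eval_hAdd, c1, H1.1.1 15 (by norm_num), h15, not_lt] at htest
  have hlast := Exec.assign (G := G) (d := 30) (e := .reg 30 + .reg 15) u rfl
  simp only [Ex.eval_reg, Ex.eval_hAdd, c1, H1.1.1 15 (by norm_num), h15] at hlast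
  refine ⟨_, (hinit.seq (hu.seq hlast)).mono ?_, ?_, ?_⟩
  · rw [show (Ex.reg 33).size = 1 from rfl, show (Ex.reg 30 + Ex.reg 15 : Ex).size = 3 from rfl]
    simp only [Store.put_reg, if_true]
    have e1 : (p + h + w - p) / w = h / w + 1 := by field_simp; ring
    rw [e1, hhw, ← hDe]
    push_cast
    linarith
  · rw [min_eq_right htest] at H1
    simp only [Store.put_reg, if_true]
    exact H1.congr (fun k hk => by simp [show k ≠ 30 by omega]) rfl rfl (by simp)
  · simp

/-- The rises of the marginal cost over the intervals telescope to at most c'(A + h). The search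
starts from the value 0 of quality 0, which keeps the best value nonnegative. -/
lemma scan_spec {s : Store} {a h tol A : ℝ} {i : Fin G.n} (ha : 0 < a) (hh : 0 < h) (htol : 0 < tol) (hA : 0 ≤ A)
    (h3 : s.reg 3 = G.α) (h5 : s.reg 5 = A) (h15 : s.reg 15 = h) (h16 : s.reg 16 = tol) (h26 : s.reg 26 = a)
    (hi : s.idx 1 = i) :
    ∃ t, Exec G scan s (130 * ((A + h) / h) + 50 * (h / tol) * G.mc i (A + h) + 7) t ∧
      ScanState G s a h tol i A t := by
  have hc : 0 ≤ h / tol := by positivity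
  obtain ⟨t, ht, ⟨H1, c1, c2⟩, htest⟩ := Exec.whileLt (G := G) (e₁ := .reg 30) (e₂ := .reg 5)
    (p := scanInterval) rfl rfl
    (fun t => ScanState G s a h tol i (t.reg 30) t ∧ 0 ≤ t.reg 30 ∧ t.reg 30 ≤ A + h)
    (fun t => 130 * ((A + h - t.reg 30) / h) + 50 * (h / tol) * (G.mc i (A + h) - G.mc i (t.reg 30)))
    (fun t ht => by
      have e1 : 0 ≤ (A + h - t.reg 30) / h := div_nonneg (by linarith [ht.2.2]) hh.le
      have e2 : 0 ≤ G.mc i (A + h) - G.mc i (t.reg 30) := sub_nonneg.2 (Game.mc_mono G i ht.2.2)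
      positivity)
    (by
      rintro t ⟨H1, c1, c2⟩ htest
      simp only [Ex.eval_reg, H1.1.1 5 (by norm_num), h5] at htest
      obtain ⟨u, hu, H2, d1⟩ := scanInterval_spec ha hh htol h3 h15 h16 h26 hi H1 c1
      refine ⟨u, _, hu, ⟨H2, by linarith, by linarith⟩, ?_⟩
      have e1 : (A + h - u.reg 30) / h = (A + h - t.reg 30) / h - 1 := by
        rw [d1]; field_simp; ring
      rw [e1, d1, show (Ex.reg 30).size = 1 from rfl, show (Ex.reg 5).size = 1 from rfl]
      push_cast
      linarith)
    (s := (s.put 30 0).put 32 0) ⟨⟨⟨fun k hk => by simp [show k ≠ 32 by omega, show k ≠ 30 by omega], rfl, rfl⟩, by simp,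
      ⟨0, le_rfl, by simp [Game.dev_zero, G.cost_zero]⟩, fun x hx => by
        exact absurd (hx.1.trans_lt hx.2) (by simp)⟩, by simp, by simp; linarith⟩
  simp only [Ex.eval_reg, H1.1.1 5 (by norm_num), h5, not_lt] at htest
  have hinit : Exec G (.seq (assign 30 (.const 0)) (assign 32 (.const 0))) s 4 ((s.put 30 0).put 32 0) := by
    have := (Exec.assign (G := G) (d := 30) (e := .const 0) s rfl).seq (Exec.assign (d := 32) (e := .const 0) _ rfl)
    simp only [Ex.eval_const, Rat.cast_zero] at this
    refine this.mono ?_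
    norm_num [Ex.size]
  refine ⟨t, (hinit.seq ht).mono ?_, H1.1, H1.2.1, H1.2.2.1, fun x hx => H1.2.2.2 x ⟨hx.1, hx.2.trans_le htest⟩⟩
  rw [show (Ex.reg 30).size = 1 from rfl, show (Ex.reg 5).size = 1 from rfl]
  simp [Game.mc_zero]
  linarith



/-! ### The test whether a profile is an approximate equilibrium -/

/-- Utility of the creator whose number is in index register `1` for the stored profile. -/
def utilityEx : Ex := .reg 12 * .traffic (.reg 24) / .reg 24 * .cell 0 1 - .cost 1 (.cell 0 1)

/-- Utility under full sharing with coefficient `κ`, when the total quality is `X`. -/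
def Game.fullUtility (G : Game) (κ X : ℝ) (i : Fin G.n) (x : ℝ) : ℝ := κ * (x * X ^ (G.γ - 1)) - G.cost i x

lemma utilityEx_eval {κ X x : ℝ} {s : Store} {i : Fin G.n} (h12 : s.reg 12 * G.μ = κ) (h24 : s.reg 24 = X) (hX : 0 < X)
    (hi : s.idx 1 = i) (hx : s.arr 0 i = x) (hx0 : 0 ≤ x) : utilityEx.eval G s = G.fullUtility κ X i x := by
  simp only [utilityEx, Ex.eval_hSub, Ex.eval_hMul, Ex.eval_hDiv, Ex.eval_reg, Ex.eval_cell, Ex.eval_traffic,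
    Ex.eval_cost, h24, hi, hx, Game.costAt_eq i hx0, max_eq_left hX.le, Game.fullUtility, ← h12,
    Real.rpow_sub_one hX.ne']
  ring

/-- Test for one creator. If it fails, the stored quality of this creator is decreased by the value of register `6`. -/
def checkStep : Prog :=
  .seq (assign 26 (.reg 24 - .cell 0 1)) (.seq scan
    (ifLt (utilityEx + .reg 1) (.reg 32 + .reg 17)
      (.seq (assignCell 0 1 (.cell 0 1 - .reg 6)) (.seq (assign 13 (.const 1)) (.instr (.idxMove 1 0))))
      (.instr (.idxSucc 1))))

/-- Test for all creators. -/
def check : Prog :=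
  .seq (.seq (assign 13 (.const 0)) (.seq (assign 24 (.reg 30)) (.instr (.idxConst 1 0)))) (.loop (.idxLt 1 0) checkStep)

/-- The test has been passed by creator `i`. -/
def Game.Accepts (G : Game) (κ A h tol tol' η : ℝ) (l : Fin G.n → ℝ) (i : Fin G.n) : Prop :=
  ∃ b, 0 ≤ b ∧ G.Covered (G.total l - l i) h tol i A b ∧ b + tol' ≤ G.fullUtility κ (G.total l) i (l i) + η

/-- Creator `i` fails in the test. -/
def Game.Rejects (G : Game) (κ tol' η : ℝ) (l : Fin G.n → ℝ) (i : Fin G.n) : Prop :=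
  ∃ y, 0 ≤ y ∧ G.fullUtility κ (G.total l) i (l i) + η < G.dev 0 (G.total l - l i) y 0 - G.cost i y + tol'

/-- The first rejection moves the loop index to n, so the loop ends and at most one quality is
lowered. -/
lemma check_spec {s : Store} {κ A h tol tol' r η T : ℝ} {l : Fin G.n → ℝ} (hh : 0 < h) (htol : 0 < tol) (hA : 0 ≤ A)
    (h12 : s.reg 12 * G.μ = κ) (h3 : s.reg 3 = G.α) (h5 : s.reg 5 = A) (h15 : s.reg 15 = h) (h16 : s.reg 16 = tol)
    (h17 : s.reg 17 = tol') (h6 : s.reg 6 = r) (h1 : s.reg 1 = η) (hl : ∀ i : Fin G.n, s.arr 0 i = l i)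
    (h30 : s.reg 30 = G.total l) (h0 : s.idx 0 = G.n) (hl0 : ∀ i, 0 ≤ l i) (hl1 : ∀ i, 0 < G.total l - l i)
    (hT0 : 0 ≤ T) (hT : ∀ i, 130 * ((A + h) / h) + 50 * (h / tol) * G.mc i (A + h) ≤ T) :
    ∃ t, Exec G check s (G.n * (T + 50) + 10) t ∧ (∀ k < 20, k ≠ 13 → t.reg k = s.reg k) ∧ t.idx 0 = G.n ∧
      ((t.reg 13 = 0 ∧ t.reg 24 = G.total l ∧ (∀ i : Fin G.n, t.arr 0 i = l i) ∧ ∀ i, G.Accepts κ A h tol tol' η l i) ∨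
        (t.reg 13 = 1 ∧ ∃ i, G.Rejects κ tol' η l i ∧
          ∀ j : Fin G.n, t.arr 0 j = Function.update l i (l i - r) j)) := by
  have hX : 0 < G.total l := by
    have i : Fin G.n := ⟨0, by have := G.two_le_n; omega⟩
    linarith [hl0 i, hl1 i]
  obtain ⟨t, ht, ⟨f1, f2, f3⟩, htest⟩ := Exec.whileIdx (G := G) (i := 1) (j := 0) (p := checkStep)
    (fun t => (∀ k < 20, k ≠ 13 → t.reg k = s.reg k) ∧ t.idx 0 = G.n ∧
      ((t.reg 13 = 0 ∧ t.reg 24 = G.total l ∧ t.idx 1 ≤ G.n ∧ (∀ i : Fin G.n, t.arr 0 i = l i) ∧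
          ∀ i : Fin G.n, (i : ℕ) < t.idx 1 → G.Accepts κ A h tol tol' η l i) ∨
        (t.reg 13 = 1 ∧ t.idx 1 = G.n ∧ ∃ i, G.Rejects κ tol' η l i ∧
          ∀ j : Fin G.n, t.arr 0 j = Function.update l i (l i - r) j)))
    (fun t => (G.n - t.idx 1) * (T + 50))
    (fun t ht => mul_nonneg (sub_nonneg.2 (by
      rcases ht.2.2 with h | h
      · exact_mod_cast h.2.2.1
      · exact_mod_cast h.2.1.le)) (by linarith)) (by
      rintro t ⟨f1, f2, ⟨g1, g2, g3, g4, g5⟩ | ⟨-, g2, -⟩⟩ htest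
      swap
      · omega
      rw [f2] at htest
      obtain ⟨i, hi⟩ : ∃ i : Fin G.n, t.idx 1 = i := ⟨⟨_, htest⟩, rfl⟩
      have hu := Exec.assign (G := G) (d := 26) (e := .reg 24 - .cell 0 1) t rfl
      simp only [Ex.eval_hSub, Ex.eval_reg, Ex.eval_cell, g2, hi, g4] at hu
      obtain ⟨v, hv, ⟨c1, c2, c3⟩, hb, ⟨y, hy, hby⟩, hcov⟩ := scan_spec (s := t.put 26 (G.total l - l i)) (i := i)
        (A := A) (h := h) (tol := tol) (hl1 i) hh htol hA (by simp [f1 3, h3]) (by simp [f1 5, h5])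
        (by simp [f1 15, h15]) (by simp [f1 16, h16]) (by simp) (by simp [hi])
      have hr : ∀ k < 26, v.reg k = t.reg k := fun k hk => by
        rw [c1 k (by omega)]; simp [hk.ne]
      have hidx : v.idx = t.idx := by rw [c3]; rfl
      have harr : v.arr = t.arr := by rw [c2]; rfl
      have hU : (utilityEx + .reg 1).eval G v = G.fullUtility κ (G.total l) i (l i) + η := by
        rw [Ex.eval_hAdd, utilityEx_eval (κ := κ) (X := G.total l) (x := l i) (i := i)
          (by rw [hr 12 (by norm_num), f1 12 (by norm_num) (by norm_num), h12])
          (by rw [hr 24 (by norm_num), g2]) hX (by rw [hidx, hi]) (by rw [harr, g4]) (hl0 i),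
          Ex.eval_reg, hr 1 (by norm_num), f1 1 (by norm_num) (by norm_num), h1]
      have hV : (.reg 32 + .reg 17 : Ex).eval G v = v.reg 32 + tol' := by
        rw [Ex.eval_hAdd, Ex.eval_reg, Ex.eval_reg, hr 17 (by norm_num), f1 17 (by norm_num) (by norm_num), h17]
      have hsz1 : (utilityEx + .reg 1).size = 13 := rfl
      have hsz2 : (.reg 32 + .reg 17 : Ex).size = 3 := rfl
      have hsz3 : (.reg 24 - .cell 0 1 : Ex).size = 3 := rfl
      have hsz4 : (.cell 0 1 - .reg 6 : Ex).size = 3 := rfl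
      have hTi := hT i
      by_cases hlt : G.fullUtility κ (G.total l) i (l i) + η < v.reg 32 + tol'
      · refine ⟨_, _, hu.seq (hv.seq (Exec.ifLt_pos rfl rfl (by rwa [hU, hV]) ((Exec.assignCell _ rfl).seq
          ((Exec.assign _ rfl).seq (Exec.idxMove 1 0 _))))), ⟨fun k hk hk' => ?_, ?_, Or.inr ⟨?_, ?_, i, ?_, ?_⟩⟩, ?_⟩
        · simp [hk', hr k (by omega), f1 k hk hk']
        · simp [hidx, f2]
        · simp
        · simp [hidx, f2]
        · exact ⟨y, hy, by rwa [← hby]⟩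
        · intro j
          simp only [Store.setIdx_arr, Store.put_arr, Store.putCell_arr, hidx, hi, harr, Ex.eval_hSub, Ex.eval_cell,
            Ex.eval_reg, g4, hr 6 (by norm_num), f1 6 (by norm_num) (by norm_num), h6]
          by_cases hj : j = i
          · subst hj; simp
          · rw [Function.update_of_ne hj, Function.update_of_ne (fun h => hj (Fin.ext h)), g4]
        · simp only [Store.setIdx_idx, if_true, Store.put_idx, Store.putCell_idx, hidx, f2, hsz1, hsz2, hsz3, hsz4]
          have h2 : (t.idx 1 : ℝ) + 1 ≤ G.n := by exact_mod_cast htest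
          norm_num [Ex.size]
          nlinarith
      · refine ⟨_, _, hu.seq (hv.seq (Exec.ifLt_neg rfl rfl (by rwa [hU, hV]) (Exec.idxSucc 1 _))),
          ⟨fun k hk hk' => ?_, ?_, Or.inl ⟨?_, ?_, ?_, ?_, ?_⟩⟩, ?_⟩
        · simp [hr k (by omega), f1 k hk hk']
        · simp [hidx, f2]
        · simp [hr 13, g1]
        · simp [hr 24, g2]
        · simp [hidx]; omega
        · intro j
          simp [harr, g4]
        · intro j hj
          simp only [Store.setIdx_idx, if_true, hidx] at hj
          rcases Nat.lt_succ_iff_lt_or_eq.1 hj with hj | hj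
          · exact g5 j hj
          · have : j = i := Fin.ext (hj.trans hi)
            subst this
            exact ⟨_, hb, hcov, not_lt.1 hlt⟩
        · simp only [Store.setIdx_idx, if_true, hidx, hsz1, hsz2, hsz3]
          push_cast
          linarith)
    (s := ((s.put 13 0).put 24 (G.total l)).setIdx 1 0) ⟨fun k hk hk' => by simp [hk', show k ≠ 24 by omega],
      by simp [h0], Or.inl ⟨by simp, by simp, by simp, by simp [hl], by simp⟩⟩
  have hinit : Exec G (.seq (assign 13 (.const 0)) (.seq (assign 24 (.reg 30)) (.instr (.idxConst 1 0)))) s 5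
      (((s.put 13 0).put 24 (G.total l)).setIdx 1 0) := by
    have := (Exec.assign (G := G) (d := 13) (e := .const 0) s rfl).seq
      ((Exec.assign (d := 24) (e := .reg 30) _ rfl).seq (Exec.idxConst 1 0 _))
    simp only [Ex.eval_const, Rat.cast_zero, Ex.eval_reg, Store.put_reg, h30] at this
    norm_num at this
    refine this.mono ?_
    norm_num [Ex.size]
  refine ⟨t, (hinit.seq ht).mono ?_, f1, f2, ?_⟩
  · simp
    linarith
  · rcases f3 with ⟨g1, g2, g3, g4, g5⟩ | ⟨g1, -, i, g2, g3⟩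
    · have h2 : t.idx 1 = G.n := by omega
      exact Or.inl ⟨g1, g2, g4, fun i => g5 i (by rw [h2]; exact i.2)⟩
    · exact Or.inr ⟨g1, i, g2, g3⟩


/-! ### Soundness of acceptance and of rejection -/

namespace Game


lemma nearESE_of_abs_sub_le {δ ρ e : ℝ} {x z : Fin G.n → ℝ} (hz : G.IsESE ρ z) (hx : ∀ i, 0 ≤ x i)
    (h : ∀ i, |x i - z i| ≤ e) (he : G.n * e ≤ δ) : G.NearESE δ ρ x := by
  refine ⟨hx, z, hz, ?_⟩
  have he0 : 0 ≤ e := (abs_nonneg _).trans (h ⟨0, by have := G.two_le_n; omega⟩)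
  have hn := one_le_n (G := G)
  rw [EuclideanSpace.dist_eq, Real.sqrt_le_left ((by positivity : (0 : ℝ) ≤ G.n * e).trans he)]
  calc ∑ i, dist (x i) (z i) ^ 2 ≤ ∑ _i : Fin G.n, e ^ 2 := by
        refine Finset.sum_le_sum fun i _ => ?_
        rw [Real.dist_eq]
        exact pow_le_pow_left₀ (abs_nonneg _) (h i) 2
    _ = G.n * e ^ 2 := by simp
    _ ≤ G.n ^ 2 * e ^ 2 := by gcongr; nlinarith
    _ = (G.n * e) ^ 2 := by ring
    _ ≤ δ ^ 2 := pow_le_pow_left₀ (by positivity) he 2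

variable (G) in
/-- A profile that is found by bisection is close to the equilibrium, and the test decides correctly whether the
profile, or a perturbation of it, is an approximate equilibrium. -/
def DecidesApproxFSE (A : ℝ) : Prop :=
  ∀ ρ ∈ Icc (0 : ℝ) 1, ∀ z, G.IsESE ρ z → ∀ r η lo hi, ∀ l : Fin G.n → ℝ, 0 < r →
    r * A ≤ 1 → A ^ 2 * r ≤ 4 * η → 1 / A ≤ lo → hi - lo ≤ r / A ^ 2 →
    (lo = 1 / A ∨ ∃ l', (∀ i, G.Bracket (G.kap ρ) lo (r / A ^ 2) i (l' i)) ∧ lo ≤ G.total l') →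
    (hi = A ∨ 1 / A ≤ hi ∧ ∃ l', (∀ i, G.Bracket (G.kap ρ) hi (r / A ^ 2) i (l' i)) ∧ G.total l' ≤ hi) →
    (∀ i, G.Bracket (G.kap ρ) (lo + A * (r / A ^ 2)) (r / A ^ 2) i (l i)) →
    (∀ i, r ≤ l i) ∧ (∀ i, 0 < G.total l - l i) ∧ (∀ i, |l i - z i| ≤ r) ∧
    ((∀ i, G.Accepts (G.kap ρ) A (r / A) (r ^ 2 / A ^ 2) (r ^ 2 / A) η l i) → G.IsApproxFSE η ρ l) ∧
    ∀ i, G.Rejects (G.kap ρ) (r ^ 2 / A) η l i → ¬ G.IsApproxFSE η ρ (Function.update l i (l i - r))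

lemma exists_decidesApproxFSE {β θ q : ℝ} (hβ : G.StrongModulus β) (hb : G.Bounds θ q) :
    ∃ C, 1 ≤ C ∧ ∀ A, C ≤ A → G.DecidesApproxFSE A := by
  obtain ⟨M, hM1, hM⟩ := G.exists_cost_ge_traffic
  obtain ⟨C, hC1, HC⟩ := exists_approx_ESE hβ hb
  have hb' := hb
  obtain ⟨hθ, hθ1, hq, H⟩ := hb
  have hβ0 := hβ.1
  obtain ⟨L, hL0, HL⟩ := G.exists_scan_bound (p := θ / 2) (q := q + 1) (by positivity) hM1 hM
  obtain ⟨Cg, hCg0, HCg⟩ := exists_gain_stability (G := G) (p := θ / 2) (q := q + 1) (by positivity) (by linarith)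
  have hn := one_le_n (G := G)
  -- The summands ensure in turn: l is within r/2 of z; the scan reaches M; its error (L+1) r²/A² is
  -- below the margin r²/A; Cg r ≤ η; r ≤ θ/2; n r ≤ 1; and the drop β r²/8 covers margin and
  -- residual, (C+1) r²/A.
  refine ⟨2 * C + M + (L + 1) + 4 * Cg + 2 / θ + G.n + 8 * (C + 1) / β + 1, ?_, ?_⟩
  · have : 0 ≤ 2 / θ := by positivity
    have : 0 ≤ 8 * (C + 1) / β := by positivity
    linarith
  intro A hA ρ hρ z hz r η lo hi l hr hrA hη h1 h2 h3 h4 h5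
  have t1 : 0 < 2 / θ := by positivity
  have t2 : 0 < 8 * (C + 1) / β := by positivity
  have hA0 : 0 < A := by linarith
  have hA1 : 1 ≤ A := by linarith
  have hrA' : r ≤ 1 / A := by rwa [le_div_iff₀ hA0]
  have hr1 : r ≤ θ / 2 := by
    refine hrA'.trans ?_
    rw [div_le_iff₀ hA0]
    have : 2 / θ ≤ A := by linarith
    rw [div_le_iff₀ hθ] at this
    linarith
  have hrn : G.n * r ≤ 1 := by
    calc G.n * r ≤ A * r := by gcongr; linarith
      _ ≤ 1 := by linarith
  have hl := HC A (by linarith) ρ hρ z hz (r / A ^ 2) lo hi l (by positivity) (by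
    have : r / A ^ 2 * A ^ 3 = r * A := by field_simp
    rwa [this]) h1 h2 h3 h4 h5
  have hA2 : A * (r / A ^ 2) = r / A := by field_simp
  rw [hA2] at hl
  have hCr : C * (r / A) ≤ r / 2 := by
    rw [← mul_div_assoc, div_le_iff₀ hA0]
    nlinarith
  obtain ⟨hz1, hz2⟩ := H ρ hρ z hz
  have hlz : ∀ i, |l i - z i| ≤ r / 2 := fun i => (hl i).1.trans hCr
  have hl1 : ∀ i, θ / 2 ≤ l i := fun i => by
    have := (abs_le.1 (hlz i)).1
    linarith [hz1 i]
  have hl0 : ∀ i, 0 ≤ l i := fun i => le_trans (by positivity) (hl1 i)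
  have hltot : G.total l ≤ q + 1 := by
    have : G.total l ≤ ∑ i, (z i + r) :=
      Finset.sum_le_sum fun i _ => by have := (abs_le.1 (hlz i)).2; linarith
    rw [Finset.sum_add_distrib, Finset.sum_const, Finset.card_univ, Fintype.card_fin, nsmul_eq_mul] at this
    change _ ≤ G.total z + _ at this
    linarith
  have hla : ∀ i, θ / 2 ≤ G.total l - l i := fun i => by
    obtain ⟨j, hj⟩ := exists_ne_index i
    exact (hl1 j).trans (add_le_total hl0 hj)
  have hla0 : ∀ i, 0 < G.total l - l i := fun i => lt_of_lt_of_le (by positivity) (hla i)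
  have hX : 0 < G.total l := by
    obtain ⟨i⟩ : Nonempty (Fin G.n) := ⟨⟨0, by have := G.two_le_n; omega⟩⟩
    linarith [hl0 i, hla0 i]
  have hU : ∀ i, G.fullUtility (G.kap ρ) (G.total l) i (l i) =
      G.dev ρ (G.total l - l i) (l i) 1 - G.cost i (l i) := fun i => by
    rw [dev_one (by linarith [hla0 i, hl0 i]), sub_add_cancel]
    rfl
  refine ⟨fun i => hr1.trans (hl1 i), hla0, fun i => (hlz i).trans (by linarith), fun hacc => ?_, fun i hrej => ?_⟩
  · rw [isApproxFSE_iff hl0 hla0]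
    intro i y hy s hs
    obtain ⟨b, hb0, hcov, hbη⟩ := hacc i
    rw [hU] at hbη
    have e0 : G.dev ρ (G.total l - l i) y 0 - G.cost i y ≤
        G.dev ρ (G.total l - l i) (l i) 1 - G.cost i (l i) + η := by
      have e1 := HL i (G.total l - l i) ⟨hla i, by linarith [hl0 i]⟩ b (r / A) (r ^ 2 / A ^ 2) hb0 (by positivity)
        (by positivity) (fun x hx => hcov x ⟨hx.1, hx.2.trans_le (by linarith)⟩) y hy
      have e2 : L * (r / A) ^ 2 + r ^ 2 / A ^ 2 ≤ r ^ 2 / A := by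
        have : L * (r / A) ^ 2 + r ^ 2 / A ^ 2 = (L + 1) * (r ^ 2 / A ^ 2) := by field_simp
        rw [this]
        calc (L + 1) * (r ^ 2 / A ^ 2) ≤ A * (r ^ 2 / A ^ 2) := by gcongr; linarith
          _ = r ^ 2 / A := by field_simp
      have e3 : G.dev ρ (G.total l - l i) y 0 = G.dev 0 (G.total l - l i) y 0 := by rw [dev_zero, dev_zero]
      rw [e3]
      linarith
    -- Deviations with full sharing are not scanned: none pays at z, and l is within r of z.
    have e1 : G.dev ρ (G.total l - l i) y 1 - G.cost i y ≤
        G.dev ρ (G.total l - l i) (l i) 1 - G.cost i (l i) + η := by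
      have e2 := HCg ρ hρ ρ hρ z l r (by simpa using hr.le) (fun i => by linarith [hz1 i]) hl1 (by linarith) hltot
        (fun i => by rw [abs_sub_comm]; linarith [hlz i]) i 1 ⟨zero_le_one, le_rfl⟩ 0 le_rfl
        (fun u hu => by rw [add_zero]; exact hz.dev_one_le hρ i hu) y hy
      have e3 : Cg * r ≤ η := by
        have : 4 * (Cg * r) ≤ A ^ 2 * r := by
          rw [← mul_assoc]
          gcongr
          nlinarith
        linarith
      linarith
    have := dev_le_of_endpoints (ρ := ρ) (B := G.dev ρ (G.total l - l i) (l i) 1 - G.cost i (l i) + η + G.cost i y)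
      hs (hla0 i) hy (by linarith) (by linarith)
    linarith
  · obtain ⟨y, hy, hyV⟩ := hrej
    have hri : r ≤ l i := hr1.trans (hl1 i)
    have e1 := utility_drop (E := C * (r / A)) (i := i) hβ (kap_pos hρ).le (kap_le hρ) (hz.foc hρ) (hla0 i) hr hri
      (by linarith [(abs_le.1 (hlz i)).2]) (by rw [sub_add_cancel]; exact (hl i).2)
    rw [sub_add_cancel] at e1
    change _ ≤ G.fullUtility (G.kap ρ) (G.total l) i (l i) + _ - _ at e1
    have e2 : C * (r / A) * r + r ^ 2 / A ≤ β * r ^ 2 / 8 := by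
      have h8 : 8 * (C + 1) / β ≤ A := by linarith
      rw [div_le_iff₀ hβ0] at h8
      have : C * (r / A) * r + r ^ 2 / A = (C + 1) * r ^ 2 / A := by field_simp
      rw [this, div_le_iff₀ hA0]
      nlinarith [sq_nonneg r]
    intro hF
    have e3 := hF.2 i y hy 0 ⟨le_rfl, zero_le_one⟩
    have hri0 : 0 ≤ l i - r := by linarith
    -- A deviation of creator i overwrites her lowered quality, so its payoff is the one computed
    -- for l.
    rw [Function.update_idem, utility_update hy zero_le_one (by linarith [hla0 i]),
      utility_update_full hri0 (by linarith [hla0 i]), dev_one (by linarith [hla0 i])] at e3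
    have e4 : G.dev ρ (G.total l - l i) y 0 = G.dev 0 (G.total l - l i) y 0 := by rw [dev_zero, dev_zero]
    rw [e4] at e3
    linarith

end Game



/-! ### The program -/

/-- Update of the current best parameter and revenue. -/
def record : Prog :=
  .seq (assign 18 (.traffic (.reg 24) * (.reg 3 / (.const 1 + .reg 3)) * (.const 1 - .reg 11)))
    (ifLt (.reg 9) (.reg 18) (.seq (assign 9 (.reg 18)) (assign 10 (.reg 11))) .skip)

/-- One iteration of the algorithm. -/
def examine : Prog :=
  .seq (.seq (assign 8 (.reg 8 + .const 1)) (.seq (assign 11 (.reg 8 / .reg 7))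
      (assign 12 ((.const 1 + .reg 3 * .reg 11) / (.const 1 + .reg 3)))))
    (.seq bisectTotal (.seq check (ifLt (.reg 13) (.const 1) record .skip)))

/-- Computation of the accuracies. -/
def setup : Prog :=
  .seq (assign 5 (.const 4 * .reg 1 / .reg 0)) (.seq (assign 6 (.reg 0 / (.reg 5 * (.const 1 + .reg 0))))
    (.seq (assign 14 (.reg 6 / (.reg 5 * .reg 5))) (.seq (assign 15 (.reg 6 / .reg 5))
      (.seq (assign 16 (.reg 6 * .reg 6 / (.reg 5 * .reg 5))) (assign 17 (.reg 6 * .reg 6 / .reg 5))))))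

/-- Computation of the number of iterations. -/
def countIterations : Prog :=
  .seq (assign 7 (.const 0)) (whileLt (.reg 7) (.const 1 / .reg 0) (assign 7 (.reg 7 + .const 1)))

/-- The program for the algorithm. -/
def program : Prog :=
  .seq setup (.seq countIterations
    (.seq (.seq (assign 8 (.const 0)) (.seq (assign 9 (.const 0)) (assign 10 (.const 0))))
      (.seq (whileLt (.reg 8) (.reg 7) examine) (assign 0 (.reg 10)))))

/-- The constants of the main loop are in their registers. -/
structure Loaded (G : Game) (δ η A r : ℝ) (s : Store) : Prop where
  h0 : s.reg 0 = δ
  h1 : s.reg 1 = η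
  h3 : s.reg 3 = G.α
  h4 : s.reg 4 = G.γ
  h5 : s.reg 5 = A
  h6 : s.reg 6 = r
  h7 : s.reg 7 = ⌈1 / δ⌉₊
  h14 : s.reg 14 = r / A ^ 2
  h15 : s.reg 15 = r / A
  h16 : s.reg 16 = r ^ 2 / A ^ 2
  h17 : s.reg 17 = r ^ 2 / A
  hn : s.idx 0 = G.n

lemma Loaded.congr {δ η A r : ℝ} {s t : Store} (H : Loaded G δ η A r s)
    (h : ∀ k < 18, k < 8 ∨ 14 ≤ k → t.reg k = s.reg k) (hn : t.idx 0 = s.idx 0) : Loaded G δ η A r t where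
  h0 := by rw [h 0 (by norm_num) (by norm_num), H.h0]
  h1 := by rw [h 1 (by norm_num) (by norm_num), H.h1]
  h3 := by rw [h 3 (by norm_num) (by norm_num), H.h3]
  h4 := by rw [h 4 (by norm_num) (by norm_num), H.h4]
  h5 := by rw [h 5 (by norm_num) (by norm_num), H.h5]
  h6 := by rw [h 6 (by norm_num) (by norm_num), H.h6]
  h7 := by rw [h 7 (by norm_num) (by norm_num), H.h7]
  h14 := by rw [h 14 (by norm_num) (by norm_num), H.h14]
  h15 := by rw [h 15 (by norm_num) (by norm_num), H.h15]
  h16 := by rw [h 16 (by norm_num) (by norm_num), H.h16]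
  h17 := by rw [h 17 (by norm_num) (by norm_num), H.h17]
  hn := by rw [hn, H.hn]

lemma record_spec {δ η A r ρ X : ℝ} {s : Store} (H : Loaded G δ η A r s) (h11 : s.reg 11 = ρ) (h24 : s.reg 24 = X)
    (hX : 0 < X) {x : Fin G.n → ℝ} (hx : G.total x = X) :
    ∃ t, Exec G record s 20 t ∧ Loaded G δ η A r t ∧ t.reg 8 = s.reg 8 ∧
      ((s.reg 9 < G.revenue ρ x G.full ∧ t.reg 9 = G.revenue ρ x G.full ∧ t.reg 10 = ρ) ∨
        (¬ s.reg 9 < G.revenue ρ x G.full ∧ t.reg 9 = s.reg 9 ∧ t.reg 10 = s.reg 10)) := by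
  have hu := Exec.assign (G := G) (d := 18)
    (e := .traffic (.reg 24) * (.reg 3 / (.const 1 + .reg 3)) * (.const 1 - .reg 11)) s rfl
  have he : (.traffic (.reg 24) * (.reg 3 / (.const 1 + .reg 3)) * (.const 1 - .reg 11) : Ex).eval G s
      = G.revenue ρ x G.full := by
    rw [Game.revenue_full (hx ▸ hX), hx]
    simp [h11, h24, H.h3, max_eq_left hX.le]
  rw [he] at hu
  have hsz : (.traffic (.reg 24) * (.reg 3 / (.const 1 + .reg 3)) * (.const 1 - .reg 11) : Ex).size = 12 := rfl
  rw [hsz] at hu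
  have htest : (Ex.reg 9).eval G (s.put 18 (G.revenue ρ x G.full)) <
      (Ex.reg 18).eval G (s.put 18 (G.revenue ρ x G.full)) ↔ s.reg 9 < G.revenue ρ x G.full := by simp
  by_cases hlt : s.reg 9 < G.revenue ρ x G.full
  · refine ⟨_, (hu.seq (Exec.ifLt_pos rfl rfl (htest.2 hlt) ((Exec.assign _ rfl).seq (Exec.assign _ rfl)))).mono ?_,
      H.congr (fun k hk hk' => ?_) rfl, ?_, Or.inl ⟨hlt, ?_, ?_⟩⟩
    · norm_num [Ex.size]
    · simp [show k ≠ 10 by omega, show k ≠ 9 by omega, show k ≠ 18 by omega]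
    · simp
    · simp
    · simp [h11]
  · refine ⟨_, (hu.seq (Exec.ifLt_neg rfl rfl (htest.not.2 hlt) (Exec.skip _))).mono ?_,
      H.congr (fun k hk hk' => ?_) rfl, ?_, Or.inr ⟨hlt, ?_, ?_⟩⟩
    · norm_num [Ex.size]
    · simp [show k ≠ 18 by omega]
    · simp
    · simp
    · simp

/-- An accepted l is itself the profile of the iteration. After a rejection the lowered profile
takes this role, and the failed test is then correct for it. -/
lemma examine_spec {β δ η A r T : ℝ} {t : ℕ} {s : Store} (hβ : G.StrongModulus β) (hdec : G.DecidesApproxFSE A)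
    (hδ : 0 < δ) (hA : 1 ≤ A) (hr : 0 < r) (hrA : r * A ≤ 1) (hrη : A ^ 2 * r ≤ 4 * η) (hrn : G.n * (2 * r) ≤ δ)
    (hT : ∀ i, 130 * ((A + r / A) / (r / A)) + 50 * (r / A / (r ^ 2 / A ^ 2)) * G.mc i (A + r / A) ≤ T)
    (H : Loaded G δ η A r s) (h8 : s.reg 8 = t) (ht : t + 1 ≤ ⌈1 / δ⌉₊)
    (hst : G.AlgState δ η t (s.reg 10) (s.reg 9)) :
    ∃ u, Exec G examine s (10000 * G.n * (A / (r / A ^ 2)) + (G.n * (T + 50) + 10) + 50) u ∧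
      Loaded G δ η A r u ∧ u.reg 8 = (t + 1 : ℕ) ∧ G.AlgState δ η (t + 1) (u.reg 10) (u.reg 9) := by
  have hA0 : 0 < A := by linarith
  have hα := G.α_pos
  have hμ := G.μ_pos
  have hg := Game.gridPoint_mem δ (t + 1)
  have hgρ := Game.gridPoint_of_le hδ ht
  obtain ⟨ρ, hρe⟩ : ∃ ρ, ρ = Game.gridPoint δ (t + 1) := ⟨_, rfl⟩
  rw [← hρe] at hg hgρ
  obtain ⟨z, hz, -⟩ := Game.existsUnique_isESE hβ hg
  have hT0 : 0 ≤ T := by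
    refine le_trans ?_ (hT ⟨0, by have := G.two_le_n; omega⟩)
    have := G.mc_nonneg ⟨0, by have := G.two_le_n; omega⟩ (A + r / A)
    positivity
  have hinit : Exec G (.seq (assign 8 (.reg 8 + .const 1)) (.seq (assign 11 (.reg 8 / .reg 7))
      (assign 12 ((.const 1 + .reg 3 * .reg 11) / (.const 1 + .reg 3))))) s 18
      (((s.put 8 (t + 1 : ℕ)).put 11 ρ).put 12 ((1 + G.α * ρ) / (1 + G.α))) := by
    have := (Exec.assign (G := G) (d := 8) (e := .reg 8 + .const 1) s rfl).seq
      ((Exec.assign (d := 11) (e := .reg 8 / .reg 7) _ rfl).seq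
        (Exec.assign (d := 12) (e := (.const 1 + .reg 3 * .reg 11) / (.const 1 + .reg 3)) _ rfl))
    have e1 : (Ex.reg 8 + Ex.const 1).eval G s = (t + 1 : ℕ) := by simp [h8]
    have e2 : (Ex.reg 8 / Ex.reg 7).eval G (s.put 8 (t + 1 : ℕ)) = ρ := by simp [H.h7, hgρ]
    have e3 : ((.const 1 + .reg 3 * .reg 11) / (.const 1 + .reg 3) : Ex).eval G
        ((s.put 8 (t + 1 : ℕ)).put 11 ρ) = (1 + G.α * ρ) / (1 + G.α) := by simp [H.h3]
    rw [e1, e2, e3] at this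
    refine this.mono ?_
    rw [show (Ex.reg 8 + Ex.const 1).size = 3 from rfl, show (Ex.reg 8 / Ex.reg 7).size = 3 from rfl,
      show ((.const 1 + .reg 3 * .reg 11) / (.const 1 + .reg 3) : Ex).size = 9 from rfl]
    norm_num
  have H1 : Loaded G δ η A r (((s.put 8 (t + 1 : ℕ)).put 11 ρ).put 12 ((1 + G.α * ρ) / (1 + G.α))) :=
    H.congr (fun k hk hk' => by
      simp [show k ≠ 8 by omega, show k ≠ 11 by omega, show k ≠ 12 by omega]) rfl
  have hκ : (1 + G.α * ρ) / (1 + G.α) * G.μ = G.kap ρ := mul_comm _ _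
  obtain ⟨v, lo, hi, hv, b1, b2, b3, b4, b5, b6, b7, b8⟩ := bisectTotal_spec (κ := G.kap ρ) (A := A)
    (τ := r / A ^ 2) (Game.kap_pos hg) (by rw [Store.put_reg, if_pos rfl, hκ]) H1.h4 H1.h5 H1.h14 hA (by positivity) (by
      rw [div_le_one (by positivity)]
      nlinarith) H1.hn
  obtain ⟨d1, d2, d3, d4, d5⟩ := hdec ρ hg z hz r η lo hi (fun i => v.arr 0 i) hr hrA hrη b1 b2 b3 b4 b5
  have hvr : ∀ k < 20, k ≠ 8 → k ≠ 11 → k ≠ 12 → v.reg k = s.reg k := fun k hk k1 k2 k3 => by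
    rw [b7 k hk]; simp [k1, k2, k3]
  have H2 : Loaded G δ η A r v := H1.congr (fun k hk _ => b7 k (by omega)) (by rw [b8, H1.hn])
  obtain ⟨w, hw, c1, c2, c3⟩ := check_spec (s := v) (κ := G.kap ρ) (A := A) (h := r / A) (tol := r ^ 2 / A ^ 2)
    (tol' := r ^ 2 / A) (r := r) (η := η) (T := T) (l := fun i => v.arr 0 i) (by positivity) (by positivity) hA0.le
    (by rw [b7 12 (by norm_num), Store.put_reg, if_pos rfl, hκ]) H2.h3 H2.h5 H2.h15 H2.h16 H2.h17 H2.h6 H2.h1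
    (fun _ => rfl) b6 b8 (fun i => hr.le.trans (d1 i)) d2 hT0 hT
  have H3 : Loaded G δ η A r w := H2.congr (fun k hk hk' => c1 k (by omega) (by omega)) (by rw [c2, b8])
  have w8 : w.reg 8 = (t + 1 : ℕ) := by rw [c1 8 (by norm_num) (by norm_num), b7 8 (by norm_num)]; simp
  have w9 : w.reg 9 = s.reg 9 := by
    rw [c1 9 (by norm_num) (by norm_num), hvr 9 (by norm_num) (by norm_num) (by norm_num) (by norm_num)]
  have w10 : w.reg 10 = s.reg 10 := by
    rw [c1 10 (by norm_num) (by norm_num), hvr 10 (by norm_num) (by norm_num) (by norm_num) (by norm_num)]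
  have w11 : w.reg 11 = ρ := by rw [c1 11 (by norm_num) (by norm_num), b7 11 (by norm_num)]; simp
  have hnear : ∀ x : Fin G.n → ℝ, (∀ i, 0 ≤ x i) → (∀ i, |x i - z i| ≤ 2 * r) →
      G.NearESE δ (Game.gridPoint δ (t + 1)) x := fun x hx hxz =>
    Game.nearESE_of_abs_sub_le (hρe ▸ hz) hx hxz hrn
  rcases c3 with ⟨g1, g2, g3, g4⟩ | ⟨g1, i, g2, g3⟩
  · have hX : 0 < G.total fun i : Fin G.n => v.arr 0 i := by
      obtain ⟨i⟩ : Nonempty (Fin G.n) := ⟨⟨0, by have := G.two_le_n; omega⟩⟩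
      linarith [d1 i, d2 i]
    obtain ⟨u, hu, H4, u8, hcase⟩ := record_spec H3 w11 g2 hX (x := fun i => v.arr 0 i) rfl
    have hnear' := hnear (fun i => v.arr 0 i) (fun i => hr.le.trans (d1 i)) (fun i => (d3 i).trans (by linarith))
    have htest : (Ex.reg 13).eval G w < (Ex.const 1).eval G w := by simp [g1]
    refine ⟨u, (hinit.seq (hv.seq (hw.seq (Exec.ifLt_pos rfl rfl htest hu)))).mono ?_, H4, u8.trans w8, ?_⟩
    · norm_num [Ex.size]
      linarith
    · rw [w9, w10] at hcase
      rcases hcase with ⟨a1, a2, a3⟩ | ⟨a1, a2, a3⟩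
      · rw [a2, a3, hρe]
        exact Game.AlgState.update _ hst hnear' ⟨hρe ▸ d4 g4, hρe ▸ a1⟩
      · rw [a2, a3]
        exact Game.AlgState.keep _ hst hnear' fun h => a1 (hρe ▸ h.2)
  · have htest : ¬ (Ex.reg 13).eval G w < (Ex.const 1).eval G w := by simp [g1]
    refine ⟨w, (hinit.seq (hv.seq (hw.seq (Exec.ifLt_neg rfl rfl htest (Exec.skip _))))).mono ?_, H3, w8, ?_⟩
    · norm_num [Ex.size]
      linarith
    · rw [w9, w10]
      -- The lowered profile is within 2r of the equilibrium in each coordinate, and n · 2r ≤ δ.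
      refine Game.AlgState.keep _ hst (hnear (Function.update (fun i : Fin G.n => v.arr 0 i) i (v.arr 0 i - r))
        (fun j => ?_) fun j => ?_) fun h => d5 i g2 (hρe ▸ h.1)
      · rcases eq_or_ne j i with rfl | hj
        · simpa using d1 j
        · simpa [hj] using hr.le.trans (d1 j)
      · have h1 := abs_le.1 (d3 j)
        rcases eq_or_ne j i with rfl | hj
        · rw [Function.update_self, abs_le]
          constructor <;> linarith
        · rw [Function.update_of_ne hj, abs_le]
          constructor <;> linarith



/-- Since 4η/δ = A, the program obtains A from its input. The choice r = δ/(A(1+δ)) gives both r A ≤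
δ and r A ≤ 1 without a case distinction. -/
lemma setup_spec {δ A : ℝ} (hδ : 0 < δ) (hA : 0 < A) :
    ∃ t, Exec G setup (G.input δ (A * δ / 4)) 40 t ∧
      ∀ u : Store, (∀ k < 18, k < 7 ∨ 14 ≤ k → u.reg k = t.reg k) → u.reg 7 = ⌈1 / δ⌉₊ → u.idx 0 = t.idx 0 →
        Loaded G δ (A * δ / 4) A (δ / (A * (1 + δ))) u := by
  obtain ⟨s, hs⟩ : ∃ s, s = G.input δ (A * δ / 4) := ⟨_, rfl⟩
  obtain ⟨r, hr⟩ : ∃ r, r = δ / (A * (1 + δ)) := ⟨_, rfl⟩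
  have s0 : s.reg 0 = δ := by rw [hs]; rfl
  have s1 : s.reg 1 = A * δ / 4 := by rw [hs]; rfl
  have s3 : s.reg 3 = G.α := by rw [hs]; rfl
  have s4 : s.reg 4 = G.γ := by rw [hs]; rfl
  have sn : s.idx 0 = G.n := by rw [hs]; rfl
  rw [← hs, ← hr]
  refine ⟨_, ((Exec.assign s rfl).seq ((Exec.assign _ rfl).seq ((Exec.assign _ rfl).seq ((Exec.assign _ rfl).seq
    ((Exec.assign _ rfl).seq (Exec.assign _ rfl)))))).mono ?_, fun u hu h7 hn => ?_⟩
  · rw [show (.const 4 * .reg 1 / .reg 0 : Ex).size = 5 from rfl,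
      show (.reg 0 / (.reg 5 * (.const 1 + .reg 0)) : Ex).size = 7 from rfl,
      show (.reg 6 / (.reg 5 * .reg 5) : Ex).size = 5 from rfl, show (.reg 6 / .reg 5 : Ex).size = 3 from rfl,
      show (.reg 6 * .reg 6 / (.reg 5 * .reg 5) : Ex).size = 7 from rfl,
      show (.reg 6 * .reg 6 / .reg 5 : Ex).size = 5 from rfl]
    norm_num
  · have e5 : 4 * (A * δ / 4) / δ = A := by field_simp
    simp only [Store.put_reg, Ex.eval_hDiv, Ex.eval_hMul, Ex.eval_hAdd, Ex.eval_reg, Ex.eval_const] at hu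
    constructor
    · simpa [s0] using hu 0 (by norm_num) (by norm_num)
    · simpa [s1] using hu 1 (by norm_num) (by norm_num)
    · simpa [s3] using hu 3 (by norm_num) (by norm_num)
    · simpa [s4] using hu 4 (by norm_num) (by norm_num)
    · simpa [s0, s1, e5] using hu 5 (by norm_num) (by norm_num)
    · simpa [s0, s1, e5, hr] using hu 6 (by norm_num) (by norm_num)
    · exact h7
    · simpa [s0, s1, e5, hr, sq] using hu 14 (by norm_num) (by norm_num)
    · simpa [s0, s1, e5, hr, sq] using hu 15 (by norm_num) (by norm_num)
    · simpa [s0, s1, e5, hr, sq] using hu 16 (by norm_num) (by norm_num)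
    · simpa [s0, s1, e5, hr, sq] using hu 17 (by norm_num) (by norm_num)
    · rw [hn, ← sn]; rfl

/-- The ceiling is found by counting upwards, which costs only O(1/δ + 1) steps. -/
lemma countIterations_spec {δ : ℝ} {s : Store} (h0 : s.reg 0 = δ) :
    ∃ t, Exec G countIterations s (10 * ⌈1 / δ⌉₊ + 10) t ∧ t.reg 7 = ⌈1 / δ⌉₊ ∧
      (∀ k, k ≠ 7 → t.reg k = s.reg k) ∧ t.idx = s.idx := by
  obtain ⟨t, ht, ⟨⟨m, hm, hmN⟩, f1, f2⟩, htest⟩ := Exec.whileLt (G := G) (e₁ := .reg 7) (e₂ := .const 1 / .reg 0)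
    (p := assign 7 (.reg 7 + .const 1)) rfl rfl
    (fun t => (∃ m : ℕ, t.reg 7 = m ∧ m ≤ ⌈1 / δ⌉₊) ∧ (∀ k, k ≠ 7 → t.reg k = s.reg k) ∧ t.idx = s.idx)
    (fun t => 10 * (⌈1 / δ⌉₊ - t.reg 7))
    (by
      rintro t ⟨⟨m, hm, hmN⟩, -⟩
      have : (m : ℝ) ≤ ⌈1 / δ⌉₊ := by exact_mod_cast hmN
      rw [hm]
      linarith)
    (by
      rintro t ⟨⟨m, hm, hmN⟩, f1, f2⟩ htest
      simp only [Ex.eval_reg, Ex.eval_hDiv, Ex.eval_const, Rat.cast_one, hm, f1 0 (by norm_num), h0] at htest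
      refine ⟨_, _, Exec.assign _ rfl, ⟨⟨m + 1, by simp [hm], Nat.lt_ceil.2 htest⟩, fun k hk => ?_, f2⟩, ?_⟩
      · simp [hk, f1 k hk]
      · rw [show (Ex.reg 7 + Ex.const 1).size = 3 from rfl, show (Ex.const 1 / Ex.reg 0).size = 3 from rfl]
        simp [Ex.size]
        linarith)
    (s := s.put 7 0) ⟨⟨0, by simp, Nat.zero_le _⟩, fun k hk => by simp [hk], rfl⟩
  simp only [Ex.eval_reg, Ex.eval_hDiv, Ex.eval_const, Rat.cast_one, hm, f1 0 (by norm_num), h0, not_lt] at htest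
  have hinit : Exec G (assign 7 (.const 0)) s 2 (s.put 7 0) := by
    have := Exec.assign (G := G) (d := 7) (e := .const 0) s rfl
    simp only [Ex.eval_const, Rat.cast_zero] at this
    refine this.mono ?_
    norm_num [Ex.size]
  refine ⟨t, (hinit.seq ht).mono ?_, ?_, f1, f2⟩
  · rw [show (Ex.const 1 / Ex.reg 0).size = 3 from rfl, show (Ex.reg 7).size = 1 from rfl]
    simp
    linarith
  · rw [hm, le_antisymm hmN (Nat.ceil_le.2 htest)]

lemma program_spec {β δ A r T K : ℝ} (hβ : G.StrongModulus β) (hdec : G.DecidesApproxFSE A)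
    (hδ : 0 < δ) (hA : 2 * G.n ≤ A) (hre : r = δ / (A * (1 + δ)))
    (hT : ∀ i, 130 * ((A + r / A) / (r / A)) + 50 * (r / A / (r ^ 2 / A ^ 2)) * G.mc i (A + r / A) ≤ T)
    (hK : 10000 * G.n * (A / (r / A ^ 2)) + (G.n * (T + 50) + 10) + 53 ≤ K) (hK0 : 0 ≤ K) :
    ∃ s, Exec G program (G.input δ (A * δ / 4)) ((K + 10) * ⌈1 / δ⌉₊ + 70) s ∧
      G.IsOutput δ (A * δ / 4) (s.reg 0) := by
  have hn := Game.one_le_n (G := G)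
  have hA1 : 1 ≤ A := by linarith
  have hA0 : 0 < A := by linarith
  have hr : 0 < r := by rw [hre]; positivity
  have hrA : r * A = δ / (1 + δ) := by rw [hre]; field_simp
  have hrA1 : r * A ≤ δ := by
    rw [hrA, div_le_iff₀ (by positivity)]
    nlinarith
  have hrA2 : r * A ≤ 1 := by
    rw [hrA, div_le_one (by positivity)]
    linarith
  obtain ⟨t, ht, hload⟩ := setup_spec (G := G) hδ hA0
  have hload0 := hload ((t.put 7 ⌈1 / δ⌉₊)) (fun k hk hk' => by simp [show k ≠ 7 by omega]) (by simp) rfl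
  obtain ⟨u, hu, u7, hur, hui⟩ := countIterations_spec (G := G) (δ := δ) (s := t) (by simpa using hload0.h0)
  have hzero : Exec G (.seq (assign 8 (.const 0)) (.seq (assign 9 (.const 0)) (assign 10 (.const 0)))) u 6
      (((u.put 8 0).put 9 0).put 10 0) := by
    have := (Exec.assign (G := G) (d := 8) (e := .const 0) u rfl).seq ((Exec.assign (d := 9) (e := .const 0) _ rfl).seq
      (Exec.assign (d := 10) (e := .const 0) _ rfl))
    simp only [Ex.eval_const, Rat.cast_zero] at this
    refine this.mono ?_
    norm_num [Ex.size]
  have hload1 : Loaded G δ (A * δ / 4) A r (((u.put 8 0).put 9 0).put 10 0) := by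
    rw [hre]
    exact hload _ (fun k hk hk' => by
      simp [show k ≠ 10 by omega, show k ≠ 9 by omega, show k ≠ 8 by omega, hur k (by omega)]) (by simp [u7])
      (by simp [hui])
  obtain ⟨v, hv, ⟨H, m, hm, hmN, hst⟩, htest⟩ := Exec.whileLt (G := G) (e₁ := .reg 8) (e₂ := .reg 7)
    (p := examine) rfl rfl
    (fun s => Loaded G δ (A * δ / 4) A r s ∧ ∃ m : ℕ, s.reg 8 = m ∧ m ≤ ⌈1 / δ⌉₊ ∧
      G.AlgState δ (A * δ / 4) m (s.reg 10) (s.reg 9))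
    (fun s => K * (⌈1 / δ⌉₊ - s.reg 8))
    (by
      rintro s ⟨-, m, hm, hmN, -⟩
      have : (m : ℝ) ≤ ⌈1 / δ⌉₊ := by exact_mod_cast hmN
      rw [hm]
      exact mul_nonneg hK0 (by linarith))
    (by
      rintro s ⟨H, m, hm, hmN, hst⟩ htest
      simp only [Ex.eval_reg, hm, H.h7] at htest
      have hlt : m < ⌈1 / δ⌉₊ := by exact_mod_cast htest
      obtain ⟨w, hw, H', hw8, hst'⟩ := examine_spec hβ hdec hδ hA1 hr hrA2 (by nlinarith)
        (by nlinarith) hT H hm hlt hst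
      refine ⟨w, _, hw, ⟨H', m + 1, hw8, hlt, hst'⟩, ?_⟩
      rw [hm, hw8, show (Ex.reg 8).size = 1 from rfl, show (Ex.reg 7).size = 1 from rfl]
      push_cast
      linarith)
    (s := ((u.put 8 0).put 9 0).put 10 0) ⟨hload1, 0, by simp, Nat.zero_le _, by
      simpa using Game.AlgState.start⟩
  simp only [Ex.eval_reg, hm, H.h7, not_lt] at htest
  have hmN' : m = ⌈1 / δ⌉₊ := le_antisymm hmN (by exact_mod_cast htest)
  refine ⟨_, (ht.seq (hu.seq (hzero.seq (hv.seq (Exec.assign (d := 0) (e := .reg 10) _ rfl))))).mono ?_, ?_⟩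
  · rw [show (Ex.reg 8).size = 1 from rfl, show (Ex.reg 7).size = 1 from rfl, show (Ex.reg 10).size = 1 from rfl]
    simp
    linarith
  · refine ⟨v.reg 9, ?_⟩
    rw [← hmN']
    simpa using hst

/-- An iteration costs at most K/r = K A (1/δ + 1), and there are at most 1/δ + 1 iterations. The
factor 4 comes from (y + 1)² ≤ 4 max(1, y²). -/
lemma exists_program_bound {β A : ℝ} (hβ : G.StrongModulus β) (hdec : G.DecidesApproxFSE A) (hA : 2 * G.n ≤ A) :
    ∃ B, 0 < B ∧ ∀ δ, 0 < δ → ∃ (k : ℕ) (s : Store), Runs G program (G.input δ (A * δ / 4)) k s ∧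
      G.IsOutput δ (A * δ / 4) (s.reg 0) ∧ (k : ℝ) ≤ B * max 1 (1 / δ ^ 2) := by
  have hn := Game.one_le_n (G := G)
  have hA1 : 1 ≤ A := by linarith
  have hA0 : 0 < A := by linarith
  obtain ⟨m, hm⟩ : ∃ m, m = ∑ i, G.mc i (A + 1) := ⟨_, rfl⟩
  have hm0 : 0 ≤ m := by rw [hm]; exact Finset.sum_nonneg fun i _ => G.mc_nonneg i _
  obtain ⟨K, hK⟩ : ∃ K, K = 10000 * G.n * A ^ 3 + (G.n * (130 * (A ^ 2 + 1) + 50 * A * m + 50) + 10) + 53 := ⟨_, rfl⟩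
  have hK0 : 0 ≤ K := by rw [hK]; positivity
  refine ⟨4 * ((K + 10) * A + 70), by positivity, fun δ hδ => ?_⟩
  obtain ⟨r, hr⟩ : ∃ r, r = δ / (A * (1 + δ)) := ⟨_, rfl⟩
  have hr0 : 0 < r := by rw [hr]; positivity
  have hr1 : r ≤ 1 := by
    rw [hr, div_le_one (by positivity)]
    nlinarith
  have hrA : r / A ≤ 1 := by
    rw [div_le_one hA0]; linarith
  obtain ⟨s, hs, hout⟩ := program_spec (δ := δ) (T := (130 * (A ^ 2 + 1) + 50 * A * m) / r) (K := K / r) hβ hdec hδ hA hr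
    (fun i => by
      have h1 : G.mc i (A + r / A) ≤ m := by
        rw [hm]
        refine (Game.mc_mono G i (by linarith : A + r / A ≤ A + 1)).trans ?_
        exact Finset.single_le_sum (f := fun i => G.mc i (A + 1)) (fun j _ => G.mc_nonneg j _) (Finset.mem_univ i)
      have h2 : (A + r / A) / (r / A) = (A ^ 2 + r) / r := by field_simp
      have h3 : r / A / (r ^ 2 / A ^ 2) = A / r := by field_simp
      rw [h2, h3]
      calc 130 * ((A ^ 2 + r) / r) + 50 * (A / r) * G.mc i (A + r / A)
          ≤ 130 * ((A ^ 2 + 1) / r) + 50 * (A / r) * m := by gcongr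
        _ = (130 * (A ^ 2 + 1) + 50 * A * m) / r := by ring)
    (by
      rw [hK, le_div_iff₀ hr0]
      have h1 : A / (r / A ^ 2) = A ^ 3 / r := by field_simp
      rw [h1]
      have h2 : (10000 * G.n * (A ^ 3 / r) + (G.n * ((130 * (A ^ 2 + 1) + 50 * A * m) / r + 50) + 10) + 53) * r =
          10000 * G.n * A ^ 3 + (G.n * (130 * (A ^ 2 + 1) + 50 * A * m + 50 * r) + 10 * r) + 53 * r := by
        field_simp
      rw [h2]
      gcongr <;> linarith)
    (by positivity)
  obtain ⟨k, s', hk, hks, hsim⟩ := hs _ (Sim.refl _)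
  refine ⟨k, s', hk, hsim.1 0 (by norm_num) ▸ hout, hks.trans ?_⟩
  have hN : (⌈1 / δ⌉₊ : ℝ) ≤ 1 / δ + 1 := (Nat.ceil_lt_add_one (by positivity)).le
  have hKr : K / r = K * A * (1 / δ + 1) := by rw [hr]; field_simp
  obtain ⟨y, hy⟩ : ∃ y, y = 1 / δ := ⟨_, rfl⟩
  have hy0 : 0 ≤ y := by rw [hy]; positivity
  have hmax : (y + 1) ^ 2 ≤ 4 * max 1 (1 / δ ^ 2) := by
    have : 1 / δ ^ 2 = y ^ 2 := by rw [hy]; ring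
    rw [this]
    rcases le_total y 1 with h | h
    · have := le_max_left 1 (y ^ 2)
      nlinarith
    · have := le_max_right 1 (y ^ 2)
      nlinarith
  rw [← hy] at hN hKr ⊢
  have hKA : 0 ≤ K * A := by positivity
  calc (K / r + 10) * (⌈y⌉₊ : ℝ) + 70 ≤ (K / r + 10) * (y + 1) + 70 := by
        have : 0 ≤ K / r + 10 := by positivity
        gcongr
    _ ≤ ((K + 10) * A + 70) * (y + 1) ^ 2 := by
        rw [hKr]
        nlinarith [mul_nonneg hA0.le hy0, mul_nonneg hy0 hy0, mul_nonneg hA0.le (mul_nonneg hy0 hy0)]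
    _ ≤ ((K + 10) * A + 70) * (4 * max 1 (1 / δ ^ 2)) := by gcongr
    _ = _ := by ring

end ContentGame

end

/-! ### Assembly of the theorem -/

theorem mainTheorem1 :
    -- one program, the same for all instances
    ∃ P : ContentGame.Prog, ∀ G : ContentGame.Game, G.StronglyConvexCosts →
      -- the ESE and the optimal revenue are well defined
      (∀ ρ ∈ Set.Icc (0 : ℝ) 1, ∃! x, G.IsESE ρ x) ∧
      IsLUB G.feasibleRevenues G.opt ∧
      ∃ A : ℝ, 0 < A ∧ ∃ B : ℝ, 0 < B ∧ ∀ ε : ℝ, 0 < ε →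
        -- the program executes the algorithm within the time bound, its result being in register `0`
        (∃ (k : ℕ) (s : ContentGame.Store),
          ContentGame.Runs G P (G.input (ε / A) (ε / 4)) k s ∧
          G.IsOutput (ε / A) (ε / 4) (s.reg 0) ∧
          (k : ℝ) ≤ B * max 1 (A ^ 2 / ε ^ 2)) ∧
        -- every possible output of the algorithm has the approximation guarantees
        (∀ ρ' : ℝ, G.IsOutput (ε / A) (ε / 4) ρ' →
          ρ' ∈ Set.Icc (0 : ℝ) 1 ∧
          ∀ x, G.IsESE ρ' x →
            G.IsApproxFSE ε ρ' x ∧ G.opt - ε ≤ G.revenue ρ' x G.full) := by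
  refine ⟨ContentGame.program, fun G hG => ?_⟩
  obtain ⟨β, hβ⟩ : ∃ β, G.StrongModulus β := G.exists_strong_tangent hG
  obtain ⟨θ, q, hb⟩ := ContentGame.Game.exists_bounds hβ
  obtain ⟨C₁, h₁, H₁⟩ := ContentGame.Game.exists_guarantee hβ hb
  obtain ⟨C₂, h₂, H₂⟩ := ContentGame.Game.exists_decidesApproxFSE hβ hb
  have hn := ContentGame.Game.one_le_n (G := G)
  -- One constant serves the guarantees and the test; the term 2n makes n · 2r ≤ A r ≤ δ, so that
  -- lowered profiles remain admissible.
  obtain ⟨A, hA⟩ : ∃ A, A = C₁ + C₂ + 2 * G.n := ⟨_, rfl⟩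
  have hA0 : 0 < A := by linarith
  obtain ⟨B, hB, HB⟩ := ContentGame.exists_program_bound hβ (H₂ A (by linarith)) (by linarith)
  refine ⟨fun ρ hρ => ContentGame.Game.existsUnique_isESE hβ hρ, ContentGame.Game.isLUB_opt hβ hb, A, hA0, B, hB,
    fun ε hε => ⟨?_, fun ρ hρ => ⟨hρ.mem, fun x hx => H₁ A (by linarith) ε hε ρ hρ x hx⟩⟩⟩
  have h := HB (ε / A) (by positivity)
  have e1 : A * (ε / A) / 4 = ε / 4 := by field_simp
  have e2 : 1 / (ε / A) ^ 2 = A ^ 2 / ε ^ 2 := by field_simp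
  rwa [e1, e2] at h
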